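/- Let $L>0$ and let $d_0:[0,L]\to\mathbb R$ be piecewise $W^{1,1}$, i.e. there is a finite partition $0=c_0<c_1<\dots<c_N=L$ such that on each open interval $(c_j,c_{j+1})$ the function $d_0$ is integrable with an integrable weak derivative, and bounded away from zero, i.e. $\operatorname{ess\,inf}_{s\in[0,L]}|d_0(s)|>0$. Put $D(s)=\int_0^s d_0(\alpha)\,d\alpha$, let $T_r=e^{ir\partial_x^2}$ be the free Schrödinger evolution on $L^2(\mathbb R)$, and for $f_1,\dots,f_4\in L^2(\mathbb R)$ let $$\mathcal Q(f_1,f_2,f_3,f_4)=\frac1L\int_0^L\int_{\mathbb R}\overline{T_{D(s)}f_1(x)}\,T_{D(s)}f_2(x)\,\overline{T_{D(s)}f_3(x)}\,T_{D(s)}f_4(x)\,dx\,ds .$$ Let $\omega>0$ and $d_{\mathrm{av}}\ge 0$, and let $f$ be a weak solution of the dispersion management equation, i.e. $f\in H^1(\mathbb R)$ if $d_{\mathrm{av}}>0$, respectively $f\in L^2(\mathbb R)$ if $d_{\mathrm{av}}=0$, and $$-\omega\langle g,f\rangle=d_{\mathrm{av}}\langle g',f'\rangle-\mathcal Q(g,f,f,f)\qquad\text{for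 all } g\in H^1(\mathbb R),$$ where $\langle g,f\rangle=\int_{\mathbb R}\overline{g(x)}f(x)\,dx$ and the term with the derivatives is absent if $d_{\mathrm{av}}=0$. Then there is $\mu>0$ such that $f$ and its Fourier transform $\widehat f$, where $\widehat f(k)=\frac1{\sqrt{2\pi}}\int_{\mathbb R}e^{ikx}f(x)\,dx$ (extended to $L^2(\mathbb R)$ as a unitary operator), both agree almost everywhere on $\mathbb R$ with the restriction of a function that is analytic in the strip $\{z\in\mathbb C:|\operatorname{Im}z|<\mu\}$. -/

import Mathlib

open MeasureTheory Set FourierTransform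
open scoped ENNReal SchwartzMap LineDeriv ComplexInnerProductSpace ComplexConjugate

namespace DispersionManagement

noncomputable section

/-- Complex-valued square integrable functions on the real line, modulo equality a.e. -/
abbrev L2 : Type := Lp ℂ 2 (volume : Measure ℝ)

/-! ### The dispersion profile -/

/-- `d` is integrable on `(a, b)` and has an integrable weak derivative there. -/
def MemW11 (d : ℝ → ℝ) (a b : ℝ) : Prop :=
  IntegrableOn d (Ioo a b) ∧
    ∃ d' : ℝ → ℝ, IntegrableOn d' (Ioo a b) ∧
      ∀ φ : ℝ → ℝ, ContDiff ℝ (⊤ : ℕ∞) φ → HasCompactSupport φ → tsupport φ ⊆ Ioo a b →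
        ∫ s in Ioo a b, d s * deriv φ s = - ∫ s in Ioo a b, d' s * φ s

/-- `d₀` is piecewise `W^{1,1}` on `[0, L]`: for some finite partition
`0 = c₀ < c₁ < … < c_N = L`, it is `W^{1,1}` on each of the open intervals of the partition. -/
def PiecewiseW11 (d₀ : ℝ → ℝ) (L : ℝ) : Prop :=
  ∃ (N : ℕ) (c : Fin (N + 1) → ℝ), StrictMono c ∧ c 0 = 0 ∧ c (Fin.last N) = L ∧
    ∀ j : Fin N, MemW11 d₀ (c j.castSucc) (c j.succ)

/-- `d₀` is bounded away from zero on `[0, L]`. -/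
def BoundedAwayFromZero (d₀ : ℝ → ℝ) (L : ℝ) : Prop :=
  0 < essInf (fun s => |d₀ s|) (volume.restrict (Icc 0 L))

/-- The accumulated dispersion `D(s) = ∫₀ˢ d₀(α) dα`. -/
def accDispersion (d₀ : ℝ → ℝ) (s : ℝ) : ℝ := ∫ α in (0 : ℝ)..s, d₀ α

/-! ### The free Schrödinger evolution -/

/-- The symbol of `e^{i r ∂ₓ²}`. Mathlib's Fourier transform has kernel `e^{-2π i x ξ}`, so
`∂ₓ²` corresponds to multiplication by `-(2 π ξ)²`. -/
def freeSymbol (r : ℝ) (ξ : ℝ) : ℂ :=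
  Complex.exp (-(Complex.I * (r * (2 * Real.pi * ξ) ^ 2 : ℝ)))

theorem norm_freeSymbol (r ξ : ℝ) : ‖freeSymbol r ξ‖ = 1 := by
  have h : freeSymbol r ξ
      = Complex.exp ((-(r * (2 * Real.pi * ξ) ^ 2) : ℝ) * Complex.I) := by
    unfold freeSymbol; congr 1; push_cast; ring
  rw [h, Complex.norm_exp_ofReal_mul_I]

theorem memLp_freeSymbol (r : ℝ) : MemLp (freeSymbol r) ∞ (volume : Measure ℝ) := by
  refine memLp_top_of_bound ?_ 1 (Filter.Eventually.of_forall fun ξ => (norm_freeSymbol r ξ).le)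
  refine Continuous.aestronglyMeasurable ?_
  unfold freeSymbol
  fun_prop

/-- `T_r = e^{i r ∂ₓ²}` on `L²(ℝ)`, as a Fourier multiplier. -/
def freeEvolution (r : ℝ) (f : L2) : L2 :=
  𝓕⁻ ((memLp_freeSymbol r).toLp (freeSymbol r) • (𝓕 f : L2) : L2)

/-- The four-linear functional
`𝒬(f₁,f₂,f₃,f₄) = L⁻¹ ∫₀ᴸ ∫ conj(T_{D(s)} f₁) T_{D(s)} f₂ conj(T_{D(s)} f₃) T_{D(s)} f₄ dx ds`. -/
def calQ (d₀ : ℝ → ℝ) (L : ℝ) (f₁ f₂ f₃ f₄ : L2) : ℂ :=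
  (1 / (L : ℂ)) * ∫ s in (0 : ℝ)..L, ∫ x : ℝ,
    conj (freeEvolution (accDispersion d₀ s) f₁ x) * freeEvolution (accDispersion d₀ s) f₂ x *
      conj (freeEvolution (accDispersion d₀ s) f₃ x) * freeEvolution (accDispersion d₀ s) f₄ x

/-! ### Sobolev functions and weak solutions -/

/-- `f ∈ H¹(ℝ)`. -/
def MemH1 (f : L2) : Prop := TemperedDistribution.MemSobolev 1 2 (f : 𝓢'(ℝ, ℂ))

/-- The distributional derivative of `f ∈ L²` is (represented by) `f' ∈ L²`. -/
def IsWeakDeriv (f f' : L2) : Prop :=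
  TemperedDistribution.derivCLM ℂ (f : 𝓢'(ℝ, ℂ)) = (f' : 𝓢'(ℝ, ℂ))

theorem MemH1.exists_isWeakDeriv {f : L2} (hf : MemH1 f) : ∃ f' : L2, IsWeakDeriv f f' := by
  have h := TemperedDistribution.MemSobolev.lineDerivOp hf (m := (1 : ℝ))
  rw [sub_self, TemperedDistribution.memSobolev_zero_iff] at h
  obtain ⟨f', hf'⟩ := h
  refine ⟨f', ?_⟩
  unfold IsWeakDeriv
  rw [← hf']
  ext g
  rw [TemperedDistribution.derivCLM_apply_apply, TemperedDistribution.lineDerivOp_apply_apply]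
  congr 1

open Classical in
/-- The weak derivative of an `H¹` function, as an element of `L²`
(and `0` if the distributional derivative is not in `L²`). -/
def weakDeriv (f : L2) : L2 :=
  if h : ∃ f' : L2, IsWeakDeriv f f' then h.choose else 0

theorem MemH1.isWeakDeriv {f : L2} (hf : MemH1 f) : IsWeakDeriv f (weakDeriv f) := by
  rw [weakDeriv, dif_pos hf.exists_isWeakDeriv]
  exact hf.exists_isWeakDeriv.choose_spec

/-- `f` is a weak solution of the dispersion management equation
`-ω ⟨g, f⟩ = d_av ⟨g', f'⟩ - 𝒬(g, f, f, f)` for all `g ∈ H¹(ℝ)`. Here `f ∈ H¹(ℝ)` if `d_av > 0`;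
if `d_av = 0`, then `f ∈ L²(ℝ)` only and the term with the derivatives is absent. -/
structure IsWeakSolution (d₀ : ℝ → ℝ) (L dav ω : ℝ) (f : L2) : Prop where
  memH1 : 0 < dav → MemH1 f
  eq : ∀ g : L2, MemH1 g →
    -(ω : ℂ) * ⟪g, f⟫ = (dav : ℂ) * ⟪weakDeriv g, weakDeriv f⟫ - calQ d₀ L g f f f

/-! ### Fourier transform and analyticity -/

/-- The Fourier transform `f̂(k) = (2π)^{-1/2} ∫ e^{i k x} f(x) dx` on `L²(ℝ)`, expressed through
Mathlib's `L²` Fourier transform with kernel `e^{-2π i x ξ}` at `ξ = -k / (2π)`. -/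
def fourierHat (f : L2) (k : ℝ) : ℂ :=
  ((√(2 * Real.pi) : ℝ) : ℂ)⁻¹ * (𝓕 f : L2) (-k / (2 * Real.pi))

/-- `u` agrees almost everywhere on the real line with (the restriction of) an analytic function on
the strip `{z : |Im z| < μ}`. -/
def AnalyticInStrip (u : ℝ → ℂ) (μ : ℝ) : Prop :=
  ∃ F : ℂ → ℂ, AnalyticOnNhd ℂ F {z : ℂ | |z.im| < μ} ∧ ∀ᵐ x : ℝ, u x = F (x : ℂ)

end

end DispersionManagement

/-! Exponential decay of `f` in the `L²` sense makes its Fourier transform analytic in a strip, and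
decay of the transform does the same for `f`. So it suffices to find `μ > 0` with `e^{μ|x|} f` and
`e^{μ|x|} 𝓕 f` in `L²`. One argument gives both, because `𝒬` has the same shape in space and in
frequency.

In frequency `T_r` multiplies by a quadratic phase, and the phases at `k`, `k+p`, `k+p+q`, `k+q`
combine to a multiple of `pq`. Hence the quartic integral is an integral of `conj g₁(k) g₂(k+p) conj
g₃(k+p+q) g₄(k+q)` against `e^{iθr}` with `θ` proportional to `pq`. In space `T_r` is a chirp, a
Fourier transform, a dilation and another chirp, which gives the same integral with the kernel
`e^{iθ/r}/|r|`. Integrating over `r = D(s)`, where the density `1/|d₀|` has bounded variation on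
each piece, bounds either kernel by a constant times `min(|θ|^{-1/4}, |θ|^{-3/4})`. So
`|𝒬(g,f,f,f)|` is controlled by `majorant` on both sides (`exists_enorm_calQ_le`).

The majorant is bounded on `L²`, with a gain when the supports of the first and third functions, or
of the second and fourth, are far apart (`majorant_le_of_separated`).

Testing the weak equation with `g = (ω - d_av ∂²)⁻¹ v` turns it into `⟨v, f⟩ = 𝒬(g, f, f, f)`, an
estimate of `f` by three copies of itself. Since `k = (k+p) - (k+p+q) + (k+q)`, an exponential
weight on the first slot moves onto the other three. With the weight capped at `2^j`, the weighted
norm `ν` of `f` outside `[-4n, 4n]` satisfies `ν ≤ δ_n + Γ ν³` with `δ_n → 0` uniformly in `j`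
(`tail_estimate`). Raising `j` by one at most doubles `ν`, so starting from a small tail `ν` never
leaves the small branch of this inequality. The bound is uniform in `j`, and Fatou removes the cap
(`exists_exponential_decay`). -/

namespace DispersionManagement

noncomputable section

/-! ### The majorant of the four-linear functional -/

/-- The decreasing weight `min (t ^ (-1/4)) (t ^ (-3/4))`. -/
def weight (t : ℝ≥0∞) : ℝ≥0∞ := min (t ^ (-(1 / 4) : ℝ)) (t ^ (-(3 / 4) : ℝ))

theorem weight_antitone : Antitone weight := fun x y h => by
  unfold weight
  simp only [ENNReal.rpow_neg]
  gcongr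

@[fun_prop]
theorem measurable_weight : Measurable weight := by
  unfold weight; fun_prop

/-- `∫∫∫ h₁(k) h₂(k+p) h₃(k+p+q) h₄(k+q) w(pq) dk dp dq`. -/
def majorant (h₁ h₂ h₃ h₄ : ℝ → ℝ≥0∞) : ℝ≥0∞ :=
  ∫⁻ k, ∫⁻ p, ∫⁻ q, h₁ k * h₂ (k + p) * h₃ (k + p + q) * h₄ (k + q) * weight ‖p * q‖ₑ

/-- Twice the integral of the weight over `max (p²) (|p| S / 2)`. -/
def weightTail (S : ℝ≥0∞) : ℝ≥0∞ := 2 * ∫⁻ p : ℝ, weight (‖p‖ₑ * max ‖p‖ₑ (S / 2))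

theorem weightTail_antitone : Antitone weightTail := fun S T h => by
  unfold weightTail
  gcongr 2 * ?_
  refine lintegral_mono fun p => weight_antitone ?_
  gcongr

theorem integrable_comp_abs {f : ℝ → ℝ} (hf : IntegrableOn f (Ioi 0)) :
    Integrable fun x => f |x| := by
  rw [← integrableOn_univ, ← Iic_union_Ioi (a := (0 : ℝ))]
  have h1 : IntegrableOn (fun x => f |x|) (Ioi 0) :=
    hf.congr_fun (fun x hx => by simp only [abs_of_pos (mem_Ioi.1 hx)]) measurableSet_Ioi
  refine IntegrableOn.union ?_ h1
  have h2 := h1.comp_neg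
  simpa [← integrableOn_Iic_iff_integrableOn_Iio] using h2

/-- This fixes the exponents of the weight: at `p²` it behaves like `|p|^{-1/2}` near zero and
`|p|^{-3/2}` at infinity, both integrable. -/
theorem lintegral_weight_sq_lt_top : ∫⁻ p : ℝ, weight (‖p‖ₑ * ‖p‖ₑ) < ∞ := by
  set f : ℝ → ℝ := fun p => min (p ^ (-(1 / 2) : ℝ)) (p ^ (-(3 / 2) : ℝ)) with hf
  have hfm : Measurable f := by fun_prop
  have hint : IntegrableOn f (Ioi 0) := by
    rw [← Ioc_union_Ioi_eq_Ioi (zero_le_one' ℝ)]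
    refine IntegrableOn.union ?_ ?_
    · have h : IntegrableOn (fun p : ℝ => p ^ (-(1 / 2) : ℝ)) (Ioc 0 1) :=
        (intervalIntegrable_iff_integrableOn_Ioc_of_le zero_le_one).1
          (intervalIntegral.intervalIntegrable_rpow' (by norm_num))
      refine h.mono' hfm.aestronglyMeasurable ?_
      filter_upwards [ae_restrict_mem measurableSet_Ioc] with p hp
      rw [Real.norm_of_nonneg (le_min (Real.rpow_nonneg hp.1.le _) (Real.rpow_nonneg hp.1.le _))]
      exact min_le_left _ _
    · have h : IntegrableOn (fun p : ℝ => p ^ (-(3 / 2) : ℝ)) (Ioi 1) :=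
        (integrableOn_Ioi_rpow_iff one_pos).2 (by norm_num)
      refine h.mono' hfm.aestronglyMeasurable ?_
      filter_upwards [ae_restrict_mem measurableSet_Ioi] with p hp
      have hp0 : (0 : ℝ) ≤ p := zero_le_one.trans (le_of_lt hp)
      rw [Real.norm_of_nonneg (le_min (Real.rpow_nonneg hp0 _) (Real.rpow_nonneg hp0 _))]
      exact min_le_right _ _
  have h2 := (integrable_comp_abs hint).lintegral_lt_top
  refine lt_of_le_of_lt (lintegral_mono_ae ?_) h2
  have h0 : ∀ᵐ p : ℝ, p ≠ 0 := by simp [ae_iff, measure_singleton]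
  filter_upwards [h0] with p hp
  have hp' : 0 < |p| := abs_pos.2 hp
  have e1 : ‖p‖ₑ * ‖p‖ₑ = ENNReal.ofReal (|p| * |p|) := by
    rw [ENNReal.ofReal_mul hp'.le, ← Real.norm_eq_abs, ofReal_norm]
  have e2 : ∀ a : ℝ, (|p| * |p|) ^ a = |p| ^ (2 * a) := fun a => by
    rw [← sq, ← Real.rpow_natCast, ← Real.rpow_mul hp'.le]; norm_num
  rw [e1, weight, ENNReal.ofReal_rpow_of_pos (by positivity),
    ENNReal.ofReal_rpow_of_pos (by positivity), e2, e2, hf]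
  norm_num [ENNReal.ofReal_min]

theorem weightTail_zero_lt_top : weightTail 0 < ∞ := by
  have := lintegral_weight_sq_lt_top
  simp only [weightTail, ENNReal.zero_div, zero_le, max_eq_left]
  exact ENNReal.mul_lt_top (by simp) this

/-- Dominated convergence, with the integrand at `S = 0` as dominating function. -/
theorem tendsto_weightTail :
    Filter.Tendsto (fun n : ℕ => weightTail n) Filter.atTop (nhds 0) := by
  have key : Filter.Tendsto (fun n : ℕ => ∫⁻ p : ℝ, weight (‖p‖ₑ * max ‖p‖ₑ ((n : ℝ≥0∞) / 2)))
      Filter.atTop (nhds (∫⁻ _ : ℝ, 0)) := by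
    refine tendsto_lintegral_of_dominated_convergence (fun p => weight (‖p‖ₑ * ‖p‖ₑ))
      (fun n => by fun_prop) (fun n => Filter.Eventually.of_forall fun p => weight_antitone ?_)
      lintegral_weight_sq_lt_top.ne ?_
    · gcongr; exact le_max_left _ _
    · have h0 : ∀ᵐ p : ℝ, p ≠ 0 := by simp [ae_iff, measure_singleton]
      filter_upwards [h0] with p hp
      have h1 : Filter.Tendsto (fun n : ℕ => ‖p‖ₑ / 2 * (n : ℝ≥0∞)) Filter.atTop (nhds ∞) := by
        have := ENNReal.Tendsto.const_mul (a := ‖p‖ₑ / 2) ENNReal.tendsto_nat_nhds_top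
          (Or.inl ENNReal.top_ne_zero)
        rwa [ENNReal.mul_top (by simp [hp])] at this
      have h2 : Filter.Tendsto (fun n : ℕ => (‖p‖ₑ / 2 * (n : ℝ≥0∞)) ^ (-(1 / 4) : ℝ)) Filter.atTop
          (nhds 0) := by
        have := (ENNReal.continuous_rpow_const (y := (-(1 / 4) : ℝ))).tendsto ∞ |>.comp h1
        rwa [ENNReal.top_rpow_of_neg (by norm_num)] at this
      refine tendsto_of_tendsto_of_tendsto_of_le_of_le tendsto_const_nhds h2
        (fun _ => zero_le) fun n => ?_
      refine (weight_antitone ?_).trans (min_le_left _ _)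
      calc ‖p‖ₑ / 2 * (n : ℝ≥0∞) = ‖p‖ₑ * ((n : ℝ≥0∞) / 2) := by
            simp only [div_eq_mul_inv]; ring
        _ ≤ _ := by gcongr; exact le_max_right _ _
  have := ENNReal.Tendsto.const_mul (a := 2) key (Or.inr (by simp))
  simpa [weightTail] using this

/-- Of the two numbers `p` and `s - p`, the one of larger absolute value is at least as large as the
other and at least `|s|/2`. The reflection `p ↦ s - p` exchanges the two cases, hence the factor 2
in `weightTail`. -/
theorem lintegral_weight_le (s : ℝ) :
    ∫⁻ p : ℝ, weight ‖p * (s - p)‖ₑ ≤ weightTail ‖s‖ₑ := by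
  set g : ℝ → ℝ≥0∞ := fun p => weight (‖p‖ₑ * max ‖p‖ₑ (‖s‖ₑ / 2)) with hg
  have hgm : Measurable g := by fun_prop
  have aux : ∀ p r : ℝ, |p| ≤ |r| → p + r = s → weight ‖p * r‖ₑ ≤ g p := by
    rintro p r h rfl
    refine weight_antitone ?_
    rw [enorm_mul]
    gcongr
    refine max_le ?_ ?_
    · simpa [enorm_eq_nnnorm, ← NNReal.coe_le_coe] using h
    · refine ENNReal.div_le_of_le_mul' ?_
      rw [two_mul]
      refine (enorm_add_le _ _).trans ?_
      gcongr
      simpa [enorm_eq_nnnorm, ← NNReal.coe_le_coe] using h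
  calc ∫⁻ p : ℝ, weight ‖p * (s - p)‖ₑ ≤ ∫⁻ p : ℝ, (g p + g (s - p)) := by
        refine lintegral_mono fun p => ?_
        rcases le_total |p| |s - p| with h | h
        · exact (aux p (s - p) h (by ring)).trans le_self_add
        · rw [mul_comm]
          exact (aux (s - p) p h (by ring)).trans le_add_self
    _ = weightTail ‖s‖ₑ := by
        rw [lintegral_add_left hgm, lintegral_sub_left_eq_self g s, weightTail, two_mul]

/-- With `s = p + q` in place of `q`, the product `f k * g (k + s)` no longer involves `p`, and the
weight can be integrated in `p` first. -/
theorem lintegral_pair_le {f g : ℝ → ℝ≥0∞} (hf : Measurable f) (hg : Measurable g)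
    (S : ℝ≥0∞) :
    ∫⁻ k : ℝ, ∫⁻ p : ℝ, ∫⁻ q : ℝ,
      (if S ≤ ‖p + q‖ₑ then f k * g (k + p + q) * weight ‖p * q‖ₑ else 0) ≤
      weightTail S * (∫⁻ k, f k) * (∫⁻ k, g k) := by
  have e : ∀ k p : ℝ, (∫⁻ q : ℝ,
      (if S ≤ ‖p + q‖ₑ then f k * g (k + p + q) * weight ‖p * q‖ₑ else 0)) =
      ∫⁻ s : ℝ, (if S ≤ ‖s‖ₑ then f k * g (k + s) * weight ‖p * (s - p)‖ₑ else 0) := fun k p => by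
    rw [← lintegral_add_left_eq_self (fun s : ℝ =>
      if S ≤ ‖s‖ₑ then f k * g (k + s) * weight ‖p * (s - p)‖ₑ else 0) p]
    simp only [add_assoc, add_sub_cancel_left]
  simp only [e]
  calc _ = ∫⁻ k : ℝ, ∫⁻ s : ℝ, ∫⁻ p : ℝ,
        (if S ≤ ‖s‖ₑ then f k * g (k + s) * weight ‖p * (s - p)‖ₑ else 0) := by
        refine lintegral_congr fun k => lintegral_lintegral_swap (Measurable.aemeasurable ?_)
        refine Measurable.ite ?_ (by fun_prop) measurable_const
        exact measurableSet_le measurable_const (by fun_prop)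
    _ ≤ ∫⁻ k : ℝ, ∫⁻ s : ℝ, f k * g (k + s) * weightTail S := by
        refine lintegral_mono fun k => lintegral_mono fun s => ?_
        by_cases h : S ≤ ‖s‖ₑ
        · simp only [h, if_true]
          rw [lintegral_const_mul _ (by fun_prop)]
          gcongr
          exact (lintegral_weight_le s).trans (weightTail_antitone h)
        · simp [h]
    _ = _ := by
        have : ∀ k, ∫⁻ s : ℝ, f k * g (k + s) * weightTail S =
            f k * (weightTail S * ∫⁻ s, g s) := fun k => by
          rw [lintegral_mul_const _ (by fun_prop), lintegral_const_mul _ (by fun_prop),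
            lintegral_add_left_eq_self g k]
          ring
        simp only [this]
        rw [lintegral_mul_const _ hf]
        ring

/-- Translating `k` by `-p` and then reflecting `p` turns `p - q` into `p + q` up to sign and
reduces this to `lintegral_pair_le`. -/
theorem lintegral_pair_le' {f g : ℝ → ℝ≥0∞} (hf : Measurable f) (hg : Measurable g)
    (S : ℝ≥0∞) :
    ∫⁻ k : ℝ, ∫⁻ p : ℝ, ∫⁻ q : ℝ,
      (if S ≤ ‖p - q‖ₑ then f (k + p) * g (k + q) * weight ‖p * q‖ₑ else 0) ≤
      weightTail S * (∫⁻ k, f k) * (∫⁻ k, g k) := by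
  have e0 : ∀ k p : ℝ, (∫⁻ q : ℝ,
      (if S ≤ ‖p - q‖ₑ then f (k + p) * g (k + q) * weight ‖p * q‖ₑ else 0)) =
      ∫⁻ q : ℝ, (if S ≤ ‖-p + q‖ₑ then f (k + p) * g (k + p + (-p + q)) * weight ‖-p * q‖ₑ
        else 0) := fun k p => by
    refine lintegral_congr fun q => ?_
    rw [← enorm_neg (p - q), neg_sub, sub_eq_neg_add, ← add_assoc, add_neg_cancel_right, neg_mul,
      enorm_neg]
  have hm : Measurable fun z : ℝ × ℝ => ∫⁻ q : ℝ,
      (if S ≤ ‖-z.2 + q‖ₑ then f (z.1 + z.2) * g (z.1 + z.2 + (-z.2 + q)) * weight ‖-z.2 * q‖ₑ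
        else 0) := by
    refine Measurable.lintegral_prod_right (f := fun (z : ℝ × ℝ) (q : ℝ) => 
      if S ≤ ‖-z.2 + q‖ₑ then f (z.1 + z.2) * g (z.1 + z.2 + (-z.2 + q)) * weight ‖-z.2 * q‖ₑ
        else 0) (Measurable.ite ?_ (by fun_prop) measurable_const)
    exact measurableSet_le measurable_const (by fun_prop)
  have hm' : Measurable fun z : ℝ × ℝ => ∫⁻ q : ℝ,
      (if S ≤ ‖-z.2 + q‖ₑ then f z.1 * g (z.1 + (-z.2 + q)) * weight ‖-z.2 * q‖ₑ
        else 0) := by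
    refine Measurable.lintegral_prod_right (f := fun (z : ℝ × ℝ) (q : ℝ) => 
      if S ≤ ‖-z.2 + q‖ₑ then f z.1 * g (z.1 + (-z.2 + q)) * weight ‖-z.2 * q‖ₑ
        else 0) (Measurable.ite ?_ (by fun_prop) measurable_const)
    exact measurableSet_le measurable_const (by fun_prop)
  simp only [e0]
  rw [lintegral_lintegral_swap hm.aemeasurable]
  have e1 : ∀ p : ℝ, (∫⁻ k : ℝ, ∫⁻ q : ℝ,
      (if S ≤ ‖-p + q‖ₑ then f (k + p) * g (k + p + (-p + q)) * weight ‖-p * q‖ₑ else 0)) =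
      ∫⁻ k : ℝ, ∫⁻ q : ℝ,
      (if S ≤ ‖-p + q‖ₑ then f k * g (k + (-p + q)) * weight ‖-p * q‖ₑ else 0) := fun p =>
    lintegral_add_right_eq_self (fun k => ∫⁻ q : ℝ,
      (if S ≤ ‖-p + q‖ₑ then f k * g (k + (-p + q)) * weight ‖-p * q‖ₑ else 0)) p
  simp only [e1]
  rw [← lintegral_lintegral_swap hm'.aemeasurable]
  have e2 : ∀ k : ℝ, (∫⁻ p : ℝ, ∫⁻ q : ℝ,
      (if S ≤ ‖-p + q‖ₑ then f k * g (k + (-p + q)) * weight ‖-p * q‖ₑ else 0)) =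
      ∫⁻ p : ℝ, ∫⁻ q : ℝ,
      (if S ≤ ‖p + q‖ₑ then f k * g (k + p + q) * weight ‖p * q‖ₑ else 0) := fun k => by
    simp only [add_assoc]
    exact lintegral_neg_eq_self (fun p : ℝ => ∫⁻ q : ℝ,
      (if S ≤ ‖p + q‖ₑ then f k * g (k + (p + q)) * weight ‖p * q‖ₑ else 0))
  simp only [e2]
  exact lintegral_pair_le hf hg S

/-! ### Boundedness of the majorant and the gain from separated supports -/

/-- The square root of `weightTail`. -/
def decay (S : ℝ≥0∞) : ℝ≥0∞ := weightTail S ^ (1 / 2 : ℝ)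

/-- Cauchy–Schwarz, half of the weight going to the pair `h₁, h₃` and half to `h₂, h₄`. The
arguments of the first pair differ by `p + q`, those of the second by `p - q`, so each pair gains
from its own separation. On the support of the integrand the separation conditions hold, so they can
be inserted for free. -/
theorem majorant_le_of_separated {h₁ h₂ h₃ h₄ : ℝ → ℝ≥0∞} (m₁ : Measurable h₁)
    (m₂ : Measurable h₂) (m₃ : Measurable h₃) (m₄ : Measurable h₄) (S T : ℝ≥0∞)
    (hST : ∀ k p q, h₁ k ≠ 0 → h₂ (k + p) ≠ 0 → h₃ (k + p + q) ≠ 0 → h₄ (k + q) ≠ 0 →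
      S ≤ ‖p + q‖ₑ ∧ T ≤ ‖p - q‖ₑ) :
    majorant h₁ h₂ h₃ h₄ ≤ decay S * decay T *
      (eLpNorm h₁ 2 * eLpNorm h₂ 2 * eLpNorm h₃ 2 * eLpNorm h₄ 2) := by
  set A : ℝ × ℝ × ℝ → ℝ≥0∞ := fun z => if S ≤ ‖z.2.1 + z.2.2‖ₑ then
    h₁ z.1 * h₃ (z.1 + z.2.1 + z.2.2) * weight ‖z.2.1 * z.2.2‖ₑ ^ (1 / 2 : ℝ) else 0 with hA
  set B : ℝ × ℝ × ℝ → ℝ≥0∞ := fun z => if T ≤ ‖z.2.1 - z.2.2‖ₑ then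
    h₂ (z.1 + z.2.1) * h₄ (z.1 + z.2.2) * weight ‖z.2.1 * z.2.2‖ₑ ^ (1 / 2 : ℝ) else 0 with hB
  have mA : Measurable A := Measurable.ite (measurableSet_le measurable_const (by fun_prop))
    (by fun_prop) measurable_const
  have mB : Measurable B := Measurable.ite (measurableSet_le measurable_const (by fun_prop))
    (by fun_prop) measurable_const
  have prod3 : ∀ F : ℝ × ℝ × ℝ → ℝ≥0∞, Measurable F →
      ∫⁻ z, F z = ∫⁻ k, ∫⁻ p, ∫⁻ q, F (k, p, q) := fun F hF => by
    rw [Measure.volume_eq_prod, lintegral_prod _ hF.aemeasurable]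
    refine lintegral_congr fun k => ?_
    rw [Measure.volume_eq_prod, lintegral_prod _ (by fun_prop)]
  have step1 : majorant h₁ h₂ h₃ h₄ ≤ ∫⁻ z, (A * B) z := by
    rw [prod3 _ (mA.mul mB), majorant]
    refine lintegral_mono fun k => lintegral_mono fun p => lintegral_mono fun q => ?_
    by_cases H : h₁ k ≠ 0 ∧ h₂ (k + p) ≠ 0 ∧ h₃ (k + p + q) ≠ 0 ∧ h₄ (k + q) ≠ 0
    · obtain ⟨hS, hT⟩ := hST k p q H.1 H.2.1 H.2.2.1 H.2.2.2
      simp only [Pi.mul_apply, hA, hB, hS, hT, if_true]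
      have hw : weight ‖p * q‖ₑ = weight ‖p * q‖ₑ ^ (1 / 2 : ℝ) * weight ‖p * q‖ₑ ^ (1 / 2 : ℝ) := by
        rw [← ENNReal.rpow_add_of_nonneg _ _ (by norm_num) (by norm_num)]; norm_num
      conv_lhs => rw [hw]
      exact le_of_eq (by ring)
    · have : h₁ k * h₂ (k + p) * h₃ (k + p + q) * h₄ (k + q) = 0 := by
        simp only [mul_eq_zero]; tauto
      rw [this, zero_mul]; exact zero_le
  have hsq : ∀ (h : ℝ → ℝ≥0∞), (∫⁻ k, h k ^ 2) ^ (1 / 2 : ℝ) = eLpNorm h 2 := fun h => by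
    rw [eLpNorm_eq_lintegral_rpow_enorm_toReal (by simp) (by simp)]
    simp
  have hwsq : ∀ x : ℝ≥0∞, (x ^ (1 / 2 : ℝ)) ^ 2 = x := fun x => by
    rw [← ENNReal.rpow_natCast, ← ENNReal.rpow_mul]; norm_num
  have step2 := ENNReal.lintegral_mul_le_Lp_mul_Lq volume Real.HolderConjugate.two_two
    mA.aemeasurable mB.aemeasurable
  have hAint : ∫⁻ z, A z ^ (2 : ℝ) ≤ weightTail S * (∫⁻ k, h₁ k ^ 2) * (∫⁻ k, h₃ k ^ 2) := by
    rw [prod3 _ (by fun_prop)]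
    refine le_trans (le_of_eq ?_) (lintegral_pair_le (m₁.pow_const 2) (m₃.pow_const 2) S)
    refine lintegral_congr fun k => lintegral_congr fun p => lintegral_congr fun q => ?_
    simp only [hA]
    split_ifs
    · rw [ENNReal.rpow_ofNat, mul_pow, mul_pow, hwsq]
    · simp
  have hBint : ∫⁻ z, B z ^ (2 : ℝ) ≤ weightTail T * (∫⁻ k, h₂ k ^ 2) * (∫⁻ k, h₄ k ^ 2) := by
    rw [prod3 _ (by fun_prop)]
    refine le_trans (le_of_eq ?_) (lintegral_pair_le' (m₂.pow_const 2) (m₄.pow_const 2) T)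
    refine lintegral_congr fun k => lintegral_congr fun p => lintegral_congr fun q => ?_
    simp only [hB]
    split_ifs
    · rw [ENNReal.rpow_ofNat, mul_pow, mul_pow, hwsq]
    · simp
  calc majorant h₁ h₂ h₃ h₄ ≤ _ := step1.trans step2
    _ ≤ (weightTail S * (∫⁻ k, h₁ k ^ 2) * (∫⁻ k, h₃ k ^ 2)) ^ (1 / 2 : ℝ) *
        (weightTail T * (∫⁻ k, h₂ k ^ 2) * (∫⁻ k, h₄ k ^ 2)) ^ (1 / 2 : ℝ) := by
        gcongr
    _ = _ := by
        simp only [ENNReal.mul_rpow_of_nonneg _ _ (show (0 : ℝ) ≤ 1 / 2 by norm_num), hsq, decay]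
        ring

theorem decay_zero_lt_top : decay 0 < ∞ :=
  ENNReal.rpow_lt_top_of_nonneg (by norm_num) weightTail_zero_lt_top.ne

theorem tendsto_decay : Filter.Tendsto (fun n : ℕ => decay n) Filter.atTop (nhds 0) := by
  have := (ENNReal.continuous_rpow_const (y := (1 / 2 : ℝ))).tendsto 0 |>.comp tendsto_weightTail
  rwa [ENNReal.zero_rpow_of_pos (by norm_num)] at this

theorem majorant_le {h₁ h₂ h₃ h₄ : ℝ → ℝ≥0∞} (m₁ : Measurable h₁)
    (m₂ : Measurable h₂) (m₃ : Measurable h₃) (m₄ : Measurable h₄) :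
    majorant h₁ h₂ h₃ h₄ ≤ decay 0 * decay 0 *
      (eLpNorm h₁ 2 * eLpNorm h₂ 2 * eLpNorm h₃ 2 * eLpNorm h₄ 2) :=
  majorant_le_of_separated m₁ m₂ m₃ m₄ 0 0 fun _ _ _ _ _ _ _ => ⟨zero_le, zero_le⟩

theorem majorant_mono {h₁ h₂ h₃ h₄ g₁ g₂ g₃ g₄ : ℝ → ℝ≥0∞} (i₁ : h₁ ≤ g₁) (i₂ : h₂ ≤ g₂)
    (i₃ : h₃ ≤ g₃) (i₄ : h₄ ≤ g₄) : majorant h₁ h₂ h₃ h₄ ≤ majorant g₁ g₂ g₃ g₄ := by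
  refine lintegral_mono fun k => lintegral_mono fun p => lintegral_mono fun q => ?_
  gcongr
  exacts [i₁ _, i₂ _, i₃ _, i₄ _]

theorem majorant_congr_ae {h₁ h₂ h₃ h₄ g₁ g₂ g₃ g₄ : ℝ → ℝ≥0∞} (i₁ : h₁ =ᵐ[volume] g₁)
    (i₂ : h₂ =ᵐ[volume] g₂) (i₃ : h₃ =ᵐ[volume] g₃) (i₄ : h₄ =ᵐ[volume] g₄) :
    majorant h₁ h₂ h₃ h₄ = majorant g₁ g₂ g₃ g₄ := by
  refine lintegral_congr_ae ?_
  filter_upwards [i₁] with k j₁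
  refine lintegral_congr_ae ?_
  filter_upwards [(measurePreserving_add_left volume k).quasiMeasurePreserving.ae i₂] with p j₂
  refine lintegral_congr_ae ?_
  filter_upwards [(measurePreserving_add_left volume (k + p)).quasiMeasurePreserving.ae i₃,
    (measurePreserving_add_left volume k).quasiMeasurePreserving.ae i₄] with q j₃ j₄
  rw [j₁, j₂, j₃, j₄]

theorem measurable_majorant_integrand {h₁ h₂ h₃ h₄ : ℝ → ℝ≥0∞} (m₁ : Measurable h₁) (m₂ : Measurable h₂)
    (m₃ : Measurable h₃) (m₄ : Measurable h₄) : Measurable fun z : (ℝ × ℝ) × ℝ =>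
      h₁ z.1.1 * h₂ (z.1.1 + z.1.2) * h₃ (z.1.1 + z.1.2 + z.2) * h₄ (z.1.1 + z.2) *
        weight ‖z.1.2 * z.2‖ₑ := by fun_prop

theorem majorant_eq_prod {h₁ h₂ h₃ h₄ : ℝ → ℝ≥0∞} (m₁ : Measurable h₁) (m₂ : Measurable h₂)
    (m₃ : Measurable h₃) (m₄ : Measurable h₄) : majorant h₁ h₂ h₃ h₄ =
      ∫⁻ z : (ℝ × ℝ) × ℝ, h₁ z.1.1 * h₂ (z.1.1 + z.1.2) * h₃ (z.1.1 + z.1.2 + z.2) *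
        h₄ (z.1.1 + z.2) * weight ‖z.1.2 * z.2‖ₑ := by
  have hm := measurable_majorant_integrand m₁ m₂ m₃ m₄
  rw [Measure.volume_eq_prod, lintegral_prod _ hm.aemeasurable, Measure.volume_eq_prod,
    lintegral_prod _ (Measurable.lintegral_prod_right' hm).aemeasurable, majorant]

theorem majorant_add₁ {h₁ h₂ h₃ h₄ g : ℝ → ℝ≥0∞} (m₁ : Measurable h₁)
    (m₂ : Measurable h₂) (m₃ : Measurable h₃) (m₄ : Measurable h₄) (mg : Measurable g) :
    majorant (h₁ + g) h₂ h₃ h₄ = majorant h₁ h₂ h₃ h₄ + majorant g h₂ h₃ h₄ := by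
  rw [majorant_eq_prod (m₁.add mg) m₂ m₃ m₄, majorant_eq_prod m₁ m₂ m₃ m₄,
    majorant_eq_prod mg m₂ m₃ m₄, ← lintegral_add_left (by fun_prop)]
  simp only [Pi.add_apply, add_mul]

theorem majorant_add₂ {h₁ h₂ h₃ h₄ g : ℝ → ℝ≥0∞} (m₁ : Measurable h₁)
    (m₂ : Measurable h₂) (m₃ : Measurable h₃) (m₄ : Measurable h₄) (mg : Measurable g) :
    majorant h₁ (h₂ + g) h₃ h₄ = majorant h₁ h₂ h₃ h₄ + majorant h₁ g h₃ h₄ := by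
  rw [majorant_eq_prod m₁ (m₂.add mg) m₃ m₄, majorant_eq_prod m₁ m₂ m₃ m₄,
    majorant_eq_prod m₁ mg m₃ m₄, ← lintegral_add_left (by fun_prop)]
  simp only [Pi.add_apply, add_mul, mul_add]

theorem majorant_add₃ {h₁ h₂ h₃ h₄ g : ℝ → ℝ≥0∞} (m₁ : Measurable h₁)
    (m₂ : Measurable h₂) (m₃ : Measurable h₃) (m₄ : Measurable h₄) (mg : Measurable g) :
    majorant h₁ h₂ (h₃ + g) h₄ = majorant h₁ h₂ h₃ h₄ + majorant h₁ h₂ g h₄ := by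
  rw [majorant_eq_prod m₁ m₂ (m₃.add mg) m₄, majorant_eq_prod m₁ m₂ m₃ m₄,
    majorant_eq_prod m₁ m₂ mg m₄, ← lintegral_add_left (by fun_prop)]
  simp only [Pi.add_apply, add_mul, mul_add]

theorem majorant_add₄ {h₁ h₂ h₃ h₄ g : ℝ → ℝ≥0∞} (m₁ : Measurable h₁)
    (m₂ : Measurable h₂) (m₃ : Measurable h₃) (m₄ : Measurable h₄) (mg : Measurable g) :
    majorant h₁ h₂ h₃ (h₄ + g) = majorant h₁ h₂ h₃ h₄ + majorant h₁ h₂ h₃ g := by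
  rw [majorant_eq_prod m₁ m₂ m₃ (m₄.add mg), majorant_eq_prod m₁ m₂ m₃ m₄,
    majorant_eq_prod m₁ m₂ m₃ mg, ← lintegral_add_left (by fun_prop)]
  simp only [Pi.add_apply, add_mul, mul_add]

/-! ### Exponential decay of functions controlled by the majorant -/

theorem eLpNorm_two_eq (h : ℝ → ℝ≥0∞) : eLpNorm h 2 = (∫⁻ k, h k ^ 2) ^ (1 / 2 : ℝ) := by
  rw [eLpNorm_eq_lintegral_rpow_enorm_toReal (by simp) (by simp)]
  simp

theorem eLpNorm_two_sq (h : ℝ → ℝ≥0∞) : eLpNorm h 2 ^ 2 = ∫⁻ k, h k ^ 2 := by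
  rw [eLpNorm_two_eq, ← ENNReal.rpow_natCast, ← ENNReal.rpow_mul]; norm_num

theorem eLpNorm_mono_enn {g h : ℝ → ℝ≥0∞} (i : g ≤ h) : eLpNorm g 2 ≤ eLpNorm h 2 :=
  eLpNorm_mono_enorm fun x => by simpa using i x

theorem eLpNorm_const_mul_enn (c : ℝ≥0∞) {h : ℝ → ℝ≥0∞} (mh : Measurable h) :
    eLpNorm (fun x => c * h x) 2 = c * eLpNorm h 2 := by
  simp only [eLpNorm_two_eq, mul_pow]
  rw [lintegral_const_mul _ (mh.pow_const 2), ENNReal.mul_rpow_of_nonneg _ _ (by norm_num),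
    ← ENNReal.rpow_natCast, ← ENNReal.rpow_mul]
  norm_num

/-- Convolution with a measure. -/
def convMeasure (ρ : Measure ℝ) (h : ℝ → ℝ≥0∞) (x : ℝ) : ℝ≥0∞ := ∫⁻ y, h (x - y) ∂ρ

/-- Young's inequality for convolution with the measure `g dρ`: Cauchy–Schwarz in `y`, then Tonelli.
-/
theorem eLpNorm_weighted_conv_le (ρ : Measure ℝ) [SFinite ρ] {g h : ℝ → ℝ≥0∞} (mg : Measurable g)
    (mh : Measurable h) :
    eLpNorm (fun x => ∫⁻ y, g y * h (x - y) ∂ρ) 2 ≤ (∫⁻ y, g y ∂ρ) * eLpNorm h 2 := by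
  have hs : ∀ x : ℝ≥0∞, (x ^ (1 / 2 : ℝ)) ^ 2 = x := fun x => by
    rw [← ENNReal.rpow_natCast, ← ENNReal.rpow_mul]; norm_num
  have hs' : ∀ x : ℝ≥0∞, x ^ (1 / 2 : ℝ) * x ^ (1 / 2 : ℝ) = x := fun x => by rw [← sq, hs]
  have pt : ∀ x : ℝ, (∫⁻ y, g y * h (x - y) ∂ρ) ^ 2 ≤
      (∫⁻ y, g y ∂ρ) * ∫⁻ y, g y * h (x - y) ^ 2 ∂ρ := fun x => by
    have := ENNReal.lintegral_mul_le_Lp_mul_Lq ρ Real.HolderConjugate.two_two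
      (f := fun y => g y ^ (1 / 2 : ℝ)) (g := fun y => g y ^ (1 / 2 : ℝ) * h (x - y))
      (by fun_prop) (by fun_prop)
    simp only [Pi.mul_apply, ← mul_assoc, hs', ENNReal.rpow_ofNat, mul_pow, hs] at this
    calc _ ≤ _ := pow_le_pow_left' this 2
      _ = _ := by rw [mul_pow, hs, hs]
  rw [← ENNReal.rpow_le_rpow_iff (z := 2) (by norm_num)]
  simp only [ENNReal.rpow_ofNat, mul_pow, eLpNorm_two_sq]
  calc _ ≤ ∫⁻ x, (∫⁻ y, g y ∂ρ) * ∫⁻ y, g y * h (x - y) ^ 2 ∂ρ := lintegral_mono pt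
    _ = (∫⁻ y, g y ∂ρ) * ∫⁻ x, ∫⁻ y, g y * h (x - y) ^ 2 ∂ρ :=
        lintegral_const_mul _ (Measurable.lintegral_prod_right
          (f := fun (x y : ℝ) => g y * h (x - y) ^ 2) (by fun_prop))
    _ = (∫⁻ y, g y ∂ρ) * ∫⁻ y, (g y * ∫⁻ x, h x ^ 2) ∂ρ := by
        rw [lintegral_lintegral_swap (by fun_prop)]
        congr 1
        refine lintegral_congr fun y => ?_
        rw [lintegral_const_mul _ (by fun_prop), lintegral_sub_right_eq_self (fun x => h x ^ 2)]
    _ = _ := by rw [lintegral_mul_const _ mg]; ring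

/-! ### Truncated exponential weights -/

/-- The truncated exponential weight `min (e^{μ|x|}) (2ⁿ)`. -/
def expWeight (μ : ℝ) (n : ℕ) (x : ℝ) : ℝ≥0∞ := min (ENNReal.ofReal (Real.exp (μ * |x|))) (2 ^ n)

@[fun_prop]
theorem measurable_expWeight (μ : ℝ) (n : ℕ) : Measurable (expWeight μ n) := by
  unfold expWeight; fun_prop

theorem expWeight_zero {μ : ℝ} (hμ : 0 ≤ μ) (x : ℝ) : expWeight μ 0 x = 1 := by
  simp only [expWeight, pow_zero, min_eq_right_iff]
  rw [← ENNReal.ofReal_one]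
  exact ENNReal.ofReal_le_ofReal (Real.one_le_exp (by positivity))

theorem expWeight_le (μ : ℝ) (n : ℕ) (x : ℝ) : expWeight μ n x ≤ 2 ^ n := min_le_right _ _

theorem expWeight_le_exp (μ : ℝ) (n : ℕ) (x : ℝ) :
    expWeight μ n x ≤ ENNReal.ofReal (Real.exp (μ * |x|)) := min_le_left _ _

/-- Doubling the cap at most doubles the weight; this is the slack that the induction on the cap has
to absorb. -/
theorem expWeight_succ_le (μ : ℝ) (n : ℕ) (x : ℝ) :
    expWeight μ (n + 1) x ≤ 2 * expWeight μ n x := by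
  simp only [expWeight, mul_min]
  refine min_le_min ?_ (by rw [pow_succ, mul_comm])
  exact le_mul_of_one_le_left' (by norm_num)

/-- Because all numbers are at least one, capping does not destroy submultiplicativity. -/
theorem min_mul_le {a b c : ℝ≥0∞} (ha : 1 ≤ a) (hb : 1 ≤ b) (hc : 1 ≤ c) :
    min (a * b) c ≤ min a c * min b c := by
  rcases le_total a c with h | h <;> rcases le_total b c with h' | h' <;>
    simp only [min_eq_left h, min_eq_right h, min_eq_left h', min_eq_right h']
  · exact min_le_left _ _
  · exact (min_le_right _ _).trans (le_mul_of_one_le_left' ha)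
  · exact (min_le_right _ _).trans (le_mul_of_one_le_right' hb)
  · exact (min_le_right _ _).trans (le_mul_of_one_le_right' hc)

theorem expWeight_le_mul {μ : ℝ} (hμ : 0 ≤ μ) (n : ℕ) {x a b : ℝ} (h : |x| ≤ |a| + |b|) :
    expWeight μ n x ≤ expWeight μ n a * expWeight μ n b := by
  have h1 : ∀ y, 1 ≤ ENNReal.ofReal (Real.exp (μ * |y|)) := fun y => by
    rw [← ENNReal.ofReal_one]
    exact ENNReal.ofReal_le_ofReal (Real.one_le_exp (by positivity))
  refine le_trans (min_le_min ?_ le_rfl) (min_mul_le (h1 a) (h1 b) (one_le_pow₀ (by norm_num)))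
  rw [← ENNReal.ofReal_mul (Real.exp_pos _).le, ← Real.exp_add, ← mul_add]
  gcongr

/-- From `k = (k+p) - (k+p+q) + (k+q)` the weight at `k` is at most the product of the weights at
the other three points. -/
theorem majorant_weight_le {μ : ℝ} (hμ : 0 ≤ μ) (n : ℕ) (H φ : ℝ → ℝ≥0∞) :
    majorant (fun x => expWeight μ n x * H x) φ φ φ ≤
      majorant H (fun x => expWeight μ n x * φ x) (fun x => expWeight μ n x * φ x)
        (fun x => expWeight μ n x * φ x) := by
  refine lintegral_mono fun k => lintegral_mono fun p => lintegral_mono fun q => ?_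
  have h : expWeight μ n k ≤
      expWeight μ n (k + p) * (expWeight μ n (k + p + q) * expWeight μ n (k + q)) := by
    have h1 : |k| ≤ |k + p| + |p| := by
      have := abs_sub (k + p) p
      rwa [add_sub_cancel_right] at this
    have h2 : |p| ≤ |k + p + q| + |k + q| := by
      have := abs_sub (k + p + q) (k + q)
      rwa [show k + p + q - (k + q) = p by ring] at this
    refine (expWeight_le_mul hμ n h1).trans ?_
    gcongr
    exact expWeight_le_mul hμ n h2
  calc _ = expWeight μ n k * (H k * φ (k + p) * φ (k + p + q) * φ (k + q) * weight ‖p * q‖ₑ) := by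
        ring
    _ ≤ expWeight μ n (k + p) * (expWeight μ n (k + p + q) * expWeight μ n (k + q)) *
        (H k * φ (k + p) * φ (k + p + q) * φ (k + q) * weight ‖p * q‖ₑ) := by gcongr
    _ = _ := by ring

/-- Split `ψ` into a small part `s` (`|x| ≤ n`), a middle part `m` and a large part `l` (`|x| >
4n`). Since `A` lives on `|x| > 2n`, every term of the expansion other than `A l l l` either has two
separated factors, gaining `decay n`, or contains `m`, whose norm will be small. So `l` enters
without a small factor only through its cube. -/
theorem majorant_localized_le {A ψ : ℝ → ℝ≥0∞} (mA : Measurable A) (mψ : Measurable ψ) (n : ℕ)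
    (hA : ∀ x, A x ≠ 0 → 2 * (n : ℝ) < |x|) :
    majorant A ψ ψ ψ ≤ decay 0 * eLpNorm A 2 * (4 * decay n * eLpNorm ψ 2 ^ 3 +
      4 * decay 0 * eLpNorm ({x | (n : ℝ) < |x| ∧ |x| ≤ 4 * n}.indicator ψ) 2 * eLpNorm ψ 2 ^ 2 +
      decay 0 * eLpNorm ({x | 4 * (n : ℝ) < |x|}.indicator ψ) 2 ^ 3) := by
  set s := {x : ℝ | |x| ≤ (n : ℝ)}.indicator ψ with hs
  set m := {x : ℝ | (n : ℝ) < |x| ∧ |x| ≤ 4 * n}.indicator ψ with hm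
  set l := {x : ℝ | 4 * (n : ℝ) < |x|}.indicator ψ with hl
  have n0 : (0 : ℝ) ≤ n := n.cast_nonneg
  have ms : Measurable s := mψ.indicator (measurableSet_le (by fun_prop) (by fun_prop))
  have mm : Measurable m := mψ.indicator
    ((measurableSet_Ioc (a := (n : ℝ)) (b := 4 * n)).preimage (by fun_prop : Measurable fun x : ℝ => |x|))
  have ml : Measurable l := mψ.indicator (measurableSet_lt (by fun_prop) (by fun_prop))
  have hψ : ψ = s + (m + l) := by
    ext x
    simp only [hs, hm, hl, Pi.add_apply, indicator_apply, mem_ofPred_eq]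
    by_cases h1 : |x| ≤ (n : ℝ)
    · have h2 : ¬ (n : ℝ) < |x| := not_lt.2 h1
      have h3 : ¬ 4 * (n : ℝ) < |x| := by linarith
      simp [h1, h2, h3]
    · have h2 : (n : ℝ) < |x| := not_le.1 h1
      by_cases h3 : |x| ≤ 4 * n
      · simp [h1, h2, h3, not_lt.2 h3]
      · simp [h1, h3, not_le.1 h3]
  have ss : ∀ x, s x ≠ 0 → |x| ≤ n := fun x hx => by
    by_contra h; exact hx (by simp [hs, h])
  have sl : ∀ x, l x ≠ 0 → 4 * n < |x| := fun x hx => by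
    by_contra h; exact hx (by simp [hl, h])
  have ns : eLpNorm s 2 ≤ eLpNorm ψ 2 := eLpNorm_mono_enn (indicator_le_self _ _)
  have nm : eLpNorm m 2 ≤ eLpNorm ψ 2 := eLpNorm_mono_enn (indicator_le_self _ _)
  have nl : eLpNorm l 2 ≤ eLpNorm ψ 2 := eLpNorm_mono_enn (indicator_le_self _ _)
  have nr : eLpNorm (m + l) 2 ≤ eLpNorm ψ 2 := eLpNorm_mono_enn (by rw [hψ]; exact le_add_self)
  have sep : ∀ x y : ℝ, (n : ℝ) ≤ |x| → (n : ℝ≥0∞) ≤ ‖x‖ₑ := fun x _ h => by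
    rw [← ofReal_norm, Real.norm_eq_abs, ← ENNReal.ofReal_natCast]
    exact ENNReal.ofReal_le_ofReal h
  set a := eLpNorm A 2
  set N := eLpNorm ψ 2
  have far13 : ∀ h₂ h₃ h₄ : ℝ → ℝ≥0∞, Measurable h₂ → Measurable h₃ → Measurable h₄ →
      (∀ k p q, A k ≠ 0 → h₂ (k + p) ≠ 0 → h₃ (k + p + q) ≠ 0 → h₄ (k + q) ≠ 0 →
        (n : ℝ) ≤ |p + q|) → eLpNorm h₂ 2 ≤ N → eLpNorm h₃ 2 ≤ N → eLpNorm h₄ 2 ≤ N →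
      majorant A h₂ h₃ h₄ ≤ decay 0 * a * (decay n * N ^ 3) := by
    intro h₂ h₃ h₄ m₂ m₃ m₄ H i₂ i₃ i₄
    refine (majorant_le_of_separated mA m₂ m₃ m₄ n 0 fun k p q c₁ c₂ c₃ c₄ =>
      ⟨sep _ 0 (H k p q c₁ c₂ c₃ c₄), zero_le⟩).trans ?_
    calc _ ≤ decay n * decay 0 * (a * N * N * N) := by gcongr
      _ = _ := by ring
  have far24 : ∀ h₂ h₃ h₄ : ℝ → ℝ≥0∞, Measurable h₂ → Measurable h₃ → Measurable h₄ →
      (∀ k p q, A k ≠ 0 → h₂ (k + p) ≠ 0 → h₃ (k + p + q) ≠ 0 → h₄ (k + q) ≠ 0 →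
        (n : ℝ) ≤ |p - q|) → eLpNorm h₂ 2 ≤ N → eLpNorm h₃ 2 ≤ N → eLpNorm h₄ 2 ≤ N →
      majorant A h₂ h₃ h₄ ≤ decay 0 * a * (decay n * N ^ 3) := by
    intro h₂ h₃ h₄ m₂ m₃ m₄ H i₂ i₃ i₄
    refine (majorant_le_of_separated mA m₂ m₃ m₄ 0 n fun k p q c₁ c₂ c₃ c₄ =>
      ⟨zero_le, sep _ 0 (H k p q c₁ c₂ c₃ c₄)⟩).trans ?_
    calc _ ≤ decay 0 * decay n * (a * N * N * N) := by gcongr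
      _ = _ := by ring
  have T1 : majorant A ψ s ψ ≤ decay 0 * a * (decay n * N ^ 3) := by
    refine far13 ψ s ψ mψ ms mψ (fun k p q c₁ _ c₃ _ => ?_) le_rfl ns le_rfl
    have h1 := hA _ c₁
    have h3 := ss _ c₃
    have := abs_sub (k + p + q) (p + q)
    rw [show k + p + q - (p + q) = k by ring] at this
    linarith
  have T2 : majorant A ψ (m + l) m ≤ decay 0 * a * (decay 0 * eLpNorm m 2 * N ^ 2) := by
    refine (majorant_le mA mψ (mm.add ml) mm).trans ?_
    calc _ ≤ decay 0 * decay 0 * (a * N * N * eLpNorm m 2) := by gcongr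
      _ = _ := by ring
  -- Here `2k = (k+p) + (k+q) - (p+q)`: with `|2k| > 4n` and both of the other arguments at most
  -- `n`, `p + q` must be large.
  have T3 : majorant A s (m + l) s ≤ decay 0 * a * (decay n * N ^ 3) := by
    refine far13 s (m + l) s ms (mm.add ml) ms (fun k p q c₁ c₂ _ c₄ => ?_) ns nr ns
    have h1 := hA _ c₁
    have h2 := ss _ c₂
    have h4 := ss _ c₄
    have e1 := abs_sub (k + p + (k + q)) (p + q)
    have e2 := abs_add_le (k + p) (k + q)
    rw [show k + p + (k + q) - (p + q) = 2 * k by ring, abs_mul, abs_two] at e1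
    linarith
  have T4 : majorant A m (m + l) s ≤ decay 0 * a * (decay 0 * eLpNorm m 2 * N ^ 2) := by
    refine (majorant_le mA mm (mm.add ml) ms).trans ?_
    calc _ ≤ decay 0 * decay 0 * (a * eLpNorm m 2 * N * N) := by gcongr
      _ = _ := by ring
  have T5 : majorant A l (m + l) s ≤ decay 0 * a * (decay n * N ^ 3) := by
    refine far24 l (m + l) s ml (mm.add ml) ms (fun k p q _ c₂ _ c₄ => ?_) nl nr ns
    have h2 := sl _ c₂
    have h4 := ss _ c₄
    have := abs_add_le (p - q) (k + q)
    rw [show p - q + (k + q) = k + p by ring] at this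
    linarith
  have T6 : majorant A s (m + l) l ≤ decay 0 * a * (decay n * N ^ 3) := by
    refine far24 s (m + l) l ms (mm.add ml) ml (fun k p q _ c₂ _ c₄ => ?_) ns nr nl
    have h2 := ss _ c₂
    have h4 := sl _ c₄
    have := abs_sub (k + p) (p - q)
    rw [show k + p - (p - q) = k + q by ring] at this
    linarith
  have T7 : majorant A m (m + l) l ≤ decay 0 * a * (decay 0 * eLpNorm m 2 * N ^ 2) := by
    refine (majorant_le mA mm (mm.add ml) ml).trans ?_
    calc _ ≤ decay 0 * decay 0 * (a * eLpNorm m 2 * N * N) := by gcongr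
      _ = _ := by ring
  have T8 : majorant A l m l ≤ decay 0 * a * (decay 0 * eLpNorm m 2 * N ^ 2) := by
    refine (majorant_le mA ml mm ml).trans ?_
    calc _ ≤ decay 0 * decay 0 * (a * N * eLpNorm m 2 * N) := by gcongr
      _ = _ := by ring
  have T9 : majorant A l l l ≤ decay 0 * a * (decay 0 * eLpNorm l 2 ^ 3) := by
    refine (majorant_le mA ml ml ml).trans (le_of_eq ?_)
    ring
  have mr := mm.add ml
  -- The third slot is split into `s` and `m + l`; in the second case the fourth slot is split into
  -- three, then the second slot when the fourth is `s` or `l`, and at last `m + l` itself when `l`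
  -- stands on both sides.
  have split : majorant A ψ ψ ψ = majorant A ψ s ψ + (majorant A ψ (m + l) m +
      ((majorant A s (m + l) s + (majorant A m (m + l) s + majorant A l (m + l) s)) +
      (majorant A s (m + l) l + (majorant A m (m + l) l +
        (majorant A l m l + majorant A l l l))))) := by
    rw [← majorant_add₃ mA ml mm ml ml, ← majorant_add₂ mA mm mr ml ml,
      ← majorant_add₂ mA ms mr ml mr, ← majorant_add₂ mA mm mr ms ml,
      ← majorant_add₂ mA ms mr ms mr, ← hψ, ← majorant_add₄ mA mψ mr ms ml,
      ← majorant_add₄ mA mψ mr mm (ms.add ml), ← add_assoc m s l, add_comm m s, add_assoc s m l,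
      ← hψ, ← majorant_add₃ mA mψ ms mψ mr, ← hψ]
  rw [split]
  calc _ ≤ decay 0 * a * (decay n * N ^ 3) + (decay 0 * a * (decay 0 * eLpNorm m 2 * N ^ 2) +
      ((decay 0 * a * (decay n * N ^ 3) + (decay 0 * a * (decay 0 * eLpNorm m 2 * N ^ 2) +
        decay 0 * a * (decay n * N ^ 3))) +
      (decay 0 * a * (decay n * N ^ 3) + (decay 0 * a * (decay 0 * eLpNorm m 2 * N ^ 2) +
        (decay 0 * a * (decay 0 * eLpNorm m 2 * N ^ 2) +
          decay 0 * a * (decay 0 * eLpNorm l 2 ^ 3)))))) := by gcongr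
    _ = _ := by ring

/-- The a priori bound makes the cubic term at most `ν / 2`, which is absorbed on the left;
finiteness of `ν` is what permits the cancellation. -/
theorem le_two_mul_of_le_add_cube {ν δ Γ ν₀ : ℝ≥0∞} (h : ν ≤ δ + Γ * ν ^ 3) (hν : ν ≤ ν₀)
    (hν₀ : ν₀ ≠ ∞) (hΓ : Γ * ν₀ ^ 2 ≤ 1 / 2) : ν ≤ 2 * δ := by
  have hfin : ν ≠ ∞ := ne_top_of_le_ne_top hν₀ hν
  have h1 : Γ * ν ^ 3 ≤ ν / 2 := by
    calc Γ * ν ^ 3 = Γ * ν ^ 2 * ν := by ring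
      _ ≤ Γ * ν₀ ^ 2 * ν := by gcongr
      _ ≤ 1 / 2 * ν := by gcongr
      _ = ν / 2 := by rw [one_div, div_eq_mul_inv, mul_comm]
  have h2 : ν / 2 + ν / 2 ≤ δ + ν / 2 := by
    rw [ENNReal.add_halves]; exact h.trans (by gcongr)
  have h3 : ν / 2 ≤ δ := (ENNReal.add_le_add_iff_right (ENNReal.div_ne_top hfin (by simp))).1 h2
  calc ν = 2 * (ν / 2) := by rw [two_mul, ENNReal.add_halves]
    _ ≤ _ := by gcongr

theorem tendsto_eLpNorm_indicator {φ : ℝ → ℝ≥0∞} (mφ : Measurable φ)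
    (hφ : eLpNorm φ 2 < ∞) :
    Filter.Tendsto (fun n : ℕ => eLpNorm ({x | (n : ℝ) < |x|}.indicator φ) 2) Filter.atTop
      (nhds 0) := by
  have hfin : ∫⁻ k, φ k ^ 2 < ∞ := by
    rw [← eLpNorm_two_sq]; exact ENNReal.pow_lt_top hφ
  have key : Filter.Tendsto (fun n : ℕ => ∫⁻ x, ({x | (n : ℝ) < |x|}.indicator φ x) ^ 2)
      Filter.atTop (nhds (∫⁻ _ : ℝ, 0)) := by
    refine tendsto_lintegral_of_dominated_convergence (fun x => φ x ^ 2) (fun n => ?_)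
      (fun n => Filter.Eventually.of_forall fun x => ?_) hfin.ne
      (Filter.Eventually.of_forall fun x => ?_)
    · exact (mφ.indicator (measurableSet_lt (by fun_prop) (by fun_prop))).pow_const 2
    · exact pow_le_pow_left' (indicator_le_self _ _ x) 2
    · refine tendsto_const_nhds.congr' ?_
      obtain ⟨n, hn⟩ := exists_nat_ge |x|
      filter_upwards [Filter.eventually_ge_atTop n] with j hj
      have : ¬ (j : ℝ) < |x| := not_lt.2 (hn.trans (by exact_mod_cast hj))
      simp [this]
  have := (ENNReal.continuous_rpow_const (y := (1 / 2 : ℝ))).tendsto _ |>.comp key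
  simp only [eLpNorm_two_eq]
  simpa [Function.comp_def] using this

theorem tendsto_lintegral_indicator {ρ : Measure ℝ} {g : ℝ → ℝ≥0∞} (mg : Measurable g)
    (hg : ∫⁻ y, g y ∂ρ < ∞) :
    Filter.Tendsto (fun n : ℕ => ∫⁻ y, {y | 2 * (n : ℝ) < |y|}.indicator g y ∂ρ) Filter.atTop
      (nhds 0) := by
  have key : Filter.Tendsto (fun n : ℕ => ∫⁻ y, {y | 2 * (n : ℝ) < |y|}.indicator g y ∂ρ)
      Filter.atTop (nhds (∫⁻ _ : ℝ, 0 ∂ρ)) := by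
    refine tendsto_lintegral_of_dominated_convergence g (fun n => ?_)
      (fun n => Filter.Eventually.of_forall fun x => ?_) hg.ne
      (Filter.Eventually.of_forall fun x => ?_)
    · exact mg.indicator (measurableSet_lt (by fun_prop) (by fun_prop))
    · exact indicator_le_self _ _ x
    · refine tendsto_const_nhds.congr' ?_
      obtain ⟨n, hn⟩ := exists_nat_ge |x|
      filter_upwards [Filter.eventually_ge_atTop n] with j hj
      have hj' : (n : ℝ) ≤ j := by exact_mod_cast hj
      have : ¬ 2 * (j : ℝ) < |x| := not_lt.2 (by linarith [(Nat.cast_nonneg j : (0 : ℝ) ≤ j)])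
      simp [this]
  simpa using key

theorem expWeight_le_exp_one {μ : ℝ} (hμ : 0 ≤ μ) {R : ℝ} (hR : μ * R ≤ 1) (j : ℕ) {x : ℝ}
    (hx : |x| ≤ R) : expWeight μ j x ≤ ENNReal.ofReal (Real.exp 1) :=
  (expWeight_le_exp _ _ _).trans (ENNReal.ofReal_le_ofReal (Real.exp_le_exp.2
    ((mul_le_mul_of_nonneg_left hx hμ).trans hR)))

theorem eLpNorm_expWeight_le {φ : ℝ → ℝ≥0∞} (mφ : Measurable φ) {μ : ℝ} (hμ : 0 ≤ μ) {R : ℝ}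
    (hR : μ * R ≤ 1) (j : ℕ) :
    eLpNorm (fun x => expWeight μ j x * φ x) 2 ≤ ENNReal.ofReal (Real.exp 1) * eLpNorm φ 2 +
      eLpNorm ({x | R < |x|}.indicator fun x => expWeight μ j x * φ x) 2 := by
  have ml : Measurable ({x | R < |x|}.indicator fun x => expWeight μ j x * φ x) :=
    Measurable.indicator (by fun_prop) (measurableSet_lt (by fun_prop) (by fun_prop))
  have h1 : (fun x => expWeight μ j x * φ x) ≤ (fun x => ENNReal.ofReal (Real.exp 1) * φ x) +
      {x | R < |x|}.indicator fun x => expWeight μ j x * φ x := fun x => by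
    by_cases h : R < |x|
    · simp only [Pi.add_apply, indicator_apply, mem_ofPred_eq, h, if_true]
      exact le_add_self
    · refine le_trans ?_ le_self_add
      exact mul_le_mul_left (expWeight_le_exp_one hμ hR j (not_lt.1 h)) _
  refine (eLpNorm_mono_enn h1).trans ?_
  refine (eLpNorm_add_le (mφ.const_mul _).aestronglyMeasurable ml.aestronglyMeasurable
    (by norm_num)).trans ?_
  rw [eLpNorm_const_mul_enn _ mφ]

/-- Fatou: at each point the capped weights are eventually equal to the full exponential. -/
theorem eLpNorm_exp_le_of_expWeight {φ : ℝ → ℝ≥0∞} (mφ : Measurable φ) (μ : ℝ) {P : ℝ≥0∞}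
    (h : ∀ j, eLpNorm (fun x => expWeight μ j x * φ x) 2 ≤ P) :
    eLpNorm (fun x => ENNReal.ofReal (Real.exp (μ * |x|)) * φ x) 2 ≤ P := by
  rw [← ENNReal.rpow_le_rpow_iff (z := 2) (by norm_num)]
  simp only [ENNReal.rpow_ofNat, eLpNorm_two_sq]
  calc _ ≤ ∫⁻ x, Filter.liminf (fun j => (expWeight μ j x * φ x) ^ 2) Filter.atTop := by
        refine lintegral_mono fun x => ?_
        refine le_of_eq (Filter.Tendsto.liminf_eq ?_).symm
        refine tendsto_const_nhds.congr' ?_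
        obtain ⟨N, hN⟩ := ENNReal.exists_nat_gt (ENNReal.ofReal_ne_top
          (r := Real.exp (μ * |x|)))
        filter_upwards [Filter.eventually_ge_atTop N] with j hj
        rw [expWeight, min_eq_left]
        calc _ ≤ (N : ℝ≥0∞) := hN.le
          _ ≤ 2 ^ N := by exact_mod_cast Nat.lt_two_pow_self.le
          _ ≤ 2 ^ j := pow_le_pow_right₀ (by norm_num) hj
    _ ≤ Filter.liminf (fun j => ∫⁻ x, (expWeight μ j x * φ x) ^ 2) Filter.atTop :=
        lintegral_liminf_le fun j => by fun_prop
    _ ≤ Filter.liminf (fun _ : ℕ => P ^ 2) Filter.atTop := by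
        refine Filter.liminf_le_liminf (Filter.Eventually.of_forall fun j => ?_)
        rw [← eLpNorm_two_sq]
        exact pow_le_pow_left' (h j) 2
    _ = P ^ 2 := Filter.liminf_const _

/-! ### The bootstrap for the weighted tail -/

/-- The estimate for the part of the weighted function outside `[-4n, 4n]`. -/
theorem tail_estimate {φ : ℝ → ℝ≥0∞} (mφ : Measurable φ)
    (ρ : Measure ℝ) [SFinite ρ] {μ : ℝ} (hμ : 0 < μ) (C : ℝ≥0∞)
    (hK : ∀ h : ℝ → ℝ≥0∞, Measurable h → eLpNorm h 2 < ∞ →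
      ∫⁻ x, h x * φ x ≤ C * majorant (convMeasure ρ h) φ φ φ)
    (n : ℕ) (hn : μ * (4 * n) ≤ 1) (j : ℕ)
    (hν : eLpNorm ({x | 4 * (n : ℝ) < |x|}.indicator fun x => expWeight μ j x * φ x) 2 ≤ 1) :
    eLpNorm ({x | 4 * (n : ℝ) < |x|}.indicator fun x => expWeight μ j x * φ x) 2 ≤
      C * ((∫⁻ y, ENNReal.ofReal (Real.exp (μ * |y|)) ∂ρ) * decay 0 *
        (4 * decay n * (ENNReal.ofReal (Real.exp 1) * eLpNorm φ 2 + 1) ^ 3 + 4 * decay 0 *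
          (ENNReal.ofReal (Real.exp 1) * eLpNorm ({x | (n : ℝ) < |x|}.indicator φ) 2) *
            (ENNReal.ofReal (Real.exp 1) * eLpNorm φ 2 + 1) ^ 2) +
        (∫⁻ y, {y | 2 * (n : ℝ) < |y|}.indicator
          (fun y => ENNReal.ofReal (Real.exp (μ * |y|))) y ∂ρ) * (decay 0 * decay 0) *
            (ENNReal.ofReal (Real.exp 1) * eLpNorm φ 2 + 1) ^ 3) +
      C * (∫⁻ y, ENNReal.ofReal (Real.exp (μ * |y|)) ∂ρ) * decay 0 * decay 0 *
        eLpNorm ({x | 4 * (n : ℝ) < |x|}.indicator fun x => expWeight μ j x * φ x) 2 ^ 3 := by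
  set ex : ℝ → ℝ≥0∞ := fun y => ENNReal.ofReal (Real.exp (μ * |y|)) with hex
  have mex : Measurable ex := by fun_prop
  set ψ : ℝ → ℝ≥0∞ := fun x => expWeight μ j x * φ x with hψ
  have mψ : Measurable ψ := by fun_prop
  set l := {x | 4 * (n : ℝ) < |x|}.indicator ψ with hl
  have ml : Measurable l := mψ.indicator (measurableSet_lt (by fun_prop) (by fun_prop))
  set ν := eLpNorm l 2 with hν'
  set e1 := ENNReal.ofReal (Real.exp 1)
  set P := e1 * eLpNorm φ 2 + 1
  set far : Set ℝ := {y | 2 * (n : ℝ) < |y|} with hfar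
  have mfar : MeasurableSet far := measurableSet_lt (by fun_prop) (by fun_prop)
  have hexp : ∀ x : ℝ, |x| ≤ 4 * n → expWeight μ j x ≤ e1 := fun x hx =>
    expWeight_le_exp_one hμ.le hn j hx
  have hP : eLpNorm ψ 2 ≤ P := by
    exact (eLpNorm_expWeight_le mφ hμ.le hn j).trans (add_le_add le_rfl hν)
  have hm : eLpNorm ({x | (n : ℝ) < |x| ∧ |x| ≤ 4 * n}.indicator ψ) 2 ≤
      e1 * eLpNorm ({x | (n : ℝ) < |x|}.indicator φ) 2 := by
    rw [← eLpNorm_const_mul_enn _ (mφ.indicator (measurableSet_lt (by fun_prop) (by fun_prop)))]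
    refine eLpNorm_mono_enn fun x => ?_
    by_cases h : (n : ℝ) < |x| <;> by_cases h' : |x| ≤ 4 * n <;> simp [h, h', hψ]
    gcongr
    exact hexp x h'
  have hlfin : ν < ∞ := lt_of_le_of_lt hν ENNReal.one_lt_top
  -- The test function carries the weight twice, so that its pairing with `φ` is exactly `ν²`. The
  -- cap on the weight is what puts it in `L²`.
  set h : ℝ → ℝ≥0∞ := fun x => expWeight μ j x * l x with hh
  have mh : Measurable h := by fun_prop
  have hhfin : eLpNorm h 2 < ∞ := by
    refine lt_of_le_of_lt (eLpNorm_mono_enn (h := fun x => 2 ^ j * l x) fun x => ?_) ?_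
    · simp only [hh]
      gcongr
      exact expWeight_le _ _ _
    · rw [eLpNorm_const_mul_enn _ ml]
      exact ENNReal.mul_lt_top (ENNReal.pow_lt_top (by simp)) hlfin
  have hνsq : ν ^ 2 = ∫⁻ x, h x * φ x := by
    rw [hν', eLpNorm_two_sq]
    refine lintegral_congr fun x => ?_
    by_cases c : 4 * (n : ℝ) < |x| <;> simp [hh, hl, hψ, c]
    ring
  -- After the weight is pulled out, the convolution of `l` splits into a part `A` supported far out
  -- and a part `B` fed only by distant mass of `ρ`. `A` has the localization of
  -- `majorant_localized_le`; `B` is small because of the exponential moment.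
  set A : ℝ → ℝ≥0∞ := far.indicator fun x => ∫⁻ y, ex y * l (x - y) ∂ρ with hA
  set B : ℝ → ℝ≥0∞ := fun x => ∫⁻ y, far.indicator ex y * l (x - y) ∂ρ with hB
  have mA : Measurable A := Measurable.indicator (Measurable.lintegral_prod_right
    (f := fun (x y : ℝ) => ex y * l (x - y)) (by fun_prop)) mfar
  have mB : Measurable B := Measurable.lintegral_prod_right
    (f := fun (x y : ℝ) => far.indicator ex y * l (x - y))
      (((mex.indicator mfar).comp measurable_snd).mul (by fun_prop))
  have hAn : eLpNorm A 2 ≤ (∫⁻ y, ex y ∂ρ) * ν :=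
    (eLpNorm_mono_enn (indicator_le_self _ _)).trans (eLpNorm_weighted_conv_le ρ mex ml)
  have hBn : eLpNorm B 2 ≤ (∫⁻ y, far.indicator ex y ∂ρ) * ν :=
    eLpNorm_weighted_conv_le ρ (mex.indicator mfar) ml
  -- The weight at `x - y` is at most the product of those at `x` and `y`. If `|x| ≤ 2n` while `|x -
  -- y| > 4n`, then `|y| > 2n`, so for such `x` the part `B` suffices.
  have hconv : convMeasure ρ h ≤ fun x => expWeight μ j x * (A + B) x := fun x => by
    have h1 : convMeasure ρ h x ≤ expWeight μ j x * ∫⁻ y, ex y * l (x - y) ∂ρ := by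
      rw [← lintegral_const_mul _ (by fun_prop)]
      refine lintegral_mono fun y => ?_
      rw [← mul_assoc]
      simp only [hh]
      gcongr
      calc _ ≤ expWeight μ j x * expWeight μ j y := expWeight_le_mul hμ.le j (abs_sub x y)
        _ ≤ _ := by gcongr; exact expWeight_le_exp _ _ _
    refine h1.trans ?_
    change _ ≤ expWeight μ j x * (A + B) x
    gcongr
    by_cases c : x ∈ far
    · simp only [Pi.add_apply, hA, c, indicator_of_mem]
      exact le_self_add
    · refine le_trans ?_ le_add_self
      refine lintegral_mono fun y => ?_
      by_cases d : y ∈ far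
      · simp [d]
      · have : ¬ 4 * (n : ℝ) < |x - y| := by
          simp only [hfar, mem_ofPred_eq, not_lt] at c d
          have := abs_sub x y
          linarith
        simp [hl, this]
  have hAfar : ∀ x, A x ≠ 0 → 2 * (n : ℝ) < |x| := fun x hx => by
    by_contra c
    exact hx (indicator_of_notMem (by simpa [hfar] using c) _)
  have main : ν ^ 2 ≤ C * ((∫⁻ y, ex y ∂ρ) * ν * decay 0 * (4 * decay n * P ^ 3 +
      4 * decay 0 * (e1 * eLpNorm ({x | (n : ℝ) < |x|}.indicator φ) 2) * P ^ 2 +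
      decay 0 * ν ^ 3) + (∫⁻ y, far.indicator ex y ∂ρ) * ν * (decay 0 * decay 0) * P ^ 3) := by
    calc ν ^ 2 ≤ C * majorant (convMeasure ρ h) φ φ φ := hνsq ▸ hK h mh hhfin
      _ ≤ C * majorant (fun x => expWeight μ j x * (A + B) x) φ φ φ := by
        gcongr
        exact majorant_mono hconv le_rfl le_rfl le_rfl
      _ ≤ C * majorant (A + B) ψ ψ ψ := by
        gcongr
        exact majorant_weight_le hμ.le j _ _
      _ = C * (majorant A ψ ψ ψ + majorant B ψ ψ ψ) := by rw [majorant_add₁ mA mψ mψ mψ mB]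
      _ ≤ C * (decay 0 * ((∫⁻ y, ex y ∂ρ) * ν) * (4 * decay n * P ^ 3 +
          4 * decay 0 * (e1 * eLpNorm ({x | (n : ℝ) < |x|}.indicator φ) 2) * P ^ 2 +
          decay 0 * ν ^ 3) + decay 0 * decay 0 *
          ((∫⁻ y, far.indicator ex y ∂ρ) * ν * P * P * P)) := by
        gcongr
        · refine (majorant_localized_le mA mψ n hAfar).trans ?_
          gcongr
        · refine (majorant_le mB mψ mψ mψ).trans ?_
          gcongr
      _ = _ := by ring
  -- Both sides of `main` carry a common factor `ν`, which is finite and can be cancelled when it is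
  -- nonzero.
  rcases eq_or_ne ν 0 with h0 | h0
  · rw [h0]; exact zero_le
  · rw [← ENNReal.mul_le_mul_iff_right h0 hlfin.ne]
    calc ν * ν = ν ^ 2 := (sq ν).symm
      _ ≤ _ := main
      _ = _ := by ring

theorem eLpNorm_indicator_expWeight_succ_le {φ : ℝ → ℝ≥0∞} (mφ : Measurable φ) {S : Set ℝ}
    (mS : MeasurableSet S) (μ : ℝ) (j : ℕ) :
    eLpNorm (S.indicator fun x => expWeight μ (j + 1) x * φ x) 2 ≤
      2 * eLpNorm (S.indicator fun x => expWeight μ j x * φ x) 2 := by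
  rw [← eLpNorm_const_mul_enn 2 (Measurable.indicator (by fun_prop) mS)]
  refine eLpNorm_mono_enn fun x => ?_
  by_cases hx : x ∈ S
  · simp only [hx, indicator_of_mem]
    rw [← mul_assoc]
    gcongr
    exact expWeight_succ_le _ _ _
  · simp [hx]

/-- A discrete continuity argument in the height of the cap. The radius `4n` is fixed first, then
`μ` small enough that the weight is at most `e` inside this radius. On the tail the cubic inequality
improves a bound `ν₀` to `ν₀ / 2`, and raising the cap costs a factor 2, so `ν₀` persists for every
cap. -/
theorem exists_exponential_decay {φ : ℝ → ℝ≥0∞} (mφ : Measurable φ) (hφ : eLpNorm φ 2 < ∞)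
    (ρ : Measure ℝ) [SFinite ρ] {μ₀ : ℝ} (hμ₀ : 0 < μ₀)
    (hρ : ∫⁻ y, ENNReal.ofReal (Real.exp (μ₀ * |y|)) ∂ρ < ∞) {C : ℝ≥0∞} (hC : C < ∞)
    (hK : ∀ h : ℝ → ℝ≥0∞, Measurable h → eLpNorm h 2 < ∞ →
      ∫⁻ x, h x * φ x ≤ C * majorant (convMeasure ρ h) φ φ φ) :
    ∃ μ : ℝ, 0 < μ ∧ eLpNorm (fun x => ENNReal.ofReal (Real.exp (μ * |x|)) * φ x) 2 < ∞ := by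
  set e1 := ENNReal.ofReal (Real.exp 1)
  set P := e1 * eLpNorm φ 2 + 1
  have hP : P < ∞ := by
    refine ENNReal.add_lt_top.2 ⟨ENNReal.mul_lt_top ENNReal.ofReal_lt_top hφ, by simp⟩
  set M := ∫⁻ y, ENNReal.ofReal (Real.exp (μ₀ * |y|)) ∂ρ with hM
  have d0 := decay_zero_lt_top
  set Γ := C * M * decay 0 * decay 0 with hΓ
  have hΓfin : Γ < ∞ := ENNReal.mul_lt_top (ENNReal.mul_lt_top (ENNReal.mul_lt_top hC hρ) d0) d0
  -- The moments are taken with `μ₀`, which dominates the later `μ`, so that `δ` does not depend on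
  -- the `μ` chosen after `n`.
  set δ : ℕ → ℝ≥0∞ := fun n => C * (M * decay 0 * (4 * decay n * P ^ 3 + 4 * decay 0 *
          (e1 * eLpNorm ({x | (n : ℝ) < |x|}.indicator φ) 2) * P ^ 2) +
        (∫⁻ y, {y | 2 * (n : ℝ) < |y|}.indicator
          (fun y => ENNReal.ofReal (Real.exp (μ₀ * |y|))) y ∂ρ) * (decay 0 * decay 0) * P ^ 3)
    with hδ
  have hδ0 : Filter.Tendsto δ Filter.atTop (nhds 0) := by
    have t1 := tendsto_decay
    have t2 := tendsto_eLpNorm_indicator mφ hφ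
    have t3 := tendsto_lintegral_indicator (ρ := ρ) (g := fun y =>
      ENNReal.ofReal (Real.exp (μ₀ * |y|))) (by fun_prop) hρ
    have cm : ∀ {u : ℕ → ℝ≥0∞} {c : ℝ≥0∞}, c < ∞ → Filter.Tendsto u Filter.atTop (nhds 0) →
        Filter.Tendsto (fun n => c * u n) Filter.atTop (nhds 0) := fun {u c} hc hu => by
      simpa using ENNReal.Tendsto.const_mul hu (Or.inr hc.ne)
    have P3 : P ^ 3 < ∞ := ENNReal.pow_lt_top hP
    have P2 : P ^ 2 < ∞ := ENNReal.pow_lt_top hP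
    have e1f : e1 < ∞ := ENNReal.ofReal_lt_top
    have s1 := cm (c := 4 * P ^ 3) (ENNReal.mul_lt_top (by simp) P3) t1
    have s2 := cm (c := 4 * decay 0 * e1 * P ^ 2) (ENNReal.mul_lt_top (ENNReal.mul_lt_top
      (ENNReal.mul_lt_top (by simp) d0) e1f) P2) t2
    have s3 := cm (c := decay 0 * decay 0 * P ^ 3) (ENNReal.mul_lt_top
      (ENNReal.mul_lt_top d0 d0) P3) t3
    have s12 := s1.add s2
    rw [add_zero] at s12
    have s123 := (cm (ENNReal.mul_lt_top hρ d0) s12).add s3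
    rw [add_zero] at s123
    have s4 := cm hC s123
    refine s4.congr fun n => ?_
    simp only [hδ]
    ring
  -- Chosen so that `ν₀ ≤ 1` and `Γ ν₀² ≤ 1/2`; the `+ 1` keeps the denominator away from zero.
  set ν₀ : ℝ≥0∞ := (1 / 2) / (Γ + 1) with hν₀
  have hν₀le : ν₀ ≤ 1 := by
    refine ENNReal.div_le_of_le_mul ?_
    calc (1 / 2 : ℝ≥0∞) ≤ 1 := ENNReal.half_le_self
      _ ≤ 1 * (Γ + 1) := by rw [one_mul]; exact le_add_self
  have hν₀pos : 0 < ν₀ := ENNReal.div_pos (by simp) (by simp [hΓfin.ne])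
  have hν₀top : ν₀ ≠ ∞ := ne_top_of_le_ne_top ENNReal.one_ne_top hν₀le
  have hΓν : Γ * ν₀ ^ 2 ≤ 1 / 2 := by
    calc Γ * ν₀ ^ 2 = Γ * ν₀ * ν₀ := by ring
      _ ≤ (Γ + 1) * ν₀ * 1 := by gcongr; exact le_self_add
      _ = 1 / 2 := by
        rw [mul_one, hν₀, ENNReal.mul_div_cancel (by simp) (by simp [hΓfin.ne])]
  obtain ⟨n, hn1, hnδ, hnφ⟩ : ∃ n : ℕ, 1 ≤ n ∧ 2 * δ n ≤ ν₀ / 2 ∧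
      eLpNorm ({x | (n : ℝ) < |x|}.indicator φ) 2 ≤ ν₀ := by
    have a1 : ∀ᶠ n in Filter.atTop, δ n ≤ ν₀ / 2 / 2 := hδ0.eventually_le_const
      (ENNReal.div_pos (ENNReal.div_pos hν₀pos.ne' (by simp)).ne' (by simp))
    have a2 := (tendsto_eLpNorm_indicator mφ hφ).eventually_le_const hν₀pos
    obtain ⟨n, h1, h2, h3⟩ := (Filter.eventually_ge_atTop 1 |>.and (a1.and a2)).exists
    refine ⟨n, h1, ?_, h3⟩
    calc 2 * δ n ≤ 2 * (ν₀ / 2 / 2) := by gcongr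
      _ = ν₀ / 2 := by rw [two_mul, ENNReal.add_halves]
  have npos : (0 : ℝ) < n := by exact_mod_cast hn1
  -- The bound `1 / (4n)` keeps the exponential at most `e` on `[-4n, 4n]`.
  set μ : ℝ := min μ₀ (1 / (4 * n)) with hμ
  have hμpos : 0 < μ := lt_min hμ₀ (by positivity)
  have hμn : μ * (4 * n) ≤ 1 := by
    calc μ * (4 * n) ≤ 1 / (4 * n) * (4 * n) := by gcongr; exact min_le_right _ _
      _ = 1 := by field_simp
  have hexle : ∀ y : ℝ, ENNReal.ofReal (Real.exp (μ * |y|)) ≤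
      ENNReal.ofReal (Real.exp (μ₀ * |y|)) := fun y => by
    gcongr; exact min_le_left _ _
  set far := {x : ℝ | 4 * (n : ℝ) < |x|} with hfar
  have mfar : MeasurableSet far := measurableSet_lt (by fun_prop) (by fun_prop)
  have step : ∀ j, eLpNorm (far.indicator fun x => expWeight μ j x * φ x) 2 ≤ ν₀ →
      eLpNorm (far.indicator fun x => expWeight μ j x * φ x) 2 ≤ ν₀ / 2 := fun j hj => by
    refine le_trans ?_ hnδ
    refine le_two_mul_of_le_add_cube (Γ := Γ) ?_ hj hν₀top hΓν
    refine (tail_estimate mφ ρ hμpos C hK n hμn j (hj.trans hν₀le)).trans ?_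
    have i1 : ∫⁻ y, ENNReal.ofReal (Real.exp (μ * |y|)) ∂ρ ≤ M := lintegral_mono hexle
    have i2 : ∫⁻ y, {y | 2 * (n : ℝ) < |y|}.indicator
        (fun y => ENNReal.ofReal (Real.exp (μ * |y|))) y ∂ρ ≤ ∫⁻ y, {y | 2 * (n : ℝ) < |y|}.indicator
        (fun y => ENNReal.ofReal (Real.exp (μ₀ * |y|))) y ∂ρ :=
      lintegral_mono fun y => indicator_le_indicator' (fun _ => hexle y)
    exact add_le_add (mul_le_mul_right (add_le_add (mul_le_mul_left (mul_le_mul_left i1 _) _)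
      (mul_le_mul_left (mul_le_mul_left i2 _) _)) _)
      (by rw [hΓ]; gcongr)
  -- For `j = 0` the weight is identically one, and the claim is that the tail of `φ` itself is
  -- small.
  have all : ∀ j, eLpNorm (far.indicator fun x => expWeight μ j x * φ x) 2 ≤ ν₀ := fun j => by
    induction j with
    | zero =>
      refine le_trans (eLpNorm_mono_enn fun x => ?_) hnφ
      simp only [expWeight_zero hμpos.le, one_mul]
      refine indicator_le_indicator_of_subset (fun x hx => ?_) (fun _ => zero_le) x
      simp only [hfar, mem_ofPred_eq] at hx ⊢
      linarith
    | succ j ih =>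
      have h1 := eLpNorm_indicator_expWeight_succ_le mφ mfar μ j
      refine h1.trans ((mul_le_mul_right (step j ih) 2).trans (le_of_eq ?_))
      rw [two_mul, ENNReal.add_halves]
  refine ⟨μ, hμpos, ?_⟩
  refine lt_of_le_of_lt (eLpNorm_exp_le_of_expWeight mφ μ fun j => ?_) hP
  exact (eLpNorm_expWeight_le mφ hμpos.le hμn j).trans
    (add_le_add le_rfl ((all j).trans hν₀le))

/-! ### The dispersion profile -/

/-- Layer-cake estimate for the integral against a monotone density. -/
theorem norm_integral_monotone_smul_le {a b : ℝ} {E : ℝ → ℂ} (hE : IntegrableOn E (Ioo a b))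
    {ρ : ℝ → ℝ} (mρ : Measurable ρ) (hρ : MonotoneOn ρ (Ioo a b)) {P : ℝ} (hP : 0 ≤ P)
    (h0 : ∀ s ∈ Ioo a b, 0 ≤ ρ s ∧ ρ s ≤ P) {B : ℝ}
    (hB : ∀ S ⊆ Ioo a b, S.OrdConnected → ‖∫ s in S, E s‖ ≤ B) :
    ‖∫ s in Ioo a b, ρ s • E s‖ ≤ P * B := by
  -- The layer-cake formula: `ρ s` is the length of the set of levels `l` in `(0, P]` below it.
  have e1 : ∀ s ∈ Ioo a b, ρ s • E s =
      ∫ l in Ioc 0 P, {z : ℝ × ℝ | z.2 < ρ z.1}.indicator (fun z => E z.1) (s, l) := by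
    intro s hs
    have : ∀ l, {z : ℝ × ℝ | z.2 < ρ z.1}.indicator (fun z => E z.1) (s, l) =
        (Iio (ρ s)).indicator (fun _ => E s) l := fun l => by
      by_cases h : l < ρ s <;> simp [h]
    simp only [this]
    rw [setIntegral_indicator measurableSet_Iio, setIntegral_const]
    congr 1
    have h2 : Ioc 0 P ∩ Iio (ρ s) = Ioo 0 (ρ s) := by
      ext x; simp only [mem_inter_iff, mem_Ioc, mem_Iio, mem_Ioo]
      have := (h0 s hs).2
      constructor
      · rintro ⟨⟨h, _⟩, h'⟩; exact ⟨h, h'⟩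
      · rintro ⟨h, h'⟩; exact ⟨⟨h, by linarith⟩, h'⟩
    rw [h2]
    simp [Measure.real, (h0 s hs).1]
  rw [setIntegral_congr_fun measurableSet_Ioo e1]
  have hint : Integrable (fun z : ℝ × ℝ => {z : ℝ × ℝ | z.2 < ρ z.1}.indicator (fun z => E z.1) z)
      ((volume.restrict (Ioo a b)).prod (volume.restrict (Ioc 0 P))) :=
    (hE.comp_fst _).indicator (measurableSet_lt (by fun_prop) (by fun_prop))
  rw [integral_integral_swap hint]
  have e2 : ∀ l, ‖∫ s in Ioo a b, {z : ℝ × ℝ | z.2 < ρ z.1}.indicator (fun z => E z.1) (s, l)‖ ≤ B := by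
    intro l
    have : ∀ s, {z : ℝ × ℝ | z.2 < ρ z.1}.indicator (fun z => E z.1) (s, l) =
        {s | l < ρ s}.indicator E s := fun s => by
      by_cases h : l < ρ s <;> simp [h]
    simp only [this]
    rw [setIntegral_indicator (measurableSet_lt (by fun_prop) (by fun_prop))]
    -- Superlevel sets of a monotone function on an interval are again intervals.
    refine hB _ inter_subset_left ⟨?_⟩
    rintro x ⟨hx, hx'⟩ y ⟨hy, hy'⟩ z hz
    have hzI : z ∈ Ioo a b := ⟨hx.1.trans_le hz.1, hz.2.trans_lt hy.2⟩
    exact ⟨hzI, lt_of_lt_of_le hx' (hρ hx hzI hz.1)⟩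
  refine (norm_setIntegral_le_of_norm_le_const (by simp) fun l _ => e2 l).trans ?_
  simp [Measure.real, hP, mul_comm]

/-- A function on an interval whose integrals against derivatives of test functions vanish is a.e.
constant. -/
theorem exists_ae_eq_const {a b : ℝ} (hab : a < b) {u : ℝ → ℝ} (hu : IntegrableOn u (Ioo a b))
    (h : ∀ φ : ℝ → ℝ, ContDiff ℝ (⊤ : ℕ∞) φ → HasCompactSupport φ → tsupport φ ⊆ Ioo a b →
      ∫ s in Ioo a b, u s * deriv φ s = 0) :
    ∃ c : ℝ, ∀ᵐ s ∂volume.restrict (Ioo a b), u s = c := by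
  set m := (a + b) / 2 with hm
  set θ : ContDiffBump m := ⟨(b - a) / 8, (b - a) / 4, by linarith, by linarith⟩ with hθ
  set η : ℝ → ℝ := θ.normed volume with hη
  have cη : ContDiff ℝ (⊤ : ℕ∞) η := θ.contDiff_normed
  have kη : HasCompactSupport η := θ.hasCompactSupport_normed
  have sη : tsupport η ⊆ Ioo a b := by
    rw [hη, θ.tsupport_normed_eq]
    intro x hx
    rw [Metric.mem_closedBall, Real.dist_eq, abs_le] at hx
    simp only [hθ] at hx
    constructor <;> linarith
  have iη : ∫ x, η x = 1 := θ.integral_normed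
  have bdd : ∀ ψ : ℝ → ℝ, Continuous ψ → HasCompactSupport ψ →
      IntegrableOn (fun s => u s * ψ s) (Ioo a b) := fun ψ h1 h2 => by
    obtain ⟨M, hM⟩ := h1.bounded_above_of_compact_support h2
    exact hu.mul_bdd (c := M) h1.aestronglyMeasurable (Filter.Eventually.of_forall hM)
  refine ⟨∫ s in Ioo a b, u s * η s, ?_⟩
  set c := ∫ s in Ioo a b, u s * η s
  rw [ae_restrict_iff' measurableSet_Ioo]
  have hloc : LocallyIntegrableOn (fun s => u s - c) (Ioo a b) :=
    (hu.sub (integrableOn_const (by simp))).locallyIntegrableOn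
  have := isOpen_Ioo.ae_eq_zero_of_integral_contDiff_smul_eq_zero hloc fun ψ h1 h2 h3 => ?_
  · filter_upwards [this] with s hs hs'
    exact sub_eq_zero.1 (hs hs')
  · set I := ∫ x, ψ x with hI
    have iψ : Integrable ψ := h1.continuous.integrable_of_hasCompactSupport h2
    have iη' : Integrable η := cη.continuous.integrable_of_hasCompactSupport kη
    -- Subtracting `I η`, where `η` has integral one, gives a test function of mean zero, whose
    -- primitive has compact support and can be used in `h`.
    set g : ℝ → ℝ := fun x => ψ x - I * η x with hg
    have cg : ContDiff ℝ (⊤ : ℕ∞) g := h1.sub (contDiff_const.mul cη)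
    have zg : ∀ x, x ∉ tsupport ψ ∪ tsupport η → g x = 0 := fun x hx => by
      rw [mem_union, not_or] at hx
      simp only [hg]
      rw [image_eq_zero_of_notMem_tsupport hx.1, image_eq_zero_of_notMem_tsupport hx.2]
      simp
    have intg : ∫ x, g x = 0 := by
      simp only [hg]
      rw [integral_sub iψ (iη'.const_mul I), integral_const_mul, iη, mul_one, sub_self]
    -- Compactness leaves a margin at both ends of the interval, needed for the support of the
    -- primitive; the union is nonempty because `η` is not zero.
    obtain ⟨a', b', ha', hb', hsub⟩ : ∃ a' b', a < a' ∧ b' < b ∧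
        tsupport ψ ∪ tsupport η ⊆ Icc a' b' := by
      have hcpt : IsCompact (tsupport ψ ∪ tsupport η) := h2.isCompact.union kη.isCompact
      have hne : (tsupport ψ ∪ tsupport η).Nonempty := by
        by_contra hemp
        rw [not_nonempty_iff_eq_empty, union_empty_iff] at hemp
        have : η = 0 := tsupport_eq_empty_iff.1 hemp.2
        simp [this] at iη
      have hin : tsupport ψ ∪ tsupport η ⊆ Ioo a b := union_subset h3 sη
      exact ⟨_, _, (hin (hcpt.sInf_mem hne)).1, (hin (hcpt.sSup_mem hne)).2,
        fun x hx => ⟨csInf_le hcpt.bddBelow hx, le_csSup hcpt.bddAbove hx⟩⟩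
    have zg' : ∀ x, x ∉ Icc a' b' → g x = 0 := fun x hx => zg x fun h => hx (hsub h)
    set φ : ℝ → ℝ := fun x => ∫ t in a..x, g t with hφ
    have dφ : ∀ x, HasDerivAt φ (g x) x := fun x =>
      intervalIntegral.integral_hasDerivAt_right (cg.continuous.intervalIntegrable _ _)
        (cg.continuous.stronglyMeasurableAtFilter _ _) cg.continuous.continuousAt
    have eφ : deriv φ = g := funext fun x => (dφ x).deriv
    have cφ : ContDiff ℝ (⊤ : ℕ∞) φ := by
      rw [contDiff_infty_iff_deriv]
      exact ⟨fun x => (dφ x).differentiableAt, by rw [eφ]; exact cg⟩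
    have zφ : ∀ x, x ∉ Icc a' b' → φ x = 0 := fun x hx => by
      have key : ∀ y, y < a' → ∫ t in a..y, g t = 0 := fun y hy => by
        rw [intervalIntegral.integral_congr (g := fun _ => 0), intervalIntegral.integral_zero]
        intro t ht
        refine zg' t fun h => ?_
        have := ht.2.trans_lt (sup_lt_iff.2 ⟨ha', hy⟩)
        linarith [h.1]
      rw [mem_Icc, not_and_or, not_le, not_le] at hx
      rcases hx with hx | hx
      · exact key x hx
      · have h4 : ∫ t in a..x, g t = ∫ t, g t := by
          refine intervalIntegral.integral_eq_integral_of_support_subset fun t ht => ?_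
          have := not_imp_comm.1 (zg' t) ht
          exact ⟨ha'.trans_le this.1, this.2.trans hx.le⟩
        simp only [hφ]
        rw [h4, intg]
    have supp : tsupport φ ⊆ Icc a' b' :=
      closure_minimal (fun x hx => not_imp_comm.1 (zφ x) hx) isClosed_Icc
    have kφ : HasCompactSupport φ := HasCompactSupport.intro isCompact_Icc zφ
    have h0 := h φ cφ kφ (supp.trans fun x hx => ⟨ha'.trans_le hx.1, hx.2.trans_lt hb'⟩)
    rw [eφ] at h0
    simp only [hg, mul_sub, mul_left_comm _ I] at h0
    rw [integral_sub (bdd ψ h1.continuous h2) ((bdd η cη.continuous kη).const_mul I),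
      integral_const_mul] at h0
    have e1 : ∫ x, ψ x • (u x - c) = ∫ x in Ioo a b, ψ x • (u x - c) := by
      rw [setIntegral_eq_integral_of_forall_compl_eq_zero]
      intro x hx
      rw [image_eq_zero_of_notMem_tsupport fun h => hx (h3 h), zero_smul]
    have e2 : ∫ x in Ioo a b, ψ x = I :=
      setIntegral_eq_integral_of_forall_compl_eq_zero fun x hx =>
        image_eq_zero_of_notMem_tsupport fun h => hx (h3 h)
    rw [e1]
    simp only [smul_eq_mul, mul_sub]
    rw [integral_sub, integral_mul_const, e2]
    · simp only [mul_comm (ψ _)]; exact h0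
    · simp only [mul_comm (ψ _)]
      exact bdd ψ h1.continuous h2
    · exact iψ.integrableOn.mul_const c

/-- A `W^{1,1}` function on an interval is a.e. equal to a primitive of its derivative. -/
theorem MemW11.exists_primitive {d : ℝ → ℝ} {a b : ℝ} (hab : a < b) (hd : MemW11 d a b) :
    ∃ (c : ℝ) (v : ℝ → ℝ), Integrable v ∧
      ∀ᵐ s ∂volume.restrict (Ioo a b), d s = c + ∫ t in a..s, v t := by
  obtain ⟨hd, d', hd', h⟩ := hd
  set v := (Ioo a b).indicator d' with hv
  have iv : Integrable v := (integrable_indicator_iff measurableSet_Ioo).2 hd'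
  have cV : Continuous fun s => ∫ t in a..s, v t := intervalIntegral.continuous_primitive
    (fun _ _ => iv.intervalIntegrable) a
  have iV : IntegrableOn (fun s => ∫ t in a..s, v t) (Ioo a b) :=
    (cV.integrableOn_Icc (a := a) (b := b)).mono_set Ioo_subset_Icc_self
  have hz : ∀ φ : ℝ → ℝ, ContDiff ℝ (⊤ : ℕ∞) φ → HasCompactSupport φ → tsupport φ ⊆ Ioo a b →
      ∫ s in Ioo a b, (d s - ∫ t in a..s, v t) * deriv φ s = 0 := by
    intro φ h1 h2 h3
    have hφa : φ a = 0 := image_eq_zero_of_notMem_tsupport fun h => by simpa using h3 h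
    have hφb : φ b = 0 := image_eq_zero_of_notMem_tsupport fun h => by simpa using h3 h
    have cφ' : Continuous (deriv φ) := h1.continuous_deriv (by simp)
    -- The primitive of `v` is only absolutely continuous, so the integration by parts takes place
    -- in that class.
    have acφ : AbsolutelyContinuousOnInterval φ a b := by
      have h4 := (cφ'.intervalIntegrable (μ := volume) a b).absolutelyContinuousOnInterval_intervalIntegral
        (c := a) (by simp)
      convert h4 using 2 with x
      rw [intervalIntegral.integral_deriv_eq_sub (fun _ _ => h1.differentiable (by simp) _)
        (cφ'.intervalIntegrable _ _), hφa, sub_zero]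
    have acV := (iv.intervalIntegrable (a := a) (b := b)).absolutelyContinuousOnInterval_intervalIntegral
        (c := a) (by simp)
    have parts := acV.integral_mul_deriv_eq_deriv_mul acφ
    have hvd : ∫ x in a..b, deriv (fun s => ∫ t in a..s, v t) x * φ x = ∫ x in a..b, v x * φ x := by
      refine intervalIntegral.integral_congr_ae ?_
      filter_upwards [(iv.intervalIntegrable (a := a) (b := b)).ae_hasDerivAt_integral] with x hx hx'
      rw [(hx (uIoc_subset_uIcc hx') a (by simp)).deriv]
    rw [hvd, hφa, hφb, mul_zero, mul_zero, sub_zero, zero_sub,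
      intervalIntegral.integral_of_le hab.le, intervalIntegral.integral_of_le hab.le,
      integral_Ioc_eq_integral_Ioo, integral_Ioc_eq_integral_Ioo] at parts
    have hv' : ∫ s in Ioo a b, v s * φ s = ∫ s in Ioo a b, d' s * φ s :=
      setIntegral_congr_fun measurableSet_Ioo fun s hs => by simp [hv, hs]
    obtain ⟨M, hM⟩ := cφ'.bounded_above_of_compact_support h2.deriv
    have i1 : IntegrableOn (fun s => d s * deriv φ s) (Ioo a b) :=
      hd.mul_bdd (c := M) cφ'.aestronglyMeasurable (Filter.Eventually.of_forall hM)
    have i2 : IntegrableOn (fun s => (∫ t in a..s, v t) * deriv φ s) (Ioo a b) :=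
      iV.mul_bdd (c := M) cφ'.aestronglyMeasurable (Filter.Eventually.of_forall hM)
    simp only [sub_mul]
    rw [integral_sub i1 i2, h φ h1 h2 h3, parts, hv', sub_neg_eq_add, neg_add_cancel]
  obtain ⟨c, hc⟩ := exists_ae_eq_const hab (hd.sub iV) hz
  refine ⟨c, v, iv, ?_⟩
  filter_upwards [hc] with s hs
  simp only [Pi.sub_apply] at hs
  linarith

/-! ### The change of variables by the accumulated dispersion -/

/-- Integrals over connected subsets of `[-R, R]` are interval integrals. -/
theorem exists_setIntegral_eq_intervalIntegral {R : ℝ} (hR : 0 ≤ R) {J : Set ℝ}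
    (hJ : IsPreconnected J) (hJR : J ⊆ Icc (-R) R) (e : ℝ → ℂ) :
    ∃ α β : ℝ, -R ≤ α ∧ α ≤ β ∧ β ≤ R ∧ ∫ r in J, e r = ∫ r in α..β, e r := by
  rcases J.eq_empty_or_nonempty with rfl | hne
  · exact ⟨0, 0, by linarith, le_rfl, hR, by simp⟩
  · have hb : BddBelow J := ⟨-R, fun x hx => (hJR hx).1⟩
    have ha : BddAbove J := ⟨R, fun x hx => (hJR hx).2⟩
    have hle : sInf J ≤ sSup J := csInf_le_csSup hne hb ha
    refine ⟨sInf J, sSup J, le_csInf hne fun x hx => (hJR hx).1, hle,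
      csSup_le hne fun x hx => (hJR hx).2, ?_⟩
    rw [intervalIntegral.integral_of_le hle]
    refine setIntegral_congr_set ?_
    have s1 := IsConnected.Ioo_csInf_csSup_subset ⟨hne, hJ⟩ hb ha
    have s2 := subset_Icc_csInf_csSup hb ha
    have h1 : J ≤ᵐ[volume] Ioc (sInf J) (sSup J) :=
      s2.eventuallyLE.trans Ioc_ae_eq_Icc.symm.le
    have h2 : Ioc (sInf J) (sSup J) ≤ᵐ[volume] J :=
      Ioo_ae_eq_Ioc.symm.le.trans s1.eventuallyLE
    exact h1.antisymm h2

/-- Substituting `r = D(s)` produces the density `1/|w|`, where `w = D'` is the absolutely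
continuous representative of the profile. Its variation is at most `∫|v| / δ²`, so it is the
difference of two bounded nondecreasing functions, each handled by the layer-cake estimate. This way
no derivative falls on `e`. -/
theorem norm_integral_comp_piece_le {a b c δ R D₀ : ℝ} (hδ : 0 < δ) (hR : 0 ≤ R)
    {v : ℝ → ℝ} (iv : Integrable v)
    (hlow : ∀ s ∈ Ioo a b, δ ≤ |c + ∫ t in a..s, v t|)
    (hDR : ∀ s ∈ Ioo a b, |D₀ + ∫ t in a..s, (c + ∫ u in a..t, v u)| ≤ R)
    {e : ℝ → ℂ} (me : Measurable e) {M : ℝ} (hM : ∀ r, ‖e r‖ ≤ M) {B : ℝ}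
    (hB : ∀ α β, -R ≤ α → α ≤ β → β ≤ R → ‖∫ r in α..β, e r‖ ≤ B) :
    ‖∫ s in Ioo a b, e (D₀ + ∫ t in a..s, (c + ∫ u in a..t, v u))‖ ≤
      (1 / δ + 2 * ((∫ t, |v t|) / δ ^ 2)) * B := by
  set w : ℝ → ℝ := fun t => c + ∫ u in a..t, v u with hw
  have cw : Continuous w := continuous_const.add (intervalIntegral.continuous_primitive
    (fun _ _ => iv.intervalIntegrable) a)
  set D : ℝ → ℝ := fun s => D₀ + ∫ t in a..s, w t with hD
  have dD : ∀ x, HasDerivAt D (w x) x := fun x => (intervalIntegral.integral_hasDerivAt_right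
    (cw.intervalIntegrable _ _) (cw.stronglyMeasurableAtFilter _ _) cw.continuousAt).const_add D₀
  have cD : Continuous D := continuous_iff_continuousAt.2 fun x => (dD x).continuousAt
  -- `V` dominates the variation of `|w|⁻¹`, so both `V` and `|w|⁻¹ + V` are nondecreasing.
  set V : ℝ → ℝ := fun s => (∫ t in a..s, |v t|) / δ ^ 2 with hV
  have iabs : Integrable fun t => |v t| := iv.abs
  have cV : Continuous V := (intervalIntegral.continuous_primitive
    (fun _ _ => iabs.intervalIntegrable) a).div_const _
  have V0 : ∀ s ∈ Ioo a b, 0 ≤ V s := fun s hs =>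
    div_nonneg (intervalIntegral.integral_nonneg hs.1.le fun _ _ => abs_nonneg _) (by positivity)
  set Vt := (∫ t, |v t|) / δ ^ 2 with hVt
  have Vt0 : 0 ≤ Vt := div_nonneg (integral_nonneg fun _ => abs_nonneg _) (by positivity)
  have V1 : ∀ s ∈ Ioo a b, V s ≤ Vt := fun s hs => by
    simp only [hV, hVt]
    gcongr
    rw [intervalIntegral.integral_of_le hs.1.le]
    exact setIntegral_le_integral iabs (Filter.Eventually.of_forall fun _ => abs_nonneg _)
  have mono : ∀ s ∈ Ioo a b, ∀ t ∈ Ioo a b, s ≤ t →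
      V s ≤ V t ∧ |(|w s|⁻¹ - |w t|⁻¹)| ≤ V t - V s := by
    intro s hs t ht hst
    have e1 : V t - V s = (∫ x in s..t, |v x|) / δ ^ 2 := by
      simp only [hV]
      rw [← sub_div, intervalIntegral.integral_interval_sub_left iabs.intervalIntegrable
        iabs.intervalIntegrable]
    have e2 : w t - w s = ∫ x in s..t, v x := by
      simp only [hw]
      rw [add_sub_add_left_eq_sub, intervalIntegral.integral_interval_sub_left
        iv.intervalIntegrable iv.intervalIntegrable]
    have h1 : |w t - w s| ≤ ∫ x in s..t, |v x| := by
      rw [e2]; exact intervalIntegral.abs_integral_le_integral_abs hst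
    have p1 := hlow s hs
    have p2 := hlow t ht
    have h2 : |(|w s|⁻¹ - |w t|⁻¹)| ≤ V t - V s := by
      have q1 : 0 < |w s| := hδ.trans_le p1
      have q2 : 0 < |w t| := hδ.trans_le p2
      rw [inv_sub_inv q1.ne' q2.ne', abs_div, abs_mul, abs_abs, abs_abs, e1]
      gcongr
      · exact (abs_nonneg _).trans h1
      · exact (abs_abs_sub_abs_le _ _).trans h1
      · rw [sq]; gcongr
    exact ⟨by linarith [abs_nonneg (|w s|⁻¹ - |w t|⁻¹)], h2⟩
  have iE : IntegrableOn (fun s => |w s| • e (D s)) (Ioo a b) := by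
    have h1 : IntegrableOn (fun s => |w s|) (Ioo a b) :=
      (cw.abs.integrableOn_Icc (a := a) (b := b)).mono_set Ioo_subset_Icc_self
    simp only [Complex.real_smul]
    exact (h1.ofReal).mul_bdd (c := M) (me.comp cD.measurable).aestronglyMeasurable
      (Filter.Eventually.of_forall fun s => hM _)
  -- By Rolle, two equal values would give a zero of `w`, contradicting `|w| ≥ δ`.
  have hinj : InjOn D (Ioo a b) := by
    have key : ∀ x ∈ Ioo a b, ∀ y ∈ Ioo a b, x < y → D x ≠ D y := by
      intro x hx y hy hxy heq
      obtain ⟨z, hz, hz0⟩ := exists_hasDerivAt_eq_zero hxy cD.continuousOn heq fun z _ => dD z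
      have := hlow z ⟨hx.1.trans hz.1, hz.2.trans hy.2⟩
      change δ ≤ |w z| at this
      rw [hz0, abs_zero] at this
      linarith
    intro x hx y hy heq
    rcases lt_trichotomy x y with h | h | h
    · exact absurd heq (key x hx y hy h)
    · exact h
    · exact absurd heq.symm (key y hy x hx h)
  -- The factor `|w|` is the Jacobian, and the image of an interval under `D` is an interval inside
  -- `[-R, R]`.
  have hB' : ∀ S ⊆ Ioo a b, S.OrdConnected → ‖∫ s in S, |w s| • e (D s)‖ ≤ B := by
    intro S hS hS'
    rw [← integral_image_eq_integral_abs_deriv_smul hS'.measurableSet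
      (fun x _ => (dD x).hasDerivWithinAt) (hinj.mono hS)]
    obtain ⟨α, β, h1, h2, h3, h4⟩ := exists_setIntegral_eq_intervalIntegral hR
      (hS'.isPreconnected.image D cD.continuousOn) (J := D '' S) (by
        rintro _ ⟨x, hx, rfl⟩
        exact abs_le.1 (hDR x (hS hx))) e
    rw [h4]
    exact hB α β h1 h2 h3
  have mw : Measurable fun s => |w s|⁻¹ := cw.measurable.abs.inv
  have hinv : ∀ s ∈ Ioo a b, |w s|⁻¹ ≤ 1 / δ := fun s hs => by
    rw [one_div]
    exact inv_anti₀ hδ (hlow s hs)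
  have T1 := norm_integral_monotone_smul_le iE (ρ := fun s => |w s|⁻¹ + V s)
    (mw.add cV.measurable) (fun s hs t ht hst => by
      have := (abs_le.1 (mono s hs t ht hst).2).2
      simp only
      linarith) (P := 1 / δ + Vt) (by positivity) (fun s hs => ⟨add_nonneg (by positivity)
        (V0 s hs), add_le_add (hinv s hs) (V1 s hs)⟩) hB'
  have T2 := norm_integral_monotone_smul_le iE (ρ := V) cV.measurable
    (fun s hs t ht hst => (mono s hs t ht hst).1) Vt0 (fun s hs => ⟨V0 s hs, V1 s hs⟩) hB'
  have bddI : ∀ (ρ : ℝ → ℝ) (P : ℝ), Measurable ρ → (∀ s ∈ Ioo a b, 0 ≤ ρ s ∧ ρ s ≤ P) →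
      IntegrableOn (fun s => ρ s • (|w s| • e (D s))) (Ioo a b) := fun ρ P mρ hP => by
    refine iE.bdd_smul P mρ.aestronglyMeasurable ?_
    filter_upwards [ae_restrict_mem measurableSet_Ioo] with s hs
    rw [Real.norm_of_nonneg (hP s hs).1]
    exact (hP s hs).2
  have split : ∫ s in Ioo a b, e (D s) = (∫ s in Ioo a b, (|w s|⁻¹ + V s) • (|w s| • e (D s))) -
      ∫ s in Ioo a b, V s • (|w s| • e (D s)) := by
    rw [← integral_sub (bddI (fun s => |w s|⁻¹ + V s) (1 / δ + Vt) (mw.add cV.measurable) fun s hs =>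
      ⟨add_nonneg (by positivity) (V0 s hs), add_le_add (hinv s hs) (V1 s hs)⟩)
      (bddI V Vt cV.measurable fun s hs => ⟨V0 s hs, V1 s hs⟩)]
    refine setIntegral_congr_fun measurableSet_Ioo fun s hs => ?_
    have q1 : |w s| ≠ 0 := (hδ.trans_le (hlow s hs)).ne'
    rw [add_smul, add_sub_cancel_right, smul_smul, inv_mul_cancel₀ q1, one_smul]
  rw [split]
  calc _ ≤ (1 / δ + Vt) * B + Vt * B := (norm_sub_le _ _).trans (add_le_add T1 T2)
    _ = _ := by ring

/-- The profile `d₀` is integrable over `[0, L]`. -/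
theorem PiecewiseW11.intervalIntegrable {d₀ : ℝ → ℝ} {L : ℝ} (h : PiecewiseW11 d₀ L) :
    IntervalIntegrable d₀ volume 0 L := by
  obtain ⟨N, c, hc, hc0, hcL, hp⟩ := h
  have : ∀ j : Fin (N + 1), IntervalIntegrable d₀ volume 0 (c j) := fun j => by
    induction j using Fin.induction with
    | zero => rw [hc0]
    | succ j ih =>
      refine ih.trans ?_
      rw [intervalIntegrable_iff_integrableOn_Ioo_of_le (hc j.castSucc_lt_succ).le]
      exact (hp j).1
  rw [← hcL]
  exact this _

theorem BoundedAwayFromZero.exists_pos {d₀ : ℝ → ℝ} {L : ℝ} (h : BoundedAwayFromZero d₀ L) :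
    ∃ δ : ℝ, 0 < δ ∧ ∀ᵐ s ∂volume.restrict (Icc 0 L), δ ≤ |d₀ s| := by
  unfold BoundedAwayFromZero at h
  rw [essInf, Filter.liminf_eq] at h
  -- The supremum of an empty set of reals is `0`, which a positive essential infimum excludes.
  have hne : {a | ∀ᶠ s in ae (volume.restrict (Icc 0 L)), a ≤ |d₀ s|}.Nonempty := by
    by_contra hemp
    rw [not_nonempty_iff_eq_empty] at hemp
    rw [hemp, Real.sSup_empty] at h
    exact lt_irrefl _ h
  obtain ⟨δ, h1, h2⟩ := exists_lt_of_lt_csSup hne h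
  exact ⟨δ, h2, h1⟩

theorem continuousOn_accDispersion {d₀ : ℝ → ℝ} {L : ℝ} (hL : 0 ≤ L) (h : PiecewiseW11 d₀ L) :
    ContinuousOn (accDispersion d₀) (Icc 0 L) := by
  have := h.intervalIntegrable
  rw [← uIcc_of_le hL]
  exact intervalIntegral.continuousOn_primitive_interval' this (by simp)

theorem aemeasurable_accDispersion {d₀ : ℝ → ℝ} {L : ℝ} (hL : 0 ≤ L) (h : PiecewiseW11 d₀ L) :
    AEMeasurable (accDispersion d₀) (volume.restrict (Ioc 0 L)) :=
  ((continuousOn_accDispersion hL h).mono Ioc_subset_Icc_self).aemeasurable measurableSet_Ioc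

/-- Integrals of functions of `D(s)` over `[0, L]` are controlled by integrals over intervals. -/
theorem exists_norm_integral_comp_accDispersion_le {d₀ : ℝ → ℝ} {L : ℝ} (hL : 0 < L)
    (h : PiecewiseW11 d₀ L) (h' : BoundedAwayFromZero d₀ L) :
    ∃ C R : ℝ, 0 < C ∧ 0 < R ∧ ∀ (e : ℝ → ℂ), Measurable e → (∃ M, ∀ r, ‖e r‖ ≤ M) →
      ∀ B : ℝ, (∀ α β, -R ≤ α → α ≤ β → β ≤ R → ‖∫ r in α..β, e r‖ ≤ B) →
        ‖∫ s in (0 : ℝ)..L, e (accDispersion d₀ s)‖ ≤ C * B := by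
  have hint := h.intervalIntegrable
  have hcont := continuousOn_accDispersion hL.le h
  have mD := aemeasurable_accDispersion hL.le h
  obtain ⟨δ, hδ, hlow⟩ := h'.exists_pos
  obtain ⟨R, hR⟩ : ∃ R, ∀ s ∈ Icc 0 L, |accDispersion d₀ s| ≤ R := by
    obtain ⟨R, hR⟩ := isCompact_Icc.exists_bound_of_continuousOn hcont
    exact ⟨R, hR⟩
  have hR0 : 0 ≤ R := (abs_nonneg _).trans (hR 0 ⟨le_rfl, hL.le⟩)
  obtain ⟨N, c, hc, hc0, hcL, hp⟩ := h
  have hcI : ∀ j, c j ∈ Icc 0 L := fun j => by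
    constructor
    · rw [← hc0]; exact hc.monotone (Fin.zero_le j)
    · rw [← hcL]; exact hc.monotone (Fin.le_last j)
  -- The constants accumulate by induction over the breakpoints, for the integral from `0` to `c j`.
  have key : ∀ j : Fin (N + 1), ∃ C : ℝ, 0 ≤ C ∧
      ∀ (e : ℝ → ℂ), Measurable e → (∃ M, ∀ r, ‖e r‖ ≤ M) →
      ∀ B : ℝ, (∀ α β, -(R + 1) ≤ α → α ≤ β → β ≤ R + 1 → ‖∫ r in α..β, e r‖ ≤ B) →
        ‖∫ s in (0 : ℝ)..(c j), e (accDispersion d₀ s)‖ ≤ C * B := fun j => by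
    induction j using Fin.induction with
    | zero => exact ⟨0, le_rfl, fun e _ _ B _ => by simp [hc0]⟩
    | succ j ih =>
      obtain ⟨C, hC, ih⟩ := ih
      set a := c j.castSucc with ha
      set b := c j.succ with hb
      have hab : a < b := hc j.castSucc_lt_succ
      have hIcc : Icc a b ⊆ Icc 0 L := Icc_subset_Icc (hcI _).1 (hcI _).2
      obtain ⟨k, v, iv, hv⟩ := (hp j).exists_primitive hab
      have cw : Continuous fun s => k + ∫ t in a..s, v t :=
        continuous_const.add (intervalIntegral.continuous_primitive
          (fun _ _ => iv.intervalIntegrable) a)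
      -- The lower bound holds almost everywhere; the exceptional set of the continuous
      -- representative is open and null, hence empty.
      have low : ∀ s ∈ Ioo a b, δ ≤ |k + ∫ t in a..s, v t| := by
        have h1 : ∀ᵐ s ∂volume.restrict (Ioo a b), δ ≤ |k + ∫ t in a..s, v t| := by
          filter_upwards [hv, ae_restrict_of_ae_restrict_of_subset
            (Ioo_subset_Icc_self.trans hIcc) hlow] with s hs hs'
          rwa [← hs]
        set U := Ioo a b ∩ {s | |k + ∫ t in a..s, v t| < δ} with hU
        have oU : IsOpen U := isOpen_Ioo.inter (isOpen_lt cw.abs continuous_const)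
        have zU : volume U = 0 := by
          rw [ae_restrict_iff' measurableSet_Ioo, ae_iff] at h1
          refine measure_mono_null (fun s hs => ?_) h1
          simp only [mem_ofPred_eq, Classical.not_imp, not_le]
          exact hs
        rw [IsOpen.measure_eq_zero_iff (μ := volume) oU] at zU
        intro s hs
        by_contra hlt
        exact (zU ▸ (⟨hs, not_le.1 hlt⟩ : s ∈ U) : s ∈ (∅ : Set ℝ))
      have hDform : ∀ s ∈ Ioo a b, accDispersion d₀ s =
          accDispersion d₀ a + ∫ t in a..s, (k + ∫ u in a..t, v u) := by
        intro s hs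
        have hs' : s ∈ Icc 0 L := hIcc ⟨hs.1.le, hs.2.le⟩
        have i1 : IntervalIntegrable d₀ volume 0 a := hint.mono_set (by
          rw [uIcc_of_le (hcI _).1, uIcc_of_le hL.le]; exact Icc_subset_Icc_right (hcI _).2)
        have i2 : IntervalIntegrable d₀ volume a s := hint.mono_set (by
          rw [uIcc_of_le hs.1.le, uIcc_of_le hL.le]; exact Icc_subset_Icc (hcI _).1 hs'.2)
        unfold accDispersion
        rw [← intervalIntegral.integral_add_adjacent_intervals i1 i2]
        congr 1
        rw [intervalIntegral.integral_of_le hs.1.le, intervalIntegral.integral_of_le hs.1.le]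
        refine integral_congr_ae ?_
        have hsub : Ioc a s ⊆ Ioo a b := fun x hx => ⟨hx.1, hx.2.trans_lt hs.2⟩
        exact ae_restrict_of_ae_restrict_of_subset hsub hv
      refine ⟨C + (1 / δ + 2 * ((∫ t, |v t|) / δ ^ 2)), ?_, fun e me hM B hB => ?_⟩
      · have : 0 ≤ ∫ t, |v t| := integral_nonneg fun _ => abs_nonneg _
        positivity
      · have ie : ∀ x y, x ∈ Icc 0 L → y ∈ Icc 0 L → x ≤ y →
            IntervalIntegrable (fun s => e (accDispersion d₀ s)) volume x y := by
          intro x y hx hy hxy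
          obtain ⟨M, hM⟩ := hM
          rw [intervalIntegrable_iff_integrableOn_Ioc_of_le hxy]
          refine Integrable.of_bound (C := M) ?_ (Filter.Eventually.of_forall fun s => hM _)
          exact ((me.comp_aemeasurable (mD.mono_measure (Measure.restrict_mono
            (Ioc_subset_Ioc hx.1 hy.2) le_rfl)))).aestronglyMeasurable
        rw [← intervalIntegral.integral_add_adjacent_intervals
          (ie 0 a ⟨le_rfl, hL.le⟩ (hcI _) (hcI _).1) (ie a b (hcI _) (hcI _) hab.le)]
        refine (norm_add_le _ _).trans ?_
        rw [add_mul]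
        refine add_le_add (ih e me hM B hB) ?_
        rw [intervalIntegral.integral_of_le hab.le, integral_Ioc_eq_integral_Ioo,
          setIntegral_congr_fun measurableSet_Ioo (fun s hs => by rw [hDform s hs])]
        obtain ⟨M, hM⟩ := hM
        refine norm_integral_comp_piece_le hδ (by linarith : 0 ≤ R + 1) iv low ?_ me hM hB
        intro s hs
        rw [← hDform s hs]
        exact (hR s (hIcc ⟨hs.1.le, hs.2.le⟩)).trans (by linarith)
  obtain ⟨C, hC, hlast⟩ := key (Fin.last N)
  rw [hcL] at hlast
  -- Passing to `C + 1` makes the constant positive. This is harmless since `B ≥ 0`, as the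
  -- degenerate interval `α = β = 0` shows.
  refine ⟨C + 1, R + 1, by linarith, by linarith, fun e me hM B hB => ?_⟩
  refine (hlast e me hM B hB).trans ?_
  have hB0 : 0 ≤ B := (norm_nonneg _).trans (hB 0 0 (by linarith) le_rfl (by linarith))
  linarith

/-! ### Oscillatory integrals -/

/-- The weight as a real number. -/
def weightReal (θ : ℝ) : ℝ := min (|θ| ^ (-(1 / 4) : ℝ)) (|θ| ^ (-(3 / 4) : ℝ))

theorem weight_enorm {θ : ℝ} (hθ : θ ≠ 0) : weight ‖θ‖ₑ = ENNReal.ofReal (weightReal θ) := by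
  have h : 0 < |θ| := abs_pos.2 hθ
  rw [weight, weightReal, ENNReal.ofReal_min, ← ofReal_norm, Real.norm_eq_abs,
    ENNReal.ofReal_rpow_of_pos h, ENNReal.ofReal_rpow_of_pos h]

theorem le_mul_weightReal {θ x C : ℝ} (hθ : θ ≠ 0)
    (h₁ : |θ| ≤ 1 → x ≤ C * |θ| ^ (-(1 / 4) : ℝ)) (h₂ : 1 ≤ |θ| → x ≤ C * |θ| ^ (-(3 / 4) : ℝ)) :
    x ≤ C * weightReal θ := by
  have h : 0 < |θ| := abs_pos.2 hθ
  rw [weightReal]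
  rcases le_total |θ| 1 with h' | h'
  · rw [min_eq_left (Real.rpow_le_rpow_of_exponent_ge h h' (by norm_num))]
    exact h₁ h'
  · rw [min_eq_right (Real.rpow_le_rpow_of_exponent_le h' (by norm_num))]
    exact h₂ h'

theorem weightReal_neg (θ : ℝ) : weightReal (-θ) = weightReal θ := by simp [weightReal]

theorem inv_abs_le_rpow {θ : ℝ} (h : 1 ≤ |θ|) : |θ|⁻¹ ≤ |θ| ^ (-(3 / 4) : ℝ) := by
  rw [← Real.rpow_neg_one]
  exact Real.rpow_le_rpow_of_exponent_le h (by norm_num)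

theorem one_le_rpow_abs {θ : ℝ} (hθ : θ ≠ 0) (h : |θ| ≤ 1) : 1 ≤ |θ| ^ (-(1 / 4) : ℝ) :=
  Real.one_le_rpow_of_pos_of_le_one_of_nonpos (abs_pos.2 hθ) h (by norm_num)

/-- For `|θ| ≤ 1` the length of the interval is enough; for `|θ| ≥ 1` the explicit primitive gives
`2/|θ|`. -/
theorem norm_integral_exp_le {R : ℝ} (hR : 0 < R) {θ : ℝ} (hθ : θ ≠ 0) {α β : ℝ} (hα : -R ≤ α)
    (hαβ : α ≤ β) (hβ : β ≤ R) :
    ‖∫ r in α..β, Complex.exp (Complex.I * (θ * r : ℝ))‖ ≤ 2 * (R + 1) * weightReal θ := by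
  refine le_mul_weightReal hθ (fun h => ?_) fun h => ?_
  · have h1 := intervalIntegral.norm_integral_le_of_norm_le_const (a := α) (b := β) (C := 1)
      (f := fun r => Complex.exp (Complex.I * (θ * r : ℝ))) (fun r _ => by
        rw [mul_comm, Complex.norm_exp_ofReal_mul_I])
    rw [one_mul, abs_of_nonneg (by linarith)] at h1
    have := one_le_rpow_abs hθ h
    nlinarith
  · have hc : Complex.I * (θ : ℂ) ≠ 0 := mul_ne_zero Complex.I_ne_zero (by exact_mod_cast hθ)
    have h1 : ∫ r in α..β, Complex.exp (Complex.I * (θ * r : ℝ)) =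
        (Complex.exp (Complex.I * (θ * β : ℝ)) - Complex.exp (Complex.I * (θ * α : ℝ))) /
          (Complex.I * θ) := by
      have := integral_exp_mul_complex (a := α) (b := β) hc
      push_cast
      simpa only [mul_assoc] using this
    have h2 : ∀ x : ℝ, ‖Complex.exp (Complex.I * (θ * x : ℝ))‖ = 1 := fun x => by
      rw [mul_comm, Complex.norm_exp_ofReal_mul_I]
    rw [h1, norm_div, norm_mul, Complex.norm_I, one_mul, Complex.norm_real, Real.norm_eq_abs,
      div_eq_mul_inv]
    have h3 : ‖Complex.exp (Complex.I * (θ * β : ℝ)) - Complex.exp (Complex.I * (θ * α : ℝ))‖ ≤ 2 := by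
      refine (norm_sub_le _ _).trans ?_
      rw [h2, h2]; norm_num
    have := inv_abs_le_rpow h
    have h0 : 0 ≤ |θ|⁻¹ := by positivity
    calc _ ≤ 2 * |θ| ^ (-(3 / 4) : ℝ) := mul_le_mul h3 this h0 (by norm_num)
      _ ≤ _ := by
        have := h0.trans this
        nlinarith

/-- The kernel `e^{iθ/r} / |r|`, cut off near zero. -/
def cutKernel (ε θ r : ℝ) : ℂ :=
  if ε < |r| then Complex.exp (Complex.I * (θ / r : ℝ)) * (|r|⁻¹ : ℝ) else 0

theorem norm_exp_I_mul (x : ℝ) : ‖Complex.exp (Complex.I * (x : ℂ))‖ = 1 := by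
  rw [mul_comm, Complex.norm_exp_ofReal_mul_I]

theorem norm_cutKernel_le {ε : ℝ} (hε : 0 < ε) (θ r : ℝ) : ‖cutKernel ε θ r‖ ≤ ε⁻¹ := by
  unfold cutKernel
  split_ifs with h
  · rw [norm_mul, norm_exp_I_mul, one_mul, Complex.norm_real, norm_inv, Real.norm_eq_abs, abs_abs]
    exact inv_anti₀ hε h.le
  · simp [hε.le]

theorem measurable_cutKernel (ε : ℝ) : Measurable fun z : ℝ × ℝ => cutKernel ε z.1 z.2 := by
  unfold cutKernel
  refine Measurable.ite (measurableSet_lt (by fun_prop) (by fun_prop)) ?_ measurable_const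
  fun_prop

/-- The derivative of `r e^{iθ/r}` is `e^{iθ/r} - iθ e^{iθ/r}/r`. Thus `iθ` times the integral is a
difference of terms of size at most `b - a` and `a + b`. -/
theorem norm_integral_exp_inv_le_of_pos {θ : ℝ} (hθ : θ ≠ 0) {a b : ℝ} (ha : 0 < a) (hab : a ≤ b) :
    ‖∫ r in a..b, Complex.exp (Complex.I * (θ / r : ℝ)) * (r⁻¹ : ℝ)‖ ≤ 2 * b * |θ|⁻¹ := by
  have hpos : ∀ r ∈ uIcc a b, 0 < r := fun r hr => by
    rw [uIcc_of_le hab] at hr; exact ha.trans_le hr.1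
  have cexp : ContinuousOn (fun r : ℝ => Complex.exp (Complex.I * (θ / r : ℝ))) (uIcc a b) := by
    refine Complex.continuous_exp.comp_continuousOn (continuousOn_const.mul ?_)
    exact Complex.continuous_ofReal.comp_continuousOn
      (continuousOn_const.div continuousOn_id fun r hr => (hpos r hr).ne')
  have cinv : ContinuousOn (fun r : ℝ => ((r⁻¹ : ℝ) : ℂ)) (uIcc a b) :=
    Complex.continuous_ofReal.comp_continuousOn
      (continuousOn_id.inv₀ fun r hr => (hpos r hr).ne')
  have i1 := cexp.intervalIntegrable (μ := volume)
  have i2 := (cexp.fun_mul cinv).intervalIntegrable (μ := volume)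
  have hd : ∀ r ∈ uIcc a b, HasDerivAt (fun r : ℝ => (r : ℂ) * Complex.exp (Complex.I * (θ / r : ℝ)))
      (Complex.exp (Complex.I * (θ / r : ℝ)) -
        Complex.I * θ * (Complex.exp (Complex.I * (θ / r : ℝ)) * (r⁻¹ : ℝ))) r := by
    intro r hr
    have hr0 := (hpos r hr).ne'
    have h1 : HasDerivAt (fun r : ℝ => θ / r) (-θ / r ^ 2) r := by
      have := (hasDerivAt_const r θ).fun_div (hasDerivAt_id' r) hr0
      simpa using this
    have h2 := ((h1.ofReal_comp).const_mul Complex.I).cexp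
    have h3 := (hasDerivAt_id' r).ofReal_comp.fun_mul h2
    refine h3.congr_deriv ?_
    have : (r : ℂ) ≠ 0 := by exact_mod_cast hr0
    push_cast
    set E := Complex.exp (Complex.I * (θ / r))
    have h4 : (r : ℂ) * (E * (Complex.I * (-θ / r ^ 2))) = -(Complex.I * θ * (E * (r : ℂ)⁻¹)) := by
      field_simp
    rw [h4]
    ring
  have ftc := intervalIntegral.integral_eq_sub_of_hasDerivAt hd (i1.sub (i2.const_mul _))
  rw [intervalIntegral.integral_sub i1 (i2.const_mul _), intervalIntegral.integral_const_mul] at ftc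
  set X := ∫ r in a..b, Complex.exp (Complex.I * (θ / r : ℝ)) * (r⁻¹ : ℝ)
  set Y := ∫ r in a..b, Complex.exp (Complex.I * (θ / r : ℝ))
  have hY : ‖Y‖ ≤ b - a := by
    have := intervalIntegral.norm_integral_le_of_norm_le_const (a := a) (b := b) (C := 1)
      (f := fun r => Complex.exp (Complex.I * (θ / r : ℝ))) (fun r _ => by rw [norm_exp_I_mul])
    rwa [one_mul, abs_of_nonneg (by linarith)] at this
  have hX : Complex.I * θ * X = Y - ((b : ℂ) * Complex.exp (Complex.I * (θ / b : ℝ)) -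
      (a : ℂ) * Complex.exp (Complex.I * (θ / a : ℝ))) := by
    rw [← ftc]; ring
  have hn : |θ| * ‖X‖ ≤ 2 * b := by
    calc |θ| * ‖X‖ = ‖Complex.I * θ * X‖ := by simp
      _ ≤ (b - a) + (b + a) := by
        rw [hX]
        refine (norm_sub_le _ _).trans (add_le_add hY ((norm_sub_le _ _).trans ?_))
        rw [norm_mul, norm_mul, norm_exp_I_mul, norm_exp_I_mul, Complex.norm_real,
          Complex.norm_real, Real.norm_of_nonneg ha.le, Real.norm_of_nonneg (ha.le.trans hab)]
        simp
      _ = 2 * b := by ring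
  have hθ' : 0 < |θ| := abs_pos.2 hθ
  rw [← div_eq_mul_inv, le_div_iff₀ hθ']
  linarith

theorem norm_integral_exp_inv_le_log {θ : ℝ} {a b : ℝ} (ha : 0 < a) (hab : a ≤ b) :
    ‖∫ r in a..b, Complex.exp (Complex.I * (θ / r : ℝ)) * (r⁻¹ : ℝ)‖ ≤ Real.log (b / a) := by
  rw [← integral_inv_of_pos ha (ha.trans_le hab)]
  refine intervalIntegral.norm_integral_le_of_norm_le hab ?_ ?_
  · refine Filter.Eventually.of_forall fun r hr => ?_
    rw [norm_mul, norm_exp_I_mul, one_mul, Complex.norm_real,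
      Real.norm_of_nonneg (inv_nonneg.2 (ha.trans hr.1).le)]
  · refine ContinuousOn.intervalIntegrable (continuousOn_id.inv₀ fun r hr => ?_)
    rw [uIcc_of_le hab] at hr
    exact (ha.trans_le hr.1).ne'

/-- For `|θ| ≤ 1` the interval is cut at `r = |θ|`: below, oscillation gives a constant; above, only
a logarithm of `1/|θ|` remains, and this is why the weight needs a singularity at zero. For `|θ| ≥
1` oscillation alone gives `2R/|θ|`. -/
theorem norm_integral_exp_inv_le {R : ℝ} (hR : 0 < R) {θ : ℝ} (hθ : θ ≠ 0) {a b : ℝ} (ha : 0 < a)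
    (hab : a ≤ b) (hb : b ≤ R) :
    ‖∫ r in a..b, Complex.exp (Complex.I * (θ / r : ℝ)) * (r⁻¹ : ℝ)‖ ≤
      (2 + 4 * (R + 1)) * weightReal θ := by
  have hθ' : 0 < |θ| := abs_pos.2 hθ
  refine le_mul_weightReal hθ (fun h => ?_) fun h => ?_
  · have h1 := one_le_rpow_abs hθ h
    have low : ∀ a b, 0 < a → a ≤ b → b ≤ |θ| →
        ‖∫ r in a..b, Complex.exp (Complex.I * (θ / r : ℝ)) * (r⁻¹ : ℝ)‖ ≤ 2 := by
      intro a b ha hab hb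
      refine (norm_integral_exp_inv_le_of_pos hθ ha hab).trans ?_
      rw [← div_eq_mul_inv, div_le_iff₀ hθ']
      linarith
    have high : ∀ a b, |θ| ≤ a → a ≤ b → b ≤ R →
        ‖∫ r in a..b, Complex.exp (Complex.I * (θ / r : ℝ)) * (r⁻¹ : ℝ)‖ ≤
          4 * (R + 1) * |θ| ^ (-(1 / 4) : ℝ) := by
      intro a b ha hab hb
      refine (norm_integral_exp_inv_le_log (hθ'.trans_le ha) hab).trans ?_
      have h2 : b / a ≤ (R + 1) / |θ| := by gcongr; linarith
      have h3 : 0 < b / a := div_pos (hθ'.trans_le (ha.trans hab)) (hθ'.trans_le ha)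
      -- The logarithm is traded for the power `1/4`, whence the factor 4.
      calc Real.log (b / a) ≤ Real.log ((R + 1) / |θ|) := Real.log_le_log h3 h2
        _ ≤ ((R + 1) / |θ|) ^ (1 / 4 : ℝ) / (1 / 4) :=
          Real.log_le_rpow_div (by positivity) (by norm_num)
        _ = 4 * ((R + 1) ^ (1 / 4 : ℝ) * |θ| ^ (-(1 / 4) : ℝ)) := by
          rw [Real.div_rpow (by linarith) hθ'.le, Real.rpow_neg hθ'.le]
          field_simp
        _ ≤ 4 * ((R + 1) * |θ| ^ (-(1 / 4) : ℝ)) := by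
          gcongr
          exact Real.rpow_le_self_of_one_le (by linarith) (by norm_num)
        _ = _ := by ring
    rcases le_total b |θ| with hbθ | hbθ
    · have := low a b ha hab hbθ
      nlinarith
    · rcases le_total |θ| a with haθ | haθ
      · have := high a b haθ hab hb
        linarith
      · have hi : ∀ x y, 0 < x → x ≤ y → IntervalIntegrable
            (fun r : ℝ => Complex.exp (Complex.I * (θ / r : ℝ)) * (r⁻¹ : ℝ)) volume x y := by
          intro x y hx hxy
          have hpos : ∀ r ∈ uIcc x y, r ≠ 0 := fun r hr => by
            rw [uIcc_of_le hxy] at hr; exact (hx.trans_le hr.1).ne'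
          refine ContinuousOn.intervalIntegrable (ContinuousOn.mul ?_ ?_)
          · exact Complex.continuous_exp.comp_continuousOn (continuousOn_const.mul
              (Complex.continuous_ofReal.comp_continuousOn
                (continuousOn_const.div continuousOn_id hpos)))
          · exact Complex.continuous_ofReal.comp_continuousOn (continuousOn_id.inv₀ hpos)
        rw [← intervalIntegral.integral_add_adjacent_intervals (hi a |θ| ha haθ)
          (hi |θ| b hθ' hbθ)]
        refine (norm_add_le _ _).trans ?_
        have i1 := low a |θ| ha haθ le_rfl
        have i2 := high |θ| b le_rfl hbθ hb
        nlinarith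
  · refine (norm_integral_exp_inv_le_of_pos hθ ha hab).trans ?_
    have h1 := inv_abs_le_rpow h
    have h0 : 0 ≤ |θ|⁻¹ := by positivity
    calc 2 * b * |θ|⁻¹ ≤ 2 * R * |θ| ^ (-(3 / 4) : ℝ) := by gcongr
      _ ≤ _ := by
        have := h0.trans h1
        nlinarith

/-- The bound is uniform in `ε`, since on each half-line the cutoff only shortens the interval of
integration. Negative `r` is reduced to positive `r` by changing the sign of `θ`. -/
theorem norm_integral_cutKernel_le {R : ℝ} (hR : 0 < R) {ε : ℝ} (hε : 0 < ε) {θ : ℝ} (hθ : θ ≠ 0)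
    {α β : ℝ} (hα : -R ≤ α) (hαβ : α ≤ β) (hβ : β ≤ R) :
    ‖∫ r in α..β, cutKernel ε θ r‖ ≤ 2 * (2 + 4 * (R + 1)) * weightReal θ := by
  have w0 : 0 ≤ weightReal θ := le_min (by positivity) (by positivity)
  have hint : ∀ x y, IntervalIntegrable (cutKernel ε θ) volume x y := fun x y => by
    rw [intervalIntegrable_iff]
    have : IsFiniteMeasure (volume.restrict (uIoc x y)) := ⟨by simp [uIoc]⟩
    exact Integrable.of_bound ((measurable_cutKernel ε).comp
      (measurable_const.prodMk measurable_id)).aestronglyMeasurable ε⁻¹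
      (Filter.Eventually.of_forall fun r => norm_cutKernel_le hε θ r)
  have pos : ∀ θ : ℝ, θ ≠ 0 → ∀ x y, 0 ≤ x → x ≤ y → y ≤ R → ‖∫ r in x..y, cutKernel ε θ r‖ ≤
      (2 + 4 * (R + 1)) * weightReal θ := by
    intro θ hθ x y hx hxy hy
    have w0 : 0 ≤ weightReal θ := le_min (by positivity) (by positivity)
    rw [intervalIntegral.integral_of_le hxy]
    have e : ∀ r ∈ Ioc x y, cutKernel ε θ r = (Ioi ε).indicator
        (fun r => Complex.exp (Complex.I * (θ / r : ℝ)) * (r⁻¹ : ℝ)) r := fun r hr => by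
      have hr0 : 0 < r := hx.trans_lt hr.1
      simp only [cutKernel, indicator_apply, mem_Ioi, abs_of_pos hr0]
    rw [setIntegral_congr_fun measurableSet_Ioc e, setIntegral_indicator measurableSet_Ioi,
      Ioc_inter_Ioi]
    rcases le_total (x ⊔ ε) y with h | h
    · rw [← intervalIntegral.integral_of_le h]
      exact norm_integral_exp_inv_le hR hθ (hε.trans_le le_sup_right) h hy
    · rw [Ioc_eq_empty (not_lt.2 h)]
      simp only [setIntegral_empty, norm_zero]
      positivity
  have neg : ∀ x y, -R ≤ x → x ≤ y → y ≤ 0 → ‖∫ r in x..y, cutKernel ε θ r‖ ≤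
      (2 + 4 * (R + 1)) * weightReal θ := by
    intro x y hx hxy hy
    have := pos (-θ) (neg_ne_zero.2 hθ) (-y) (-x) (by linarith) (by linarith) (by linarith)
    rw [weightReal_neg] at this
    have e : ∀ r, cutKernel ε (-θ) r = cutKernel ε θ (-r) := fun r => by
      simp [cutKernel, div_neg, neg_div]
    simp only [e] at this
    rwa [intervalIntegral.integral_comp_neg, neg_neg, neg_neg] at this
  have hC : 0 ≤ (2 + 4 * (R + 1)) * weightReal θ := by positivity
  rcases le_total 0 α with h | h
  · exact (pos θ hθ α β h hαβ hβ).trans (by linarith)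
  · rcases le_total β 0 with h' | h'
    · exact (neg α β hα hαβ h').trans (by linarith)
    · rw [← intervalIntegral.integral_add_adjacent_intervals (hint α 0) (hint 0 β)]
      refine (norm_add_le _ _).trans ?_
      have := neg α 0 hα h le_rfl
      have := pos θ hθ 0 β le_rfl h' hβ
      linarith

/-! ### Schwartz functions -/

/-- The chirp `e^{i c x²}`. -/
def chirp (c x : ℝ) : ℂ := Complex.exp (Complex.I * (c * x ^ 2 : ℝ))

theorem hasTemperateGrowth_exp_I : Function.HasTemperateGrowth
    (fun x : ℝ => Complex.exp (Complex.I * (x : ℂ))) := by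
  have hd : ∀ x : ℝ, HasDerivAt (fun x : ℝ => Complex.exp (Complex.I * (x : ℂ)))
      (Complex.I * Complex.exp (Complex.I * (x : ℂ))) x := fun x => by
    have := ((hasDerivAt_id' x).ofReal_comp.const_mul Complex.I).cexp
    refine this.congr_deriv ?_
    simp [mul_comm]
  have hit : ∀ n : ℕ, iteratedDeriv n (fun x : ℝ => Complex.exp (Complex.I * (x : ℂ))) =
      fun x : ℝ => Complex.I ^ n * Complex.exp (Complex.I * (x : ℂ)) := fun n => by
    induction n with
    | zero => simp
    | succ n ih =>
      rw [iteratedDeriv_succ, ih]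
      ext x
      rw [((hd x).const_mul _).deriv]
      ring
  refine ⟨?_, fun n => ⟨0, 1, fun x => ?_⟩⟩
  · exact (contDiff_const.mul Complex.ofRealCLM.contDiff).cexp
  · rw [norm_iteratedFDeriv_eq_norm_iteratedDeriv, hit]
    simp

theorem hasTemperateGrowth_chirp (c : ℝ) : Function.HasTemperateGrowth (chirp c) := by
  have h : Function.HasTemperateGrowth (fun x : ℝ => c * x ^ 2) :=
    (Function.HasTemperateGrowth.const c).mul (Function.HasTemperateGrowth.id'.pow 2)
  exact hasTemperateGrowth_exp_I.comp h

theorem norm_chirp (c x : ℝ) : ‖chirp c x‖ = 1 := norm_exp_I_mul _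

@[fun_prop]
theorem continuous_chirp (c : ℝ) : Continuous (chirp c) := by unfold chirp; fun_prop

theorem freeSymbol_eq_chirp (r : ℝ) : freeSymbol r = chirp (-(4 * Real.pi ^ 2 * r)) := by
  ext x
  unfold freeSymbol chirp
  congr 1
  push_cast
  ring

/-- Multiplication of a Schwartz function by a chirp. -/
def chirpMul (c : ℝ) (φ : 𝓢(ℝ, ℂ)) : 𝓢(ℝ, ℂ) := SchwartzMap.smulLeftCLM ℂ (chirp c) φ

theorem chirpMul_apply (c : ℝ) (φ : 𝓢(ℝ, ℂ)) (x : ℝ) : chirpMul c φ x = chirp c x * φ x := by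
  rw [chirpMul, SchwartzMap.smulLeftCLM_apply_apply (hasTemperateGrowth_chirp c), smul_eq_mul]

/-- The free evolution of a Schwartz function. -/
def evolve (r : ℝ) (φ : 𝓢(ℝ, ℂ)) : 𝓢(ℝ, ℂ) := 𝓕⁻ (chirpMul (-(4 * Real.pi ^ 2 * r)) (𝓕 φ))

theorem freeEvolution_toLp (r : ℝ) (φ : 𝓢(ℝ, ℂ)) :
    freeEvolution r (φ.toLp 2) = (evolve r φ).toLp 2 := by
  rw [freeEvolution, evolve, ← SchwartzMap.toLp_fourierInv_eq, SchwartzMap.toLp_fourier_eq]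
  congr 1
  refine Lp.ext ?_
  filter_upwards [Lp.coeFn_lpSMul (r := 2) ((memLp_freeSymbol r).toLp (freeSymbol r))
    ((𝓕 φ : 𝓢(ℝ, ℂ)).toLp 2), (memLp_freeSymbol r).coeFn_toLp,
    (𝓕 φ : 𝓢(ℝ, ℂ)).coeFn_toLp 2 volume,
    (chirpMul (-(4 * Real.pi ^ 2 * r)) (𝓕 φ)).coeFn_toLp 2 volume] with x h1 h2 h3 h4
  rw [h1, h4, Pi.smul_apply', h2, h3, chirpMul_apply, freeSymbol_eq_chirp, smul_eq_mul]

/-! ### The quartic integral in frequency variables -/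

/-- The integrand `conj g₁(k) g₂(k+p) conj g₃(k+p+q) g₄(k+q)`. -/
def quadIntegrand (g₁ g₂ g₃ g₄ : ℝ → ℂ) (z : (ℝ × ℝ) × ℝ) : ℂ :=
  conj (g₁ z.1.1) * g₂ (z.1.1 + z.1.2) * conj (g₃ (z.1.1 + z.1.2 + z.2)) * g₄ (z.1.1 + z.2)

/-- The shear `(k, p, q) ↦ (k, k + p, k + q)`. -/
def shear (z : (ℝ × ℝ) × ℝ) : (ℝ × ℝ) × ℝ := ((z.1.1, z.1.1 + z.1.2), z.1.1 + z.2)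

theorem measurePreserving_shear : MeasurePreserving shear volume volume := by
  have h1 : MeasurePreserving (fun z : ℝ × ℝ => (z.1, z.1 + z.2)) volume volume :=
    measurePreserving_prod_add volume volume
  have h2 : MeasurePreserving (fun z : (ℝ × ℝ) × ℝ => ((z.1.1, z.1.1 + z.1.2), z.1.1 + z.2))
      (volume.prod volume) (volume.prod volume) :=
    h1.skew_product (g := fun z q => z.1 + q) (by fun_prop)
      (Filter.Eventually.of_forall fun z => map_add_left_eq_self volume z.1)
  exact h2

theorem measurableEmbedding_shear : MeasurableEmbedding shear := by
  let e : ((ℝ × ℝ) × ℝ) ≃ᵐ ((ℝ × ℝ) × ℝ) :=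
    { toFun := shear
      invFun := fun z => ((z.1.1, z.1.2 - z.1.1), z.2 - z.1.1)
      left_inv := fun z => by simp [shear]
      right_inv := fun z => by simp [shear]
      measurable_toFun := by
        change Measurable shear
        unfold shear; fun_prop
      measurable_invFun := by
        change Measurable fun z : (ℝ × ℝ) × ℝ => ((z.1.1, z.1.2 - z.1.1), z.2 - z.1.1)
        fun_prop }
  exact e.measurableEmbedding

/-- Only three of the four factors are expanded as Fourier integrals. The fourth stays in `x`, which
keeps everything absolutely integrable; its `x`-integral against the combined phase is Fourier
inversion at `k₂ + k₄ - k₁`. The shear then yields the variables `k, p, q`. -/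
theorem integral_quad_eq (g₁ g₂ g₃ g₄ : 𝓢(ℝ, ℂ)) :
    ∫ x, conj ((𝓕⁻ g₁ : 𝓢(ℝ, ℂ)) x) * (𝓕⁻ g₂ : 𝓢(ℝ, ℂ)) x * conj ((𝓕⁻ g₃ : 𝓢(ℝ, ℂ)) x) *
      (𝓕⁻ g₄ : 𝓢(ℝ, ℂ)) x = ∫ z, quadIntegrand g₁ g₂ g₃ g₄ z := by
  set u₃ : 𝓢(ℝ, ℂ) := 𝓕⁻ g₃ with hu₃
  set E : ℝ → ℂ := fun t => Complex.exp (Complex.I * (2 * Real.pi * t : ℝ)) with hE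
  have nE : ∀ t, ‖E t‖ = 1 := fun t => norm_exp_I_mul _
  have cE : Continuous E := by fun_prop
  have Eadd : ∀ s t, E (s + t) = E s * E t := fun s t => by
    simp only [hE]; rw [← Complex.exp_add]; congr 1; push_cast; ring
  have Econj : ∀ t, conj (E t) = E (-t) := fun t => by
    simp only [hE]
    rw [← Complex.exp_conj, map_mul, Complex.conj_I, Complex.conj_ofReal]
    congr 1; push_cast; ring
  have inv_eq : ∀ (g : 𝓢(ℝ, ℂ)) (x : ℝ), (𝓕⁻ g : 𝓢(ℝ, ℂ)) x = ∫ k, E (k * x) * g k := fun g x => by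
    rw [SchwartzMap.fourierInv_coe, Real.fourierInv_eq']
    refine integral_congr_ae (Filter.Eventually.of_forall fun k => ?_)
    simp only [hE, smul_eq_mul, RCLike.inner_apply, conj_trivial]
    congr 2
    push_cast; ring
  have four : ∀ t : ℝ, ∫ x, E (-(x * t)) * u₃ x = g₃ t := fun t => by
    have h1 : (𝓕 u₃ : 𝓢(ℝ, ℂ)) t = g₃ t := by rw [hu₃, FourierTransform.fourier_fourierInv_eq]
    rw [← h1, SchwartzMap.fourier_coe, Real.fourier_eq']
    refine integral_congr_ae (Filter.Eventually.of_forall fun k => ?_)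
    simp only [hE, smul_eq_mul, RCLike.inner_apply, conj_trivial]
    congr 2
    push_cast; ring
  set H : (ℝ × ℝ) × ℝ → ℂ := fun z => conj (g₁ z.1.1) * g₂ z.1.2 * g₄ z.2 with hH
  have iH : Integrable H (volume : Measure ((ℝ × ℝ) × ℝ)) := by
    have i1 : Integrable (fun k => conj (g₁ k)) (volume : Measure ℝ) :=
      (Complex.conjLIE.integrable_comp_iff).2 g₁.integrable
    exact (i1.mul_prod (g₂.integrable (μ := volume))).mul_prod (g₄.integrable (μ := volume))
  have step1 : ∀ x : ℝ, conj ((𝓕⁻ g₁ : 𝓢(ℝ, ℂ)) x) * (𝓕⁻ g₂ : 𝓢(ℝ, ℂ)) x * conj (u₃ x) *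
      (𝓕⁻ g₄ : 𝓢(ℝ, ℂ)) x =
      ∫ z : (ℝ × ℝ) × ℝ, conj (u₃ x) * (E ((z.1.2 + z.2 - z.1.1) * x) * H z) := by
    intro x
    have e1 : conj ((𝓕⁻ g₁ : 𝓢(ℝ, ℂ)) x) = ∫ k, E (-(k * x)) * conj (g₁ k) := by
      rw [inv_eq, ← integral_conj]
      simp only [map_mul, Econj]
    rw [e1, inv_eq g₂, inv_eq g₄, mul_right_comm _ (conj (u₃ x)), mul_comm _ (conj (u₃ x)),
      ← integral_prod_mul, ← integral_prod_mul, ← integral_const_mul]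
    refine integral_congr_ae (Filter.Eventually.of_forall fun z => ?_)
    have : E ((z.1.2 + z.2 - z.1.1) * x) = E (-(z.1.1 * x)) * E (z.1.2 * x) * E (z.2 * x) := by
      rw [← Eadd, ← Eadd]; congr 1; ring
    simp only [hH, this]
    ring
  have iprod : Integrable (Function.uncurry fun (x : ℝ) (z : (ℝ × ℝ) × ℝ) =>
      conj (u₃ x) * (E ((z.1.2 + z.2 - z.1.1) * x) * H z)) (volume.prod volume) := by
    have i3 : Integrable (fun k => conj (u₃ k)) (volume : Measure ℝ) :=
      (Complex.conjLIE.integrable_comp_iff).2 u₃.integrable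
    have i4 := i3.mul_prod iH
    refine (i4.bdd_mul (f := fun w : ℝ × ((ℝ × ℝ) × ℝ) => E ((w.2.1.2 + w.2.2 - w.2.1.1) * w.1)) (c := 1)
      (by fun_prop : Continuous _).aestronglyMeasurable
      (Filter.Eventually.of_forall fun w => (nE _).le)).congr
      (Filter.Eventually.of_forall fun w => ?_)
    simp only [Function.uncurry]
    ring
  have step2 : ∀ z : (ℝ × ℝ) × ℝ, ∫ x, conj (u₃ x) * (E ((z.1.2 + z.2 - z.1.1) * x) * H z) =
      conj (g₃ (z.1.2 + z.2 - z.1.1)) * H z := by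
    intro z
    rw [← four, ← integral_conj, ← integral_mul_const]
    refine integral_congr_ae (Filter.Eventually.of_forall fun x => ?_)
    simp only [map_mul, Econj, neg_neg]
    rw [mul_comm x]
    ring
  simp only [step1]
  rw [integral_integral_swap iprod]
  simp only [step2]
  rw [← measurePreserving_shear.integral_comp measurableEmbedding_shear]
  refine integral_congr_ae (Filter.Eventually.of_forall fun z => ?_)
  have : z.1.1 + z.1.2 + (z.1.1 + z.2) - z.1.1 = z.1.1 + z.1.2 + z.2 := by ring
  simp only [shear, hH, quadIntegrand, this]
  ring

theorem integrable_quadIntegrand (g₁ g₂ g₃ g₄ : 𝓢(ℝ, ℂ)) :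
    Integrable (quadIntegrand g₁ g₂ g₃ g₄) := by
  have iH : Integrable (fun z : (ℝ × ℝ) × ℝ => conj (g₁ z.1.1) * g₂ z.1.2 * g₄ z.2) := by
    have i1 : Integrable (fun k => conj (g₁ k)) (volume : Measure ℝ) :=
      (Complex.conjLIE.integrable_comp_iff).2 g₁.integrable
    exact (i1.mul_prod (g₂.integrable (μ := volume))).mul_prod (g₄.integrable (μ := volume))
  have h1 := (measurePreserving_shear.integrable_comp_emb measurableEmbedding_shear).2 iH
  obtain ⟨M, hM⟩ : ∃ M, ∀ x, ‖g₃ x‖ ≤ M := ⟨_, fun x => g₃.norm_le_seminorm ℝ x⟩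
  refine (h1.bdd_mul (f := fun z : (ℝ × ℝ) × ℝ => conj (g₃ (z.1.1 + z.1.2 + z.2))) (c := M) ?_
    (Filter.Eventually.of_forall fun z => ?_)).congr (Filter.Eventually.of_forall fun z => ?_)
  · exact (Complex.continuous_conj.comp (g₃.continuous.comp (by fun_prop))).aestronglyMeasurable
  · simpa using hM _
  · simp only [shear, quadIntegrand, Function.comp]
    ring

/-- The identity behind it is `-k² + (k+p)² - (k+p+q)² + (k+q)² = -2pq`. -/
theorem quadIntegrand_chirp (c : ℝ) (g₁ g₂ g₃ g₄ : ℝ → ℂ) (z : (ℝ × ℝ) × ℝ) :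
    quadIntegrand (fun x => chirp c x * g₁ x) (fun x => chirp c x * g₂ x)
      (fun x => chirp c x * g₃ x) (fun x => chirp c x * g₄ x) z =
      quadIntegrand g₁ g₂ g₃ g₄ z *
        Complex.exp (Complex.I * (-(2 * c) * (z.1.2 * z.2) : ℝ)) := by
  have hconj : ∀ x, conj (chirp c x) = Complex.exp (-(Complex.I * (c * x ^ 2 : ℝ))) := fun x => by
    rw [chirp, ← Complex.exp_conj]; congr 1; simp
  simp only [quadIntegrand, map_mul, hconj]
  simp only [chirp]
  have : Complex.exp (Complex.I * (-(2 * c) * (z.1.2 * z.2) : ℝ)) =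
      Complex.exp (-(Complex.I * (c * z.1.1 ^ 2 : ℝ))) *
      Complex.exp (Complex.I * (c * (z.1.1 + z.1.2) ^ 2 : ℝ)) *
      Complex.exp (-(Complex.I * (c * (z.1.1 + z.1.2 + z.2) ^ 2 : ℝ))) *
      Complex.exp (Complex.I * (c * (z.1.1 + z.2) ^ 2 : ℝ)) := by
    rw [← Complex.exp_add, ← Complex.exp_add, ← Complex.exp_add]
    congr 1
    push_cast
    ring
  rw [this]
  ring

theorem integral_evolve_eq_fourier (r : ℝ) (φ₁ φ₂ φ₃ φ₄ : 𝓢(ℝ, ℂ)) :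
    ∫ x, conj (evolve r φ₁ x) * evolve r φ₂ x * conj (evolve r φ₃ x) * evolve r φ₄ x =
      ∫ z, quadIntegrand (𝓕 φ₁ : 𝓢(ℝ, ℂ)) (𝓕 φ₂ : 𝓢(ℝ, ℂ)) (𝓕 φ₃ : 𝓢(ℝ, ℂ)) (𝓕 φ₄ : 𝓢(ℝ, ℂ)) z *
        Complex.exp (Complex.I * (8 * Real.pi ^ 2 * (z.1.2 * z.2) * r : ℝ)) := by
  unfold evolve
  rw [integral_quad_eq]
  refine integral_congr_ae (Filter.Eventually.of_forall fun z => ?_)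
  have := quadIntegrand_chirp (-(4 * Real.pi ^ 2 * r)) (𝓕 φ₁ : 𝓢(ℝ, ℂ)) (𝓕 φ₂ : 𝓢(ℝ, ℂ))
    (𝓕 φ₃ : 𝓢(ℝ, ℂ)) (𝓕 φ₄ : 𝓢(ℝ, ℂ)) z
  simp only [← chirpMul_apply] at this
  refine this.trans ?_
  congr 3
  ring_nf

/-! ### The free evolution in space -/

open Filter Topology

/-- The multiplication formula `∫ (𝓕 φ) ψ = ∫ φ (𝓕 ψ)` with a Gaussian `ψ`. -/
theorem integral_fourier_mul_gaussian (φ : 𝓢(ℝ, ℂ)) {b : ℂ} (hb : 0 < b.re) (x : ℝ) :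
    ∫ ξ : ℝ, (𝓕 φ : 𝓢(ℝ, ℂ)) ξ *
        Complex.exp (-Real.pi * b * ξ ^ 2 + 2 * Real.pi * (Complex.I * x) * ξ) =
      1 / b ^ (1 / 2 : ℂ) * ∫ y : ℝ, φ y * Complex.exp (-Real.pi / b * (y - x : ℝ) ^ 2) := by
  have hi : Integrable fun ξ : ℝ =>
      Complex.exp (-Real.pi * b * ξ ^ 2 + 2 * Real.pi * (Complex.I * x) * ξ) := by
    have := integrable_cexp_quadratic' (b := -Real.pi * b) (by simp; positivity)
      (2 * Real.pi * (Complex.I * x)) 0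
    simpa using this
  have h := VectorFourier.integral_fourierIntegral_smul_eq_flip (L := innerₗ ℝ)
    Real.continuous_fourierChar continuous_inner (φ.integrable (μ := volume)) hi
  have h' : ∫ ξ : ℝ, (𝓕 φ : 𝓢(ℝ, ℂ)) ξ *
        Complex.exp (-Real.pi * b * ξ ^ 2 + 2 * Real.pi * (Complex.I * x) * ξ) =
      ∫ y : ℝ, φ y * (𝓕 (fun ξ : ℝ =>
        Complex.exp (-Real.pi * b * ξ ^ 2 + 2 * Real.pi * (Complex.I * x) * ξ))) y := by
    simpa [SchwartzMap.fourier_coe] using! h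
  rw [h', fourier_gaussian_pi' hb, ← integral_const_mul]
  refine integral_congr_ae (Eventually.of_forall fun y => ?_)
  have : (y : ℂ) + Complex.I * (Complex.I * x) = (y - x : ℝ) := by
    rw [← mul_assoc, Complex.I_mul_I]; push_cast; ring
  simp only [this]
  ring

theorem evolve_eq_integral (r : ℝ) (φ : 𝓢(ℝ, ℂ)) (x : ℝ) :
    evolve r φ x = ∫ ξ : ℝ, (𝓕 φ : 𝓢(ℝ, ℂ)) ξ *
      Complex.exp (-Real.pi * (4 * Real.pi * r * Complex.I) * ξ ^ 2 +
        2 * Real.pi * (Complex.I * x) * ξ) := by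
  rw [evolve, SchwartzMap.fourierInv_coe, Real.fourierInv_eq']
  refine integral_congr_ae (Eventually.of_forall fun ξ => ?_)
  simp only [chirpMul_apply, chirp, smul_eq_mul, RCLike.inner_apply, conj_trivial]
  rw [← mul_assoc, ← Complex.exp_add, mul_comm]
  congr 2
  push_cast
  ring

/-- The Gaussian formula is taken at `b = ε + 4πir` and `ε` tends to zero from above; for `ε > 0`
both exponentials have modulus at most one, so dominated convergence applies to each side. -/
theorem evolve_eq_integral_kernel {r : ℝ} (hr : r ≠ 0) (φ : 𝓢(ℝ, ℂ)) (x : ℝ) :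
    evolve r φ x = 1 / (4 * Real.pi * r * Complex.I) ^ (1 / 2 : ℂ) *
      ∫ y : ℝ, φ y * chirp (1 / (4 * r)) (y - x) := by
  set b₀ : ℂ := 4 * Real.pi * r * Complex.I with hb₀
  have hre : ∀ ε : ℝ, ((ε : ℂ) + b₀).re = ε := fun ε => by simp [hb₀]
  have him : ∀ ε : ℝ, ((ε : ℂ) + b₀).im = 4 * Real.pi * r := fun ε => by simp [hb₀]
  have hpi : (Real.pi : ℂ) ≠ 0 := by exact_mod_cast Real.pi_ne_zero
  have hrc : (r : ℂ) ≠ 0 := by exact_mod_cast hr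
  have hb0 : b₀ ≠ 0 := by simp [hb₀, hr]
  have tb : Tendsto (fun ε : ℝ => (ε : ℂ) + b₀) (𝓝[>] 0) (𝓝 b₀) := by
    have : Continuous fun ε : ℝ => (ε : ℂ) + b₀ := by fun_prop
    have h := (this.tendsto 0).mono_left (nhdsWithin_le_nhds (s := Ioi 0))
    simpa using h
  have hpos : ∀ᶠ ε : ℝ in 𝓝[>] 0, 0 < ε := self_mem_nhdsWithin
  have lim1 : Tendsto (fun ε : ℝ => ∫ ξ : ℝ, (𝓕 φ : 𝓢(ℝ, ℂ)) ξ *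
      Complex.exp (-Real.pi * (ε + b₀) * ξ ^ 2 + 2 * Real.pi * (Complex.I * x) * ξ)) (𝓝[>] 0)
      (𝓝 (evolve r φ x)) := by
    rw [evolve_eq_integral]
    refine tendsto_integral_filter_of_dominated_convergence (fun ξ => ‖(𝓕 φ : 𝓢(ℝ, ℂ)) ξ‖)
      (Eventually.of_forall fun ε => ?_) ?_ (𝓕 φ : 𝓢(ℝ, ℂ)).integrable.norm
      (Eventually.of_forall fun ξ => ?_)
    · exact ((𝓕 φ : 𝓢(ℝ, ℂ)).continuous.mul (by fun_prop)).aestronglyMeasurable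
    · filter_upwards [hpos] with ε hε
      refine Eventually.of_forall fun ξ => ?_
      rw [norm_mul, Complex.norm_exp]
      refine mul_le_of_le_one_right (norm_nonneg _) (Real.exp_le_one_iff.2 ?_)
      have : (-Real.pi * ((ε : ℂ) + b₀) * ξ ^ 2 + 2 * Real.pi * (Complex.I * x) * ξ).re =
          -(Real.pi * ε * ξ ^ 2) := by
        simp [hb₀, pow_two]
      rw [this]
      have := Real.pi_pos
      exact neg_nonpos.2 (by positivity)
    · refine Tendsto.const_mul _ ((Complex.continuous_exp.tendsto _).comp ?_)
      exact ((tb.const_mul _).mul_const _).add_const _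
  have lim2 : Tendsto (fun ε : ℝ => 1 / ((ε : ℂ) + b₀) ^ (1 / 2 : ℂ) *
      ∫ y : ℝ, φ y * Complex.exp (-Real.pi / (ε + b₀) * (y - x : ℝ) ^ 2)) (𝓝[>] 0)
      (𝓝 (1 / b₀ ^ (1 / 2 : ℂ) * ∫ y : ℝ, φ y * chirp (1 / (4 * r)) (y - x))) := by
    refine Tendsto.mul ?_ ?_
    · refine Tendsto.div tendsto_const_nhds ?_ ?_
      -- The limit point is purely imaginary and nonzero, so the principal square root is continuous
      -- there.
      · have hs : b₀ ∈ Complex.slitPlane := Or.inr (by simp [hb₀, hr, Real.pi_ne_zero])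
        exact ((continuousAt_cpow_const hs).tendsto).comp tb
      · rw [Ne, Complex.cpow_eq_zero_iff]; simp [hb0]
    · refine tendsto_integral_filter_of_dominated_convergence (fun y => ‖φ y‖)
        (Eventually.of_forall fun ε => ?_) ?_ φ.integrable.norm
        (Eventually.of_forall fun y => ?_)
      · exact (φ.continuous.mul (by fun_prop)).aestronglyMeasurable
      · filter_upwards [hpos] with ε hε
        refine Eventually.of_forall fun y => ?_
        rw [norm_mul, Complex.norm_exp]
        refine mul_le_of_le_one_right (norm_nonneg _) (Real.exp_le_one_iff.2 ?_)
        have e1 : -(Real.pi : ℂ) / (ε + b₀) * ((y - x : ℝ) : ℂ) ^ 2 =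
            ((-Real.pi * (y - x) ^ 2 : ℝ) : ℂ) * ((ε : ℂ) + b₀)⁻¹ := by
          push_cast; ring
        rw [e1, Complex.re_ofReal_mul, Complex.inv_re, hre]
        have := Real.pi_pos
        have h1 : 0 ≤ ε / Complex.normSq (ε + b₀) := div_nonneg hε.le (Complex.normSq_nonneg _)
        have h2 : 0 ≤ Real.pi * (y - x) ^ 2 := by positivity
        nlinarith [mul_nonneg h2 h1]
      · refine Tendsto.const_mul _ ?_
        have : chirp (1 / (4 * r)) (y - x) =
            Complex.exp (-Real.pi / b₀ * (y - x : ℝ) ^ 2) := by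
          unfold chirp
          congr 1
          have h3 : -(Real.pi : ℂ) / b₀ = Complex.I / (4 * r) := by
            rw [div_eq_div_iff hb0 (by simp [hr]), hb₀]
            linear_combination (4 * Real.pi * r : ℂ) * (-Complex.I_mul_I)
          rw [h3]
          push_cast
          ring
        rw [this]
        refine (Complex.continuous_exp.tendsto _).comp (Tendsto.mul_const _ ?_)
        exact tendsto_const_nhds.div tb hb0
  refine tendsto_nhds_unique lim1 (lim2.congr' ?_)
  filter_upwards [hpos] with ε hε
  rw [integral_fourier_mul_gaussian φ (by rw [hre]; exact hε)]

/-- Expanding `(y - x)²` separates a chirp in `x`, a chirp in `y` and a Fourier kernel at frequency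
`x/(4πr)`. -/
theorem evolve_eq_fourier {r : ℝ} (hr : r ≠ 0) (φ : 𝓢(ℝ, ℂ)) (x : ℝ) :
    evolve r φ x = 1 / (4 * Real.pi * r * Complex.I) ^ (1 / 2 : ℂ) *
      (chirp (1 / (4 * r)) x * (𝓕 (chirpMul (1 / (4 * r)) φ) : 𝓢(ℝ, ℂ)) (x / (4 * Real.pi * r))) := by
  rw [evolve_eq_integral_kernel hr, SchwartzMap.fourier_coe, Real.fourier_eq']
  congr 1
  rw [← integral_const_mul]
  refine integral_congr_ae (Eventually.of_forall fun y => ?_)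
  simp only [chirpMul_apply, smul_eq_mul, RCLike.inner_apply, conj_trivial]
  have hpi : Real.pi ≠ 0 := Real.pi_ne_zero
  have : chirp (1 / (4 * r)) (y - x) = chirp (1 / (4 * r)) x *
      (Complex.exp ((-2 * Real.pi * (x / (4 * Real.pi * r) * y) : ℝ) * Complex.I) *
        chirp (1 / (4 * r)) y) := by
    unfold chirp
    rw [← Complex.exp_add, ← Complex.exp_add]
    congr 1
    have : 1 / (4 * r) * (y - x) ^ 2 = 1 / (4 * r) * x ^ 2 +
        (-2 * Real.pi * (x / (4 * Real.pi * r) * y) + 1 / (4 * r) * y ^ 2) := by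
      field_simp; ring
    rw [this]
    push_cast
    ring
  rw [this]
  ring

/-- The outer chirps cancel in the quartic product and the inner ones leave a phase in `pq/r`. The
prefactors contribute `(4π|r|)⁻²` and the dilation `4π|r|`. The result mirrors the frequency
formula, with `1/r` in place of `r`. -/
theorem integral_evolve_eq_space {r : ℝ} (hr : r ≠ 0) (φ₁ φ₂ φ₃ φ₄ : 𝓢(ℝ, ℂ)) :
    ∫ x, conj (evolve r φ₁ x) * evolve r φ₂ x * conj (evolve r φ₃ x) * evolve r φ₄ x =
      ((4 * Real.pi)⁻¹ : ℝ) * ∫ z, quadIntegrand φ₁ φ₂ φ₃ φ₄ z *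
        (Complex.exp (Complex.I * (-(1 / 2) * (z.1.2 * z.2) / r : ℝ)) * ((|r|)⁻¹ : ℝ)) := by
  set κ : ℂ := 1 / (4 * Real.pi * r * Complex.I) ^ (1 / 2 : ℂ) with hκ
  set c : ℝ := 1 / (4 * r) with hc
  have nκ : ((‖κ‖ ^ 4 : ℝ) : ℂ) = (((4 * Real.pi * |r|) ^ 2)⁻¹ : ℝ) := by
    congr 1
    have h0 : ‖(4 * Real.pi * r * Complex.I : ℂ)‖ = 4 * Real.pi * |r| := by
      simp [abs_of_pos Real.pi_pos]
    have h1 : ‖(4 * Real.pi * r * Complex.I : ℂ) ^ (1 / 2 : ℂ)‖ = √(4 * Real.pi * |r|) := by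
      have := Complex.norm_cpow_real (4 * Real.pi * r * Complex.I) (1 / 2)
      rw [h0, ← Real.sqrt_eq_rpow] at this
      rw [← this]; norm_num
    rw [hκ, norm_div, h1, norm_one, div_pow, one_pow, one_div]
    congr 1
    have h2 : 0 ≤ 4 * Real.pi * |r| := by have := Real.pi_pos; positivity
    rw [show (4 : ℕ) = 2 * 2 from rfl, pow_mul, Real.sq_sqrt h2]
  have hcc : ∀ x, conj (chirp c x) * chirp c x = 1 := fun x => by
    rw [Complex.conj_mul', norm_chirp]; simp
  set F : ℝ → ℂ := fun t => conj ((𝓕 (chirpMul c φ₁) : 𝓢(ℝ, ℂ)) t) *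
    (𝓕 (chirpMul c φ₂) : 𝓢(ℝ, ℂ)) t * conj ((𝓕 (chirpMul c φ₃) : 𝓢(ℝ, ℂ)) t) *
    (𝓕 (chirpMul c φ₄) : 𝓢(ℝ, ℂ)) t with hF
  have step : ∀ x, conj (evolve r φ₁ x) * evolve r φ₂ x * conj (evolve r φ₃ x) * evolve r φ₄ x =
      (((4 * Real.pi * |r|) ^ 2)⁻¹ : ℝ) * F (x / (4 * Real.pi * r)) := fun x => by
    rw [evolve_eq_fourier hr, evolve_eq_fourier hr, evolve_eq_fourier hr, evolve_eq_fourier hr,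
      ← nκ]
    have e4 : ((‖κ‖ ^ 4 : ℝ) : ℂ) = (conj κ * κ) ^ 2 := by
      rw [Complex.conj_mul']; push_cast; ring
    rw [e4]
    simp only [map_mul, hF, ← hκ, ← hc]
    have := hcc x
    set t := x / (4 * Real.pi * r)
    linear_combination ((conj κ * κ) ^ 2 * (conj ((𝓕 (chirpMul c φ₁) : 𝓢(ℝ, ℂ)) t) *
      (𝓕 (chirpMul c φ₂) : 𝓢(ℝ, ℂ)) t * conj ((𝓕 (chirpMul c φ₃) : 𝓢(ℝ, ℂ)) t) *
      (𝓕 (chirpMul c φ₄) : 𝓢(ℝ, ℂ)) t)) * (conj (chirp c x) * chirp c x + 1) * this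
  simp only [step]
  -- The factorisation produces `𝓕` while `integral_quad_eq` concerns `𝓕⁻`; the reflection
  -- reconciles them.
  rw [integral_const_mul, Measure.integral_comp_div, ← integral_neg_eq_self]
  have hinv : ∫ t, F (-t) = ∫ z, quadIntegrand (chirpMul c φ₁) (chirpMul c φ₂) (chirpMul c φ₃)
      (chirpMul c φ₄) z := by
    rw [← integral_quad_eq]
    refine integral_congr_ae (Eventually.of_forall fun t => ?_)
    simp only [hF, SchwartzMap.fourierInv_coe, Real.fourierInv_eq_fourier_neg,
      SchwartzMap.fourier_coe]
  have hq : ∀ z, quadIntegrand (chirpMul c φ₁) (chirpMul c φ₂) (chirpMul c φ₃)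
      (chirpMul c φ₄) z = quadIntegrand φ₁ φ₂ φ₃ φ₄ z *
        Complex.exp (Complex.I * (-(1 / 2) * (z.1.2 * z.2) / r : ℝ)) := fun z => by
    have := quadIntegrand_chirp c φ₁ φ₂ φ₃ φ₄ z
    simp only [← chirpMul_apply] at this
    refine this.trans ?_
    congr 4
    rw [hc]
    field_simp
    norm_num
  rw [hinv]
  simp only [hq, ← mul_assoc]
  rw [integral_mul_const, abs_mul, abs_of_pos (by have := Real.pi_pos; positivity : 0 < 4 * Real.pi),
    Complex.real_smul]
  have hr' : ((|r| : ℝ) : ℂ) ≠ 0 := by simpa using hr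
  have hpi : (Real.pi : ℂ) ≠ 0 := by exact_mod_cast Real.pi_ne_zero
  push_cast
  field_simp

/-! ### Bounds for the four-linear functional on Schwartz functions -/

theorem weight_half_le (t : ℝ≥0∞) : weight (2⁻¹ * t) ≤ 2 * weight t := by
  have key : ∀ a : ℝ, 0 ≤ a → a ≤ 1 → (2⁻¹ * t) ^ (-a) ≤ 2 * t ^ (-a) := fun a h0 h1 => by
    rw [ENNReal.rpow_neg, ENNReal.rpow_neg, ENNReal.mul_rpow_of_nonneg _ _ h0,
      ENNReal.mul_inv (Or.inl (by simp)) (Or.inl (by simp)), ← ENNReal.inv_rpow, inv_inv]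
    gcongr
    calc (2 : ℝ≥0∞) ^ a ≤ 2 ^ (1 : ℝ) := ENNReal.rpow_le_rpow_of_exponent_le (by norm_num) h1
      _ = 2 := ENNReal.rpow_one 2
  unfold weight
  rw [mul_min_of_nonneg _ _ (by positivity)]
  exact min_le_min (key _ (by norm_num) (by norm_num)) (key _ (by norm_num) (by norm_num))

section Oscillatory

variable {L : ℝ} {D : ℝ → ℝ} {Φ : (ℝ × ℝ) × ℝ → ℂ} {e : ℝ → ℝ → ℂ} {M : ℝ}

theorem integrable_oscillatory (mD : AEMeasurable D (volume.restrict (Ioc 0 L)))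
    (hΦ : Integrable Φ) (me : Measurable fun z : ℝ × ℝ => e z.1 z.2) (hM : ∀ θ r, ‖e θ r‖ ≤ M)
    (c : ℝ) : Integrable (Function.uncurry fun (s : ℝ) (z : (ℝ × ℝ) × ℝ) =>
      Φ z * e (c * (z.1.2 * z.2)) (D s)) ((volume.restrict (Ioc 0 L)).prod volume) := by
  have h1 : Integrable (fun w : ℝ × ((ℝ × ℝ) × ℝ) => Φ w.2)
      ((volume.restrict (Ioc 0 L)).prod volume) := by
    simpa using (integrable_const (μ := volume.restrict (Ioc 0 L)) (1 : ℂ)).mul_prod hΦ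
  refine h1.mul_bdd (c := M) ?_ (Eventually.of_forall fun w => hM _ _)
  have h2 : AEMeasurable (fun w : ℝ × ((ℝ × ℝ) × ℝ) => D w.1)
      ((volume.restrict (Ioc 0 L)).prod volume) :=
    mD.comp_quasiMeasurePreserving Measure.quasiMeasurePreserving_fst
  have h3 : AEMeasurable (fun w : ℝ × ((ℝ × ℝ) × ℝ) => c * (w.2.1.2 * w.2.2))
      ((volume.restrict (Ioc 0 L)).prod volume) := by fun_prop
  exact (me.comp_aemeasurable (h3.prodMk h2)).aestronglyMeasurable

theorem enorm_integral_oscillatory_le (hL : 0 < L)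
    (mD : AEMeasurable D (volume.restrict (Ioc 0 L)))
    (hΦ : Integrable Φ) (me : Measurable fun z : ℝ × ℝ => e z.1 z.2) (hM : ∀ θ r, ‖e θ r‖ ≤ M)
    {A : ℝ} (hA : 0 < A) (hbd : ∀ θ, θ ≠ 0 → ‖∫ s in (0 : ℝ)..L, e θ (D s)‖ ≤ A * weightReal θ)
    (c : ℝ) : ‖∫ s in (0 : ℝ)..L, ∫ z, Φ z * e (c * (z.1.2 * z.2)) (D s)‖ₑ ≤
      ENNReal.ofReal A * ∫⁻ z, ‖Φ z‖ₑ * weight ‖c * (z.1.2 * z.2)‖ₑ := by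
  have hall : ∀ θ, ‖∫ s in (0 : ℝ)..L, e θ (D s)‖ₑ ≤ ENNReal.ofReal A * weight ‖θ‖ₑ := fun θ => by
    -- At `θ = 0` the weight is infinite and the bound is void.
    rcases eq_or_ne θ 0 with rfl | hθ
    · have : weight ‖(0 : ℝ)‖ₑ = ∞ := by
        rw [weight, enorm_zero, ENNReal.zero_rpow_of_neg (by norm_num),
          ENNReal.zero_rpow_of_neg (by norm_num), min_self]
      rw [this, ENNReal.mul_top (by simpa using hA)]
      exact le_top
    · rw [weight_enorm hθ, ← ENNReal.ofReal_mul hA.le, ← ofReal_norm]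
      exact ENNReal.ofReal_le_ofReal (hbd θ hθ)
  rw [intervalIntegral.integral_of_le hL.le,
    integral_integral_swap (integrable_oscillatory mD hΦ me hM c)]
  calc _ = ‖∫ z, Φ z * ∫ s in (0 : ℝ)..L, e (c * (z.1.2 * z.2)) (D s)‖ₑ := by
        simp only [integral_const_mul, intervalIntegral.integral_of_le hL.le]
    _ ≤ ∫⁻ z, ‖Φ z * ∫ s in (0 : ℝ)..L, e (c * (z.1.2 * z.2)) (D s)‖ₑ := enorm_integral_le_lintegral_enorm _
    _ ≤ ∫⁻ z, ENNReal.ofReal A * (‖Φ z‖ₑ * weight ‖c * (z.1.2 * z.2)‖ₑ) := by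
        refine lintegral_mono fun z => ?_
        rw [enorm_mul, mul_left_comm (ENNReal.ofReal A)]
        exact mul_le_mul' le_rfl (hall _)
    _ = _ := lintegral_const_mul' _ _ ENNReal.ofReal_ne_top

end Oscillatory

theorem lintegral_quadIntegrand_le {g₁ g₂ g₃ g₄ : ℝ → ℂ} (m₁ : Measurable g₁) (m₂ : Measurable g₂)
    (m₃ : Measurable g₃) (m₄ : Measurable g₄) {c : ℝ} {K : ℝ≥0∞} (hK : K ≠ ∞)
    (hc : ∀ x : ℝ, weight ‖c * x‖ₑ ≤ K * weight ‖x‖ₑ) :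
    ∫⁻ z, ‖quadIntegrand g₁ g₂ g₃ g₄ z‖ₑ * weight ‖c * (z.1.2 * z.2)‖ₑ ≤
      K * majorant (‖g₁ ·‖ₑ) (‖g₂ ·‖ₑ) (‖g₃ ·‖ₑ) (‖g₄ ·‖ₑ) := by
  rw [majorant_eq_prod m₁.enorm m₂.enorm m₃.enorm m₄.enorm, ← lintegral_const_mul' _ _ hK]
  refine lintegral_mono fun z => ?_
  simp only [quadIntegrand, enorm_mul, RCLike.enorm_conj]
  rw [mul_left_comm K]
  exact mul_le_mul' le_rfl (by simpa only [enorm_mul] using hc (z.1.2 * z.2))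

/-! ### Majorant bounds in frequency and in space -/

/-- `∫ conj(T_r φ₁) T_r φ₂ conj(T_r φ₃) T_r φ₄ dx` for Schwartz functions. -/
def evolvedQuad (φ₁ φ₂ φ₃ φ₄ : 𝓢(ℝ, ℂ)) (r : ℝ) : ℂ :=
  ∫ x, conj (evolve r φ₁ x) * evolve r φ₂ x * conj (evolve r φ₃ x) * evolve r φ₄ x

theorem calQ_toLp (d₀ : ℝ → ℝ) (L : ℝ) (φ₁ φ₂ φ₃ φ₄ : 𝓢(ℝ, ℂ)) :
    calQ d₀ L (φ₁.toLp 2) (φ₂.toLp 2) (φ₃.toLp 2) (φ₄.toLp 2) =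
      (1 / (L : ℂ)) * ∫ s in (0 : ℝ)..L, evolvedQuad φ₁ φ₂ φ₃ φ₄ (accDispersion d₀ s) := by
  unfold calQ evolvedQuad
  congr 1
  refine intervalIntegral.integral_congr fun s _ => integral_congr_ae ?_
  simp only [freeEvolution_toLp]
  filter_upwards [(evolve (accDispersion d₀ s) φ₁).coeFn_toLp 2 volume,
    (evolve (accDispersion d₀ s) φ₂).coeFn_toLp 2 volume,
    (evolve (accDispersion d₀ s) φ₃).coeFn_toLp 2 volume,
    (evolve (accDispersion d₀ s) φ₄).coeFn_toLp 2 volume] with x h1 h2 h3 h4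
  rw [h1, h2, h3, h4]

section Profile

variable {d₀ : ℝ → ℝ} {L : ℝ}

theorem integrableOn_evolvedQuad (hL : 0 < L) (h : PiecewiseW11 d₀ L) (φ₁ φ₂ φ₃ φ₄ : 𝓢(ℝ, ℂ)) :
    IntegrableOn (fun s => evolvedQuad φ₁ φ₂ φ₃ φ₄ (accDispersion d₀ s)) (Ioc 0 L) := by
  have h1 := (integrable_oscillatory (e := fun θ r => Complex.exp (Complex.I * (θ * r : ℝ))) (M := 1)
    (aemeasurable_accDispersion hL.le h)
    (integrable_quadIntegrand (𝓕 φ₁) (𝓕 φ₂) (𝓕 φ₃) (𝓕 φ₄)) (by fun_prop)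
    (fun θ r => (norm_exp_I_mul _).le) (8 * Real.pi ^ 2)).integral_prod_left
  refine h1.congr (Eventually.of_forall fun s => ?_)
  simp only [evolvedQuad, integral_evolve_eq_fourier, Function.uncurry]

theorem exists_enorm_integral_evolvedQuad_le_fourier (hL : 0 < L) (h : PiecewiseW11 d₀ L)
    (h' : BoundedAwayFromZero d₀ L) : ∃ C : ℝ≥0∞, C < ∞ ∧ ∀ φ₁ φ₂ φ₃ φ₄ : 𝓢(ℝ, ℂ),
      ‖∫ s in (0 : ℝ)..L, evolvedQuad φ₁ φ₂ φ₃ φ₄ (accDispersion d₀ s)‖ₑ ≤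
        C * majorant (‖(𝓕 φ₁ : 𝓢(ℝ, ℂ)) ·‖ₑ) (‖(𝓕 φ₂ : 𝓢(ℝ, ℂ)) ·‖ₑ) (‖(𝓕 φ₃ : 𝓢(ℝ, ℂ)) ·‖ₑ)
          (‖(𝓕 φ₄ : 𝓢(ℝ, ℂ)) ·‖ₑ) := by
  obtain ⟨C, R, hC, hR, hCR⟩ := exists_norm_integral_comp_accDispersion_le hL h h'
  refine ⟨ENNReal.ofReal (C * (2 * (R + 1))), ENNReal.ofReal_lt_top, fun φ₁ φ₂ φ₃ φ₄ => ?_⟩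
  have h1 := enorm_integral_oscillatory_le (e := fun θ r => Complex.exp (Complex.I * (θ * r : ℝ)))
    (M := 1) hL (aemeasurable_accDispersion hL.le h)
    (integrable_quadIntegrand (𝓕 φ₁) (𝓕 φ₂) (𝓕 φ₃) (𝓕 φ₄)) (by fun_prop)
    (fun θ r => (norm_exp_I_mul _).le) (A := C * (2 * (R + 1))) (by positivity)
    (fun θ hθ => by
      rw [mul_assoc]
      exact hCR _ (by fun_prop) ⟨1, fun r => (norm_exp_I_mul _).le⟩ _
        fun α β hα hαβ hβ => norm_integral_exp_le hR hθ hα hαβ hβ) (8 * Real.pi ^ 2)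
  simp only [evolvedQuad, integral_evolve_eq_fourier]
  refine h1.trans ?_
  gcongr
  have := lintegral_quadIntegrand_le (𝓕 φ₁ : 𝓢(ℝ, ℂ)).continuous.measurable
    (𝓕 φ₂ : 𝓢(ℝ, ℂ)).continuous.measurable (𝓕 φ₃ : 𝓢(ℝ, ℂ)).continuous.measurable
    -- The weight is decreasing and `8π² ≥ 1`, so this factor of the phase can be dropped.
    (𝓕 φ₄ : 𝓢(ℝ, ℂ)).continuous.measurable (c := 8 * Real.pi ^ 2) ENNReal.one_ne_top fun x => by
      rw [one_mul]
      refine weight_antitone ?_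
      rw [enorm_mul]
      refine le_mul_of_one_le_left (zero_le) ?_
      rw [← ofReal_norm, ENNReal.one_le_ofReal, Real.norm_eq_abs, abs_of_nonneg (by positivity)]
      nlinarith [Real.pi_gt_three]
  rwa [one_mul] at this

/-- The kernel `e^{iθ/r}/|r|` is not absolutely integrable at `r = 0`. The set where `|D(s)| ≤ ε`
contributes only `O(ε)`, because the quartic integral is bounded in `s`; on its complement the
cutoff kernel is bounded uniformly in `ε`. Then `ε` tends to zero. -/
theorem exists_enorm_integral_evolvedQuad_le_space (hL : 0 < L) (h : PiecewiseW11 d₀ L)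
    (h' : BoundedAwayFromZero d₀ L) : ∃ C : ℝ≥0∞, C < ∞ ∧ ∀ φ₁ φ₂ φ₃ φ₄ : 𝓢(ℝ, ℂ),
      ‖∫ s in (0 : ℝ)..L, evolvedQuad φ₁ φ₂ φ₃ φ₄ (accDispersion d₀ s)‖ₑ ≤
        C * majorant (‖φ₁ ·‖ₑ) (‖φ₂ ·‖ₑ) (‖φ₃ ·‖ₑ) (‖φ₄ ·‖ₑ) := by
  obtain ⟨C, R, hC, hR, hCR⟩ := exists_norm_integral_comp_accDispersion_le hL h h'
  set A : ℝ := C * (2 * (2 + 4 * (R + 1))) with hA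
  have mD := aemeasurable_accDispersion hL.le h
  refine ⟨ENNReal.ofReal A * 2, ENNReal.mul_lt_top ENNReal.ofReal_lt_top (by simp),
    fun φ₁ φ₂ φ₃ φ₄ => ?_⟩
  set q : ℝ → ℂ := fun s => evolvedQuad φ₁ φ₂ φ₃ φ₄ (accDispersion d₀ s) with hq
  have iq : IntegrableOn q (Ioc 0 L) := integrableOn_evolvedQuad hL h φ₁ φ₂ φ₃ φ₄
  -- Boundedness in `s` comes from the frequency representation, where the phase has modulus one.
  set B : ℝ := ∫ z, ‖quadIntegrand (𝓕 φ₁ : 𝓢(ℝ, ℂ)) (𝓕 φ₂ : 𝓢(ℝ, ℂ)) (𝓕 φ₃ : 𝓢(ℝ, ℂ))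
    (𝓕 φ₄ : 𝓢(ℝ, ℂ)) z‖ with hB
  have hB0 : 0 ≤ B := integral_nonneg fun z => norm_nonneg _
  have hqB : ∀ s, ‖q s‖ ≤ B := fun s => by
    simp only [hq, evolvedQuad, integral_evolve_eq_fourier]
    refine (norm_integral_le_integral_norm _).trans_eq ?_
    simp only [norm_mul, norm_exp_I_mul, mul_one, hB]
  set near : ℝ → ℝ → ℂ := fun ε r => if |r| ≤ ε then 1 else 0 with hnear
  have mnear : ∀ ε, Measurable (near ε) := fun ε =>
    Measurable.ite (measurableSet_le (by fun_prop) (by fun_prop)) measurable_const measurable_const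
  have nnear : ∀ ε r, ‖near ε r‖ ≤ 1 := fun ε r => by simp only [hnear]; split_ifs <;> simp
  have bnear : ∀ ε, 0 < ε → ‖∫ s in (0 : ℝ)..L, near ε (accDispersion d₀ s)‖ ≤ C * (2 * ε) :=
    fun ε hε => by
      refine hCR _ (mnear ε) ⟨1, nnear ε⟩ _ fun α β _ hαβ _ => ?_
      have e1 : near ε = indicator (Icc (-ε) ε) fun _ => 1 := by
        ext r; simp [hnear, indicator, abs_le]
      rw [e1, intervalIntegral.integral_of_le hαβ, integral_indicator measurableSet_Icc,
        Measure.restrict_restrict measurableSet_Icc]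
      refine (norm_integral_le_integral_norm _).trans ?_
      rw [norm_one, integral_const, smul_eq_mul, mul_one, measureReal_restrict_apply_univ]
      calc volume.real (Icc (-ε) ε ∩ Ioc α β) ≤ volume.real (Icc (-ε) ε) :=
            measureReal_mono inter_subset_left (by simp)
        _ = 2 * ε := by rw [Real.volume_real_Icc_of_le (by linarith)]; ring
  have split : ∀ ε, 0 < ε → ‖∫ s in (0 : ℝ)..L, q s‖ₑ ≤
      ENNReal.ofReal (B * (C * (2 * ε))) + ENNReal.ofReal A * 2 *
        majorant (‖φ₁ ·‖ₑ) (‖φ₂ ·‖ₑ) (‖φ₃ ·‖ₑ) (‖φ₄ ·‖ₑ) := fun ε hε => by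
    have mn : AEStronglyMeasurable (fun s => near ε (accDispersion d₀ s))
        (volume.restrict (Ioc 0 L)) := ((mnear ε).comp_aemeasurable mD).aestronglyMeasurable
    have i1 : IntegrableOn (fun s => near ε (accDispersion d₀ s) * q s) (Ioc 0 L) :=
      iq.bdd_mul (c := 1) mn (Eventually.of_forall fun s => nnear _ _)
    have i2 : IntegrableOn (fun s => q s - near ε (accDispersion d₀ s) * q s) (Ioc 0 L) := iq.sub i1
    have e1 : ∫ s in (0 : ℝ)..L, q s = (∫ s in (0 : ℝ)..L, near ε (accDispersion d₀ s) * q s) +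
        ∫ s in (0 : ℝ)..L, (q s - near ε (accDispersion d₀ s) * q s) := by
      simp only [intervalIntegral.integral_of_le hL.le]
      rw [← integral_add i1 i2]
      simp
    rw [e1]
    refine (enorm_add_le _ _).trans (add_le_add ?_ ?_)
    · rw [← ofReal_norm]
      refine ENNReal.ofReal_le_ofReal ?_
      -- The cutoff is nonnegative, so the integral of its norm is the norm of its integral, which
      -- `bnear` controls.
      have e2 : ∫ s in (0 : ℝ)..L, near ε (accDispersion d₀ s) =
          ((∫ s in (0 : ℝ)..L, ‖near ε (accDispersion d₀ s)‖ : ℝ) : ℂ) := by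
        rw [← intervalIntegral.integral_ofReal]
        refine intervalIntegral.integral_congr fun s _ => ?_
        simp only [hnear]; split_ifs <;> simp
      have e3 : ∫ s in (0 : ℝ)..L, ‖near ε (accDispersion d₀ s)‖ ≤ C * (2 * ε) := by
        refine le_trans (le_abs_self _) ?_
        rw [← Real.norm_eq_abs, ← Complex.norm_real, ← e2]
        exact bnear ε hε
      refine le_trans ?_ (mul_le_mul_of_nonneg_left e3 hB0)
      rw [intervalIntegral.integral_of_le hL.le, intervalIntegral.integral_of_le hL.le,
        ← integral_const_mul]
      refine norm_integral_le_of_norm_le ?_ (Eventually.of_forall fun s => ?_)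
      · exact (Integrable.of_bound mn 1 (Eventually.of_forall fun s => nnear _ _)).norm.const_mul _
      · rw [norm_mul, mul_comm]
        gcongr
        exact hqB s
    · have e4 : ∀ s, q s - near ε (accDispersion d₀ s) * q s = ((4 * Real.pi)⁻¹ : ℝ) *
          ∫ z, quadIntegrand φ₁ φ₂ φ₃ φ₄ z *
            cutKernel ε (-(1 / 2) * (z.1.2 * z.2)) (accDispersion d₀ s) := fun s => by
        by_cases hs : |accDispersion d₀ s| ≤ ε
        · simp [hnear, cutKernel, hs, not_lt.2 hs]
        · have hs' := not_le.1 hs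
          have h0 : accDispersion d₀ s ≠ 0 := fun h0 => by
            rw [h0, abs_zero] at hs'; exact absurd hs' (not_lt.2 hε.le)
          simp only [hnear, hs, if_false, zero_mul, sub_zero, cutKernel, hs', if_true]
          exact integral_evolve_eq_space h0 φ₁ φ₂ φ₃ φ₄
      simp only [e4]
      rw [intervalIntegral.integral_const_mul, enorm_mul]
      have hpi : ‖(((4 * Real.pi)⁻¹ : ℝ) : ℂ)‖ₑ ≤ 1 := by
        rw [← ofReal_norm, Complex.norm_real, ENNReal.ofReal_le_one, Real.norm_eq_abs,
          abs_of_nonneg (by have := Real.pi_pos; positivity)]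
        exact inv_le_one_of_one_le₀ (by linarith [Real.pi_gt_three])
      refine (mul_le_of_le_one_left zero_le hpi).trans ?_
      have h1 := enorm_integral_oscillatory_le (e := cutKernel ε) hL mD
        (integrable_quadIntegrand φ₁ φ₂ φ₃ φ₄) (measurable_cutKernel ε) (norm_cutKernel_le hε)
        (A := A) (by positivity) (fun θ hθ => by
          rw [hA, mul_assoc]
          exact hCR _ ((measurable_cutKernel ε).comp measurable_prodMk_left)
            ⟨_, norm_cutKernel_le hε θ⟩ _
            fun α β hα hαβ hβ => norm_integral_cutKernel_le hR hε hθ hα hαβ hβ) (-(1 / 2))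
      refine h1.trans ?_
      rw [mul_assoc]
      gcongr
      refine lintegral_quadIntegrand_le φ₁.continuous.measurable φ₂.continuous.measurable
        φ₃.continuous.measurable φ₄.continuous.measurable (by simp) fun x => ?_
      have : ‖-(1 / 2) * x‖ₑ = 2⁻¹ * ‖x‖ₑ := by
        rw [enorm_mul, enorm_neg]
        congr 1
        rw [← ofReal_norm]
        rw [one_div, norm_inv, ENNReal.ofReal_inv_of_pos (by simp)]
        simp
      rw [this]
      exact weight_half_le _
  have lim : Tendsto (fun ε : ℝ => ENNReal.ofReal (B * (C * (2 * ε))) + ENNReal.ofReal A * 2 *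
        majorant (‖φ₁ ·‖ₑ) (‖φ₂ ·‖ₑ) (‖φ₃ ·‖ₑ) (‖φ₄ ·‖ₑ)) (𝓝[>] 0)
      (𝓝 (0 + ENNReal.ofReal A * 2 *
        majorant (‖φ₁ ·‖ₑ) (‖φ₂ ·‖ₑ) (‖φ₃ ·‖ₑ) (‖φ₄ ·‖ₑ))) := by
    refine Tendsto.add ?_ tendsto_const_nhds
    have : Continuous fun ε : ℝ => ENNReal.ofReal (B * (C * (2 * ε))) :=
      ENNReal.continuous_ofReal.comp (by fun_prop)
    simpa using (this.tendsto 0).mono_left (nhdsWithin_le_nhds (s := Ioi 0))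
  rw [zero_add] at lim
  exact ge_of_tendsto lim (by filter_upwards [self_mem_nhdsWithin] with ε hε using split ε hε)

end Profile

/-! ### Extension to square integrable functions -/

theorem freeEvolution_sub (r : ℝ) (f g : L2) :
    freeEvolution r (f - g) = freeEvolution r f - freeEvolution r g := by
  unfold freeEvolution
  have e1 : (𝓕 (f - g) : L2) = 𝓕 f - 𝓕 g := map_sub (FourierTransform.fourierCLE ℂ L2) f g
  have e2 : ∀ u v : L2, (𝓕⁻ (u - v) : L2) = 𝓕⁻ u - 𝓕⁻ v := fun u v =>
    map_sub (FourierTransform.fourierCLE ℂ L2).symm u v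
  rw [e1, sub_eq_add_neg, Lp.add_smul, Lp.smul_neg, ← sub_eq_add_neg, e2]

theorem norm_freeEvolution (r : ℝ) (f : L2) : ‖freeEvolution r f‖ = ‖f‖ := by
  unfold freeEvolution
  rw [← Lp.norm_fourier_eq, FourierTransform.fourier_fourierInv_eq, ← Lp.norm_fourier_eq f]
  rw [Lp.norm_def, Lp.norm_def]
  congr 1
  refine eLpNorm_congr_norm_ae ?_
  filter_upwards [Lp.coeFn_lpSMul (r := 2) ((memLp_freeSymbol r).toLp (freeSymbol r)) (𝓕 f : L2),
    (memLp_freeSymbol r).coeFn_toLp] with x h1 h2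
  rw [h1, Pi.smul_apply', h2, norm_smul, norm_freeSymbol, one_mul]

theorem enorm_freeEvolution_sub (r : ℝ) (f g : L2) :
    ‖freeEvolution r f - freeEvolution r g‖ₑ = ‖f - g‖ₑ := by
  rw [← freeEvolution_sub, ← ofReal_norm, ← ofReal_norm, norm_freeEvolution]

theorem enorm_L2_sq (f : L2) : ‖f‖ₑ ^ 2 = ∫⁻ x, ‖f x‖ₑ ^ 2 := by
  rw [Lp.enorm_def, ← eLpNorm_enorm, eLpNorm_two_sq]

theorem measurable_enorm_L2 (f : L2) : Measurable fun x => ‖f x‖ₑ :=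
  (Lp.stronglyMeasurable f).measurable.enorm

theorem ae_tendsto_zero_of_tsum {α : Type*} {m : MeasurableSpace α} {μ : Measure α}
    {w : ℕ → α → ℝ≥0∞} (mw : ∀ n, AEMeasurable (w n) μ) (h : ∑' n, ∫⁻ x, w n x ∂μ ≠ ∞) :
    ∀ᵐ x ∂μ, Tendsto (fun n => w n x) atTop (𝓝 0) := by
  rw [← lintegral_tsum mw] at h
  filter_upwards [ae_lt_top' (AEMeasurable.tsum mw) h] with x hx
  exact ENNReal.tendsto_atTop_zero_of_tsum_ne_top hx.ne

/-- The geometric rate makes the squared errors summable, so no subsequence is needed. -/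
theorem ae_tendsto_of_enorm_sub_le {u : ℕ → L2} {f : L2} (h : ∀ n, ‖u n - f‖ₑ ≤ 2⁻¹ ^ n) :
    ∀ᵐ x, Tendsto (fun n => u n x) atTop (𝓝 (f x)) := by
  have h1 : ∀ᵐ x, Tendsto (fun n => ‖(u n - f : L2) x‖ₑ ^ 2) atTop (𝓝 0) := by
    refine ae_tendsto_zero_of_tsum (fun n => ((measurable_enorm_L2 _).pow_const 2).aemeasurable) ?_
    have : ∀ n, ∫⁻ x, ‖(u n - f : L2) x‖ₑ ^ 2 ≤ 2⁻¹ ^ n := fun n => by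
      rw [← enorm_L2_sq]
      have h1 : ‖u n - f‖ₑ ≤ 1 := (h n).trans (pow_le_one₀ zero_le (by simp))
      calc ‖u n - f‖ₑ ^ 2 ≤ ‖u n - f‖ₑ ^ 1 := pow_le_pow_of_le_one zero_le h1 (by norm_num)
        _ ≤ _ := by rw [pow_one]; exact h n
    refine ne_top_of_le_ne_top ?_ (ENNReal.tsum_le_tsum this)
    rw [ENNReal.tsum_geometric]
    simp
  have h2 : ∀ᵐ x, ∀ n, (u n - f : L2) x = u n x - f x := ae_all_iff.2 fun n => by
    filter_upwards [Lp.coeFn_sub (u n) f] with x hx using hx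
  filter_upwards [h1, h2] with x hx1 hx2
  rw [tendsto_iff_edist_tendsto_0]
  have h3 : Tendsto (fun n => (‖(u n - f : L2) x‖ₑ ^ 2) ^ (1 / 2 : ℝ)) atTop (𝓝 0) := by
    have := ((ENNReal.continuous_rpow_const (y := (1 / 2 : ℝ))).tendsto 0).comp hx1
    simpa [Function.comp_def] using this
  refine h3.congr fun n => ?_
  rw [edist_eq_enorm_sub, ← hx2, ← ENNReal.rpow_natCast, ← ENNReal.rpow_mul]
  norm_num

theorem exists_schwartz_approx (f : L2) : ∃ φ : ℕ → 𝓢(ℝ, ℂ), ∀ n, ‖(φ n).toLp 2 volume - f‖ₑ ≤ 2⁻¹ ^ n := by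
  have hd := SchwartzMap.denseRange_toLpCLM (E := ℝ) (F := ℂ) (p := 2) (by simp) (μ := volume)
  have : ∀ n : ℕ, ∃ φ : 𝓢(ℝ, ℂ), ‖φ.toLp 2 volume - f‖ₑ ≤ 2⁻¹ ^ n := fun n => by
    obtain ⟨φ, hφ⟩ := hd.exists_dist_lt f (ε := 2⁻¹ ^ n) (by positivity)
    refine ⟨φ, ?_⟩
    rw [SchwartzMap.toLpCLM_apply, dist_comm, dist_eq_norm] at hφ
    rw [← ofReal_norm]
    refine (ENNReal.ofReal_le_ofReal hφ.le).trans_eq ?_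
    rw [ENNReal.ofReal_pow (by norm_num), ENNReal.ofReal_inv_of_pos (by norm_num)]
    simp
  choose φ hφ using this
  exact ⟨φ, hφ⟩

/-- `∫ |u|⁴`. -/
def quartic (u : ℝ → ℂ) : ℝ≥0∞ := ∫⁻ x, ‖u x‖ₑ ^ 4

/-- Fatou; an `L²` limit need not have a finite quartic integral a priori. -/
theorem quartic_le_liminf {u : ℕ → L2} {f : L2} (h : ∀ n, ‖u n - f‖ₑ ≤ 2⁻¹ ^ n) :
    quartic f ≤ liminf (fun n => quartic (u n)) atTop := by
  unfold quartic
  refine le_trans ?_ (lintegral_liminf_le' fun n =>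
    ((measurable_enorm_L2 (u n)).pow_const 4).aemeasurable)
  refine lintegral_mono_ae ?_
  filter_upwards [ae_tendsto_of_enorm_sub_le h] with x hx
  have h4 : Continuous fun z : ℂ => ‖z‖ₑ ^ 4 :=
    (ENNReal.continuous_pow 4).comp continuous_enorm
  exact ((h4.tendsto _).comp hx).liminf_eq.ge

theorem lintegral_mul_sq_le {a b : ℝ → ℝ≥0∞} (ma : Measurable a) (mb : Measurable b) :
    ∫⁻ x, a x * b x ^ 2 ≤ eLpNorm a 2 * (1 + ∫⁻ x, b x ^ 4) := by
  have h := ENNReal.lintegral_mul_le_Lp_mul_Lq volume (p := 2) (q := 2)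
    (by constructor <;> norm_num) ma.aemeasurable (mb.pow_const 2).aemeasurable
  simp only [Pi.mul_apply, ENNReal.rpow_ofNat, ← eLpNorm_two_eq a] at h
  refine h.trans ?_
  gcongr
  have e4 : ∀ x, (b x ^ 2) ^ 2 = b x ^ 4 := fun x => by rw [← pow_mul]
  simp only [e4]
  set P := ∫⁻ x, b x ^ 4
  -- `√P ≤ 1 + P` avoids carrying fractional powers into the integration over `s`.
  rcases le_total P 1 with h1 | h1
  · exact le_add_right (ENNReal.rpow_le_one h1 (by norm_num))
  · refine le_add_left ?_
    calc P ^ (1 / 2 : ℝ) ≤ P ^ (1 : ℝ) := ENNReal.rpow_le_rpow_of_exponent_le h1 (by norm_num)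
      _ = P := ENNReal.rpow_one P

theorem norm_cube_sub_le (u w : ℂ) : ‖u * conj u * u - w * conj w * w‖ ≤
    2 * (‖u - w‖ * ‖u‖ ^ 2 + ‖u - w‖ * ‖w‖ ^ 2) := by
  have e : u * conj u * u - w * conj w * w =
      (u - w) * (conj u * u) + w * conj (u - w) * u + w * conj w * (u - w) := by
    rw [map_sub]; ring
  rw [e]
  refine (norm_add₃_le).trans ?_
  simp only [norm_mul, RCLike.norm_conj]
  nlinarith [mul_nonneg (norm_nonneg (u - w)) (sq_nonneg (‖u‖ - ‖w‖)),
    mul_nonneg (norm_nonneg (u - w)) (sq_nonneg ‖u‖), mul_nonneg (norm_nonneg (u - w)) (sq_nonneg ‖w‖)]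

theorem lintegral_cube_sub_le {K : ℝ} {v : ℝ → ℂ} (hv : ∀ᵐ x, ‖v x‖ ≤ K) (u w : L2) :
    ∫⁻ x, ‖conj (v x) * u x * conj (u x) * u x - conj (v x) * w x * conj (w x) * w x‖ₑ ≤
      ENNReal.ofReal K * (2 * (‖u - w‖ₑ * (2 + quartic u + quartic w))) := by
  have hd : ∀ᵐ x, ‖conj (v x) * u x * conj (u x) * u x - conj (v x) * w x * conj (w x) * w x‖ₑ ≤
      ENNReal.ofReal K * (2 * (‖(u - w : L2) x‖ₑ * ‖u x‖ₑ ^ 2 + ‖(u - w : L2) x‖ₑ * ‖w x‖ₑ ^ 2)) := by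
    filter_upwards [hv, Lp.coeFn_sub u w] with x hx hs
    have e : conj (v x) * u x * conj (u x) * u x - conj (v x) * w x * conj (w x) * w x =
        conj (v x) * (u x * conj (u x) * u x - w x * conj (w x) * w x) := by ring
    rw [e, enorm_mul, RCLike.enorm_conj, hs, Pi.sub_apply]
    gcongr
    · rw [← ofReal_norm]; exact ENNReal.ofReal_le_ofReal hx
    · have := ENNReal.ofReal_le_ofReal (norm_cube_sub_le (u x) (w x))
      rw [ENNReal.ofReal_mul (by norm_num), ENNReal.ofReal_add (by positivity) (by positivity),
        ENNReal.ofReal_mul (by positivity), ENNReal.ofReal_mul (by positivity),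
        ENNReal.ofReal_pow (by positivity), ENNReal.ofReal_pow (by positivity)] at this
      simpa only [ofReal_norm, ENNReal.ofReal_ofNat] using this
  have md := measurable_enorm_L2 (u - w)
  have mu := measurable_enorm_L2 u
  have mw := measurable_enorm_L2 w
  refine (lintegral_mono_ae hd).trans ?_
  rw [lintegral_const_mul _ (by fun_prop), lintegral_const_mul _ (by fun_prop),
    lintegral_add_left (by fun_prop)]
  have h1 := lintegral_mul_sq_le md mu
  have h2 := lintegral_mul_sq_le md mw
  rw [eLpNorm_enorm, ← Lp.enorm_def] at h1 h2
  gcongr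
  refine (add_le_add h1 h2).trans_eq ?_
  unfold quartic
  ring

theorem enorm_integral_cube_sub_le {K : ℝ} {v : ℝ → ℂ} (mv : AEStronglyMeasurable v)
    (hv : ∀ᵐ x, ‖v x‖ ≤ K) (u w : L2) (hu : quartic u ≠ ∞) (hw : quartic w ≠ ∞) :
    ‖(∫ x, conj (v x) * u x * conj (u x) * u x) - ∫ x, conj (v x) * w x * conj (w x) * w x‖ₑ ≤
      ENNReal.ofReal K * (2 * (‖u - w‖ₑ * (2 + quartic u + quartic w))) := by
  have mc : ∀ u : L2, AEStronglyMeasurable fun x => conj (v x) * u x * conj (u x) * u x := fun u => by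
    have := Lp.aestronglyMeasurable u
    have hc := Complex.continuous_conj.comp_aestronglyMeasurable this
    have hc' := Complex.continuous_conj.comp_aestronglyMeasurable mv
    exact ((hc'.mul this).mul hc).mul this
  have ic : ∀ u : L2, quartic u ≠ ∞ → Integrable fun x => conj (v x) * u x * conj (u x) * u x :=
    fun u hu => by
      refine ⟨mc u, ?_⟩
      have h := lintegral_cube_sub_le hv u 0
      have h0 : quartic (0 : L2) = 0 := by
        unfold quartic
        rw [← lintegral_zero (μ := (volume : Measure ℝ))]
        refine lintegral_congr_ae ?_
        filter_upwards [Lp.coeFn_zero (E := ℂ) (p := 2) (μ := (volume : Measure ℝ))] with x hx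
        rw [hx]; simp
      have e : ∫⁻ x, ‖conj (v x) * u x * conj (u x) * u x‖ₑ = ∫⁻ x, ‖conj (v x) * u x * conj (u x) * u x
          - conj (v x) * (0 : L2) x * conj ((0 : L2) x) * (0 : L2) x‖ₑ := by
        refine lintegral_congr_ae ?_
        filter_upwards [Lp.coeFn_zero (E := ℂ) (p := 2) (μ := (volume : Measure ℝ))] with x hx
        rw [hx]; simp
      rw [HasFiniteIntegral, e]
      refine h.trans_lt (ENNReal.mul_lt_top ENNReal.ofReal_lt_top (ENNReal.mul_lt_top (by simp)
        (ENNReal.mul_lt_top enorm_lt_top ?_)))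
      rw [h0, add_zero]
      exact ENNReal.add_lt_top.2 ⟨by simp, hu.lt_top⟩
  rw [← integral_sub (ic u hu) (ic w hw)]
  exact (enorm_integral_le_lintegral_enorm _).trans (lintegral_cube_sub_le hv u w)

theorem evolvedQuad_self (φ : 𝓢(ℝ, ℂ)) (r : ℝ) :
    evolvedQuad φ φ φ φ r = ((∫ x, ‖evolve r φ x‖ ^ 4 : ℝ) : ℂ) := by
  rw [evolvedQuad, ← integral_complex_ofReal]
  refine integral_congr_ae (Eventually.of_forall fun x => ?_)
  have := Complex.conj_mul' (evolve r φ x)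
  calc _ = (conj (evolve r φ x) * evolve r φ x) ^ 2 := by ring
    _ = _ := by rw [this]; push_cast; ring

theorem evolvedQuad_self_eq_norm (φ : 𝓢(ℝ, ℂ)) (r : ℝ) :
    evolvedQuad φ φ φ φ r = (‖evolvedQuad φ φ φ φ r‖ : ℝ) := by
  rw [evolvedQuad_self, Complex.norm_real, Real.norm_eq_abs,
    abs_of_nonneg (integral_nonneg fun x => by positivity)]

theorem quartic_freeEvolution_toLp (r : ℝ) (φ : 𝓢(ℝ, ℂ)) :
    quartic (freeEvolution r (φ.toLp 2)) = ‖evolvedQuad φ φ φ φ r‖ₑ := by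
  have h4 : MemLp (evolve r φ) 4 volume := (evolve r φ).memLp 4
  have i4 : Integrable fun x => ‖evolve r φ x‖ ^ 4 := by
    simpa using h4.integrable_norm_pow (by norm_num)
  rw [evolvedQuad_self, ← ofReal_norm, Complex.norm_real, Real.norm_eq_abs,
    abs_of_nonneg (integral_nonneg fun x => by positivity),
    ofReal_integral_eq_lintegral_ofReal i4 (Eventually.of_forall fun x => by positivity), quartic]
  refine lintegral_congr_ae ?_
  rw [freeEvolution_toLp]
  filter_upwards [(evolve r φ).coeFn_toLp 2 volume] with x hx
  rw [hx, ENNReal.ofReal_pow (norm_nonneg _), ofReal_norm]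

theorem enorm_toLp_eq_eLpNorm (φ : 𝓢(ℝ, ℂ)) :
    ‖φ.toLp 2 (volume : Measure ℝ)‖ₑ = eLpNorm (fun x => ‖φ x‖ₑ) 2 volume := by
  rw [Lp.enorm_def, eLpNorm_enorm]
  exact eLpNorm_congr_ae (φ.coeFn_toLp 2 volume)

theorem enorm_fourier_eq (f : L2) : ‖(𝓕 f : L2)‖ₑ = ‖f‖ₑ := by
  rw [← ofReal_norm, ← ofReal_norm, Lp.norm_fourier_eq]

theorem norm_evolve_le (r : ℝ) (φ : 𝓢(ℝ, ℂ)) (x : ℝ) :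
    ‖evolve r φ x‖ ≤ ∫ ξ, ‖(𝓕 φ : 𝓢(ℝ, ℂ)) ξ‖ := by
  rw [evolve_eq_integral]
  refine (norm_integral_le_integral_norm _).trans_eq ?_
  congr 1
  ext ξ
  have : -(Real.pi : ℂ) * (4 * Real.pi * r * Complex.I) * ξ ^ 2 + 2 * Real.pi * (Complex.I * x) * ξ =
      Complex.I * ((-Real.pi * (4 * Real.pi * r) * ξ ^ 2 + 2 * Real.pi * x * ξ : ℝ) : ℂ) := by
    push_cast; ring
  rw [norm_mul, this, norm_exp_I_mul, mul_one]

theorem tendsto_of_enorm_sub_le {E : Type*} [SeminormedAddCommGroup E] {u : ℕ → E} {f : E}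
    {w : ℕ → ℝ≥0∞} (h : ∀ n, ‖u n - f‖ₑ ≤ w n) (hw : Tendsto w atTop (𝓝 0)) :
    Tendsto u atTop (𝓝 f) := by
  rw [tendsto_iff_edist_tendsto_0]
  refine tendsto_of_tendsto_of_tendsto_of_le_of_le tendsto_const_nhds hw (fun _ => zero_le)
    fun n => ?_
  rw [edist_eq_enorm_sub]
  exact h n

theorem tendsto_inv_two_pow : Tendsto (fun n : ℕ => (2⁻¹ : ℝ≥0∞) ^ n) atTop (𝓝 0) :=
  ENNReal.tendsto_pow_atTop_nhds_zero_of_lt_one (by simp)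

section Profile

variable {d₀ : ℝ → ℝ} {L : ℝ}

/-- A Strichartz estimate. On the diagonal the quartic form is nonnegative, so the norm of its
integral over `s` is the integral of its norm, and the majorant bound applies; density and Fatou
extend it to `L²`. Supplying a majorant `m` avoids having to show that the quartic integral is
measurable in `s`. -/
theorem exists_lintegral_quartic_le (hL : 0 < L) (h : PiecewiseW11 d₀ L)
    (h' : BoundedAwayFromZero d₀ L) : ∃ C : ℝ≥0∞, C < ∞ ∧ ∀ f : L2, ∃ m : ℝ → ℝ≥0∞,
      AEMeasurable m (volume.restrict (Ioc 0 L)) ∧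
      (∀ s, quartic (freeEvolution (accDispersion d₀ s) f) ≤ m s) ∧
      ∫⁻ s in Ioc 0 L, m s ≤ C * ‖f‖ₑ ^ 4 := by
  obtain ⟨C, hC, hCb⟩ := exists_enorm_integral_evolvedQuad_le_fourier hL h h'
  have hD := decay_zero_lt_top
  have schw : ∀ φ : 𝓢(ℝ, ℂ), ∫⁻ s in Ioc 0 L, ‖evolvedQuad φ φ φ φ (accDispersion d₀ s)‖ₑ ≤
      C * (decay 0 * decay 0) * ‖φ.toLp 2 (volume : Measure ℝ)‖ₑ ^ 4 := fun φ => by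
    have iq := integrableOn_evolvedQuad hL h φ φ φ φ
    have e2 : ∫⁻ s in Ioc 0 L, ‖evolvedQuad φ φ φ φ (accDispersion d₀ s)‖ₑ =
        ‖∫ s in (0 : ℝ)..L, evolvedQuad φ φ φ φ (accDispersion d₀ s)‖ₑ := by
      have e3 : ∫ s in (0 : ℝ)..L, evolvedQuad φ φ φ φ (accDispersion d₀ s) =
          ((∫ s in Ioc 0 L, ‖evolvedQuad φ φ φ φ (accDispersion d₀ s)‖ : ℝ) : ℂ) := by
        rw [intervalIntegral.integral_of_le hL.le, ← integral_complex_ofReal]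
        exact integral_congr_ae (Eventually.of_forall fun s => evolvedQuad_self_eq_norm _ _)
      rw [e3, ← ofReal_norm, Complex.norm_real, Real.norm_eq_abs,
        abs_of_nonneg (integral_nonneg fun x => by positivity),
        ofReal_integral_eq_lintegral_ofReal iq.norm (Eventually.of_forall fun x => by positivity)]
      simp only [ofReal_norm]
    rw [e2, mul_assoc]
    refine (hCb φ φ φ φ).trans ?_
    gcongr
    have mφ : Measurable fun x => ‖(𝓕 φ : 𝓢(ℝ, ℂ)) x‖ₑ :=
      (𝓕 φ : 𝓢(ℝ, ℂ)).continuous.measurable.enorm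
    refine (majorant_le mφ mφ mφ mφ).trans_eq ?_
    rw [← enorm_toLp_eq_eLpNorm, ← SchwartzMap.toLp_fourier_eq, enorm_fourier_eq]
    ring
  refine ⟨C * (decay 0 * decay 0), ENNReal.mul_lt_top hC (ENNReal.mul_lt_top hD hD), fun f => ?_⟩
  obtain ⟨φ, hφ⟩ := exists_schwartz_approx f
  have mq : ∀ n, AEMeasurable (fun s => ‖evolvedQuad (φ n) (φ n) (φ n) (φ n) (accDispersion d₀ s)‖ₑ)
      (volume.restrict (Ioc 0 L)) := fun n =>
    (integrableOn_evolvedQuad hL h (φ n) (φ n) (φ n) (φ n)).aestronglyMeasurable.enorm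
  refine ⟨fun s => liminf (fun n =>
    ‖evolvedQuad (φ n) (φ n) (φ n) (φ n) (accDispersion d₀ s)‖ₑ) atTop, ?_,
    fun s => ?_, ?_⟩
  · simp only [liminf_eq_iSup_iInf_of_nat]
    exact AEMeasurable.iSup fun n => AEMeasurable.biInf _ (to_countable _) fun i _ => mq i
  · simp only [← quartic_freeEvolution_toLp]
    exact quartic_le_liminf fun n => by rw [enorm_freeEvolution_sub]; exact hφ n
  · refine (lintegral_liminf_le' mq).trans ?_
    have hconv : Tendsto (fun n => C * (decay 0 * decay 0) *
        ‖(φ n).toLp 2 (volume : Measure ℝ)‖ₑ ^ 4) atTop (𝓝 (C * (decay 0 * decay 0) * ‖f‖ₑ ^ 4)) := by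
      have h1 : Tendsto (fun n => (φ n).toLp 2 (volume : Measure ℝ)) atTop (𝓝 f) :=
        tendsto_of_enorm_sub_le hφ tendsto_inv_two_pow
      have h2 : Tendsto (fun n => ‖(φ n).toLp 2 (volume : Measure ℝ)‖ₑ ^ 4) atTop (𝓝 (‖f‖ₑ ^ 4)) :=
        (((ENNReal.continuous_pow 4).comp continuous_enorm).tendsto f).comp h1
      exact ENNReal.Tendsto.const_mul h2
        (Or.inr (ENNReal.mul_lt_top hC (ENNReal.mul_lt_top hD hD)).ne)
    rw [← hconv.liminf_eq]
    exact liminf_le_liminf (Eventually.of_forall fun n => schw (φ n))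

/-- Since `g` is Schwartz, `T_r g` is bounded uniformly in `r` by the `L¹` norm of `𝓕 g`. The change
of the cubic factor is then controlled by the `L²` error times quartic integrals, which the
Strichartz bound makes integrable over `s`. -/
theorem tendsto_calQ (hL : 0 < L) (h : PiecewiseW11 d₀ L) (h' : BoundedAwayFromZero d₀ L)
    (g : 𝓢(ℝ, ℂ)) {φ : ℕ → 𝓢(ℝ, ℂ)} {f : L2} (hφ : ∀ n, ‖(φ n).toLp 2 volume - f‖ₑ ≤ 2⁻¹ ^ n) :
    Tendsto (fun n => calQ d₀ L (g.toLp 2) ((φ n).toLp 2) ((φ n).toLp 2) ((φ n).toLp 2)) atTop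
      (𝓝 (calQ d₀ L (g.toLp 2) f f f)) := by
  obtain ⟨C, hC, hCm⟩ := exists_lintegral_quartic_le hL h h'
  obtain ⟨m, mm, hm, hmC⟩ := hCm f
  choose k mk hk hkC using fun n => hCm ((φ n).toLp 2)
  set K : ℝ := ∫ ξ, ‖(𝓕 g : 𝓢(ℝ, ℂ)) ξ‖ with hK
  set Q : L2 → ℝ → ℂ := fun u s => ∫ x : ℝ,
    conj (freeEvolution (accDispersion d₀ s) (g.toLp 2) x) * freeEvolution (accDispersion d₀ s) u x *
      conj (freeEvolution (accDispersion d₀ s) u x) * freeEvolution (accDispersion d₀ s) u x with hQ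
  set w : ℕ → ℝ → ℝ≥0∞ := fun n s =>
    ENNReal.ofReal K * (2 * (2⁻¹ ^ n * (2 + k n s + m s))) with hw
  have mw : ∀ n, AEMeasurable (w n) (volume.restrict (Ioc 0 L)) := fun n => by
    have := mk n
    fun_prop
  set B : ℝ≥0∞ := ENNReal.ofReal K * (2 * (2 * ENNReal.ofReal L + C * (‖f‖ₑ + 1) ^ 4 + C * ‖f‖ₑ ^ 4))
    with hB
  have hBt : B ≠ ∞ := by
    have h1 : C * (‖f‖ₑ + 1) ^ 4 ≠ ∞ := ENNReal.mul_ne_top hC.ne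
      (ENNReal.pow_ne_top (ENNReal.add_ne_top.2 ⟨enorm_ne_top, by simp⟩))
    have h2 : C * ‖f‖ₑ ^ 4 ≠ ∞ := ENNReal.mul_ne_top hC.ne (ENNReal.pow_ne_top enorm_ne_top)
    have h3 : 2 * ENNReal.ofReal L ≠ ∞ := ENNReal.mul_ne_top (by simp) ENNReal.ofReal_ne_top
    exact ENNReal.mul_ne_top ENNReal.ofReal_ne_top (ENNReal.mul_ne_top (by simp)
      (ENNReal.add_ne_top.2 ⟨ENNReal.add_ne_top.2 ⟨h3, h1⟩, h2⟩))
  have nφ : ∀ n, ‖(φ n).toLp 2 (volume : Measure ℝ)‖ₑ ≤ ‖f‖ₑ + 1 := fun n => by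
    calc ‖(φ n).toLp 2 (volume : Measure ℝ)‖ₑ = ‖f + ((φ n).toLp 2 volume - f)‖ₑ := by
          rw [add_sub_cancel]
      _ ≤ ‖f‖ₑ + ‖(φ n).toLp 2 volume - f‖ₑ := enorm_add_le _ _
      _ ≤ _ := by
          gcongr
          exact (hφ n).trans (pow_le_one₀ zero_le (by simp))
  have hwB : ∀ n, ∫⁻ s in Ioc 0 L, w n s ≤ 2⁻¹ ^ n * B := fun n => by
    have := mk n
    rw [lintegral_const_mul'' _ (by fun_prop), lintegral_const_mul'' _ (by fun_prop),
      lintegral_const_mul'' _ (by fun_prop), lintegral_add_right' _ mm, lintegral_add_left' (by fun_prop),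
      lintegral_const, Measure.restrict_apply_univ, Real.volume_Ioc, sub_zero]
    calc _ ≤ ENNReal.ofReal K * (2 * (2⁻¹ ^ n * (2 * ENNReal.ofReal L + C * (‖f‖ₑ + 1) ^ 4 +
          C * ‖f‖ₑ ^ 4))) := by
          gcongr
          exact (hkC n).trans (by gcongr; exact nφ n)
      _ = _ := by rw [hB]; ring
  have hsum : ∑' n, ∫⁻ s in Ioc 0 L, w n s ≠ ∞ := by
    refine ne_top_of_le_ne_top ?_ (ENNReal.tsum_le_tsum hwB)
    rw [ENNReal.tsum_mul_right, ENNReal.tsum_geometric]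
    exact ENNReal.mul_ne_top (by simp) hBt
  have bound : ∀ᵐ s ∂(volume.restrict (Ioc 0 L)), ∀ n, ‖Q ((φ n).toLp 2) s - Q f s‖ₑ ≤ w n s := by
    have h1 : ∀ᵐ s ∂(volume.restrict (Ioc 0 L)), m s < ∞ :=
      ae_lt_top' mm (hmC.trans_lt (ENNReal.mul_lt_top hC (ENNReal.pow_lt_top enorm_lt_top))).ne
    have h2 : ∀ᵐ s ∂(volume.restrict (Ioc 0 L)), ∀ n, k n s < ∞ := ae_all_iff.2 fun n =>
      ae_lt_top' (mk n) ((hkC n).trans_lt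
        (ENNReal.mul_lt_top hC (ENNReal.pow_lt_top enorm_lt_top))).ne
    filter_upwards [h1, h2] with s hs1 hs2 n
    refine (enorm_integral_cube_sub_le (K := K) (Lp.aestronglyMeasurable _) ?_ _ _
      ((hk n s).trans_lt (hs2 n)).ne ((hm s).trans_lt hs1).ne).trans ?_
    · rw [freeEvolution_toLp]
      filter_upwards [(evolve (accDispersion d₀ s) g).coeFn_toLp 2 volume] with x hx
      rw [hx]
      exact norm_evolve_le _ _ _
    · rw [enorm_freeEvolution_sub]
      simp only [hw]
      gcongr
      exacts [hφ n, hk n s, hm s]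
  have iQ : ∀ n, IntegrableOn (Q ((φ n).toLp 2)) (Ioc 0 L) := fun n => by
    refine (integrableOn_evolvedQuad hL h g (φ n) (φ n) (φ n)).congr (Eventually.of_forall fun s => ?_)
    simp only [evolvedQuad, hQ, freeEvolution_toLp]
    refine integral_congr_ae ?_
    filter_upwards [(evolve (accDispersion d₀ s) g).coeFn_toLp 2 volume,
      (evolve (accDispersion d₀ s) (φ n)).coeFn_toLp 2 volume] with x h1 h2
    rw [h1, h2]
  have lim : ∀ᵐ s ∂(volume.restrict (Ioc 0 L)),
      Tendsto (fun n => Q ((φ n).toLp 2) s) atTop (𝓝 (Q f s)) := by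
    filter_upwards [bound, ae_tendsto_zero_of_tsum mw hsum] with s hs1 hs2
    exact tendsto_of_enorm_sub_le hs1 hs2
  -- Measurability of the limit in `s` is inherited from the approximants.
  have mQ : AEStronglyMeasurable (Q f) (volume.restrict (Ioc 0 L)) :=
    aestronglyMeasurable_of_tendsto_ae atTop (fun n => (iQ n).aestronglyMeasurable) lim
  have hL1 : Tendsto (fun n => ∫⁻ s in Ioc 0 L, ‖Q ((φ n).toLp 2) s - Q f s‖ₑ) atTop (𝓝 0) := by
    refine tendsto_of_tendsto_of_tendsto_of_le_of_le tendsto_const_nhds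
      (ENNReal.tendsto_atTop_zero_of_tsum_ne_top hsum) (fun _ => zero_le) fun n => ?_
    refine lintegral_mono_ae ?_
    filter_upwards [bound] with s hs using hs n
  have := tendsto_integral_of_L1 (Q f) mQ (Eventually.of_forall iQ) hL1
  unfold calQ
  refine Tendsto.const_mul _ ?_
  simp only [intervalIntegral.integral_of_le hL.le]
  exact this

/-- One slot at a time is changed from `F + a` to `F`; each of the three errors contains `a` once,
and `‖a‖ ≤ 1` bounds the remaining slots by `‖F‖ + 1`. -/
theorem majorant_add_le {g F a : ℝ → ℝ≥0∞} (mg : Measurable g) (mF : Measurable F)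
    (ma : Measurable a) (ha : eLpNorm a 2 ≤ 1) :
    majorant g (F + a) (F + a) (F + a) ≤ majorant g F F F +
      eLpNorm a 2 * (3 * (decay 0 * decay 0 * eLpNorm g 2 * (eLpNorm F 2 + 1) ^ 2)) := by
  have mFa := mF.add ma
  have h1 : eLpNorm F 2 ≤ eLpNorm F 2 + 1 := le_self_add
  have h2 : eLpNorm (F + a) 2 ≤ eLpNorm F 2 + 1 :=
    (eLpNorm_add_le mF.aestronglyMeasurable ma.aestronglyMeasurable (by norm_num)).trans (by gcongr)
  rw [majorant_add₂ mg mF mFa mFa ma, majorant_add₃ mg mF mF mFa ma, majorant_add₄ mg mF mF mF ma,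
    add_assoc, add_assoc]
  gcongr
  calc _ ≤ decay 0 * decay 0 * (eLpNorm g 2 * (eLpNorm F 2 + 1) * (eLpNorm F 2 + 1) * eLpNorm a 2) +
        (decay 0 * decay 0 * (eLpNorm g 2 * (eLpNorm F 2 + 1) * eLpNorm a 2 * (eLpNorm F 2 + 1)) +
        decay 0 * decay 0 * (eLpNorm g 2 * eLpNorm a 2 * (eLpNorm F 2 + 1) * (eLpNorm F 2 + 1))) := by
        refine add_le_add ((majorant_le mg mF mF ma).trans ?_) (add_le_add
          ((majorant_le mg mF ma mFa).trans ?_) ((majorant_le mg ma mFa mFa).trans ?_)) <;> gcongr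
    _ = _ := by ring

theorem majorant_le_of_tendsto {C x : ℝ≥0∞} (hC : C ≠ ∞) {y : ℕ → ℝ≥0∞}
    (hy : Tendsto y atTop (𝓝 x)) {g : ℝ → ℝ≥0∞} (mg : Measurable g) (hg : eLpNorm g 2 ≠ ∞) {u : ℕ → L2}
    {f : L2} (hu : ∀ n, ‖u n - f‖ₑ ≤ 2⁻¹ ^ n)
    (h : ∀ n, y n ≤ C * majorant g (‖u n ·‖ₑ) (‖u n ·‖ₑ) (‖u n ·‖ₑ)) :
    x ≤ C * majorant g (‖f ·‖ₑ) (‖f ·‖ₑ) (‖f ·‖ₑ) := by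
  set F : ℝ → ℝ≥0∞ := fun x => ‖f x‖ₑ
  set a : ℕ → ℝ → ℝ≥0∞ := fun n x => ‖(u n - f : L2) x‖ₑ
  set A : ℝ≥0∞ := 3 * (decay 0 * decay 0 * eLpNorm g 2 * (eLpNorm F 2 + 1) ^ 2) with hA
  have ha : ∀ n, eLpNorm (a n) 2 ≤ 2⁻¹ ^ n := fun n => by
    simp only [a]; rw [eLpNorm_enorm, ← Lp.enorm_def]; exact hu n
  have hF : eLpNorm F 2 ≠ ∞ := by
    simp only [F]; rw [eLpNorm_enorm, ← Lp.enorm_def]; exact enorm_ne_top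
  have hAt : A ≠ ∞ := by
    have := decay_zero_lt_top.ne
    exact ENNReal.mul_ne_top (by simp) (ENNReal.mul_ne_top (ENNReal.mul_ne_top
      (ENNReal.mul_ne_top this this) hg) (ENNReal.pow_ne_top (ENNReal.add_ne_top.2 ⟨hF, by simp⟩)))
  have step : ∀ n, y n ≤ C * (majorant g F F F + 2⁻¹ ^ n * A) := fun n => by
    refine (h n).trans ?_
    gcongr
    have hle : ∀ᵐ x, ‖u n x‖ₑ ≤ (F + a n) x := by
      filter_upwards [Lp.coeFn_sub (u n) f] with x hx
      simp only [Pi.add_apply, F, a, hx, Pi.sub_apply]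
      calc ‖u n x‖ₑ = ‖f x + (u n x - f x)‖ₑ := by rw [add_sub_cancel]
        _ ≤ _ := enorm_add_le _ _
    -- The triangle inequality holds only almost everywhere; taking the minimum gives a
    -- representative for which it holds everywhere.
    have hae : (fun x => ‖u n x‖ₑ) =ᵐ[volume] fun x => min ‖u n x‖ₑ ((F + a n) x) := by
      filter_upwards [hle] with x hx using (min_eq_left hx).symm
    rw [majorant_congr_ae (EventuallyEq.refl _ g) hae hae hae]
    have hmin : (fun x => min ‖u n x‖ₑ ((F + a n) x)) ≤ F + a n := fun x => min_le_right _ _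
    refine (majorant_mono le_rfl hmin hmin hmin).trans ((majorant_add_le mg (measurable_enorm_L2 f)
      (measurable_enorm_L2 _) ((ha n).trans (pow_le_one₀ zero_le (by simp)))).trans ?_)
    gcongr
    exact ha n
  have lim : Tendsto (fun n : ℕ => C * (majorant g F F F + 2⁻¹ ^ n * A)) atTop
      (𝓝 (C * (majorant g F F F + 0 * A))) := by
    refine ENNReal.Tendsto.const_mul (tendsto_const_nhds.add
      (ENNReal.Tendsto.mul_const tendsto_inv_two_pow (Or.inr hAt))) (Or.inr hC)
  rw [zero_mul, add_zero] at lim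
  exact le_of_tendsto_of_tendsto' hy lim step

/-- The space and frequency bounds for Schwartz functions pass to `L²` in the last three slots; this
is where the two halves of the theorem become parallel. -/
theorem exists_enorm_calQ_le (hL : 0 < L) (h : PiecewiseW11 d₀ L) (h' : BoundedAwayFromZero d₀ L) :
    ∃ C : ℝ≥0∞, C < ∞ ∧ ∀ (g : 𝓢(ℝ, ℂ)) (f : L2),
      ‖calQ d₀ L (g.toLp 2) f f f‖ₑ ≤ C * majorant (‖g ·‖ₑ) (‖f ·‖ₑ) (‖f ·‖ₑ) (‖f ·‖ₑ) ∧
      ‖calQ d₀ L (g.toLp 2) f f f‖ₑ ≤ C * majorant (‖(𝓕 g : 𝓢(ℝ, ℂ)) ·‖ₑ) (‖(𝓕 f : L2) ·‖ₑ)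
        (‖(𝓕 f : L2) ·‖ₑ) (‖(𝓕 f : L2) ·‖ₑ) := by
  obtain ⟨C₁, hC₁, b₁⟩ := exists_enorm_integral_evolvedQuad_le_space hL h h'
  obtain ⟨C₂, hC₂, b₂⟩ := exists_enorm_integral_evolvedQuad_le_fourier hL h h'
  set c : ℝ≥0∞ := ‖(1 / (L : ℂ))‖ₑ
  have hC : c * (C₁ + C₂) < ∞ :=
    ENNReal.mul_lt_top enorm_lt_top (ENNReal.add_lt_top.2 ⟨hC₁, hC₂⟩)
  refine ⟨c * (C₁ + C₂), hC, fun g f => ?_⟩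
  obtain ⟨φ, hφ⟩ := exists_schwartz_approx f
  have lim := (continuous_enorm.tendsto _).comp (tendsto_calQ hL h h' g hφ)
  constructor
  · refine majorant_le_of_tendsto hC.ne lim g.continuous.measurable.enorm ?_ hφ fun n => ?_
    · rw [← enorm_toLp_eq_eLpNorm]; exact enorm_ne_top
    · have hae : (fun x => ‖(φ n).toLp 2 (volume : Measure ℝ) x‖ₑ) =ᵐ[volume] fun x => ‖φ n x‖ₑ := by
        filter_upwards [(φ n).coeFn_toLp 2 volume] with x hx using by rw [hx]
      rw [majorant_congr_ae (EventuallyEq.refl _ _) hae hae hae, Function.comp_apply, calQ_toLp,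
        enorm_mul, mul_assoc]
      gcongr
      refine (b₁ g (φ n) (φ n) (φ n)).trans ?_
      gcongr
      exact le_self_add
  · refine majorant_le_of_tendsto hC.ne lim (𝓕 g : 𝓢(ℝ, ℂ)).continuous.measurable.enorm ?_
      (u := fun n => (𝓕 (φ n) : 𝓢(ℝ, ℂ)).toLp 2) (fun n => ?_) fun n => ?_
    · rw [← enorm_toLp_eq_eLpNorm]; exact enorm_ne_top
    · have e1 : ∀ u v : L2, (𝓕 (u - v) : L2) = 𝓕 u - 𝓕 v :=
        map_sub (FourierTransform.fourierCLE ℂ L2)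
      rw [← SchwartzMap.toLp_fourier_eq, ← e1, enorm_fourier_eq]
      exact hφ n
    · have hae : (fun x => ‖(𝓕 (φ n) : 𝓢(ℝ, ℂ)).toLp 2 (volume : Measure ℝ) x‖ₑ) =ᵐ[volume]
          fun x => ‖(𝓕 (φ n) : 𝓢(ℝ, ℂ)) x‖ₑ := by
        filter_upwards [(𝓕 (φ n) : 𝓢(ℝ, ℂ)).coeFn_toLp 2 volume] with x hx using by rw [hx]
      rw [majorant_congr_ae (EventuallyEq.refl _ _) hae hae hae, Function.comp_apply, calQ_toLp,
        enorm_mul, mul_assoc]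
      gcongr
      refine (b₂ g (φ n) (φ n) (φ n)).trans ?_
      gcongr
      exact le_add_self

end Profile

/-! ### The weak equation tested with Schwartz functions -/

theorem memH1_toLp (g : 𝓢(ℝ, ℂ)) : MemH1 (g.toLp 2) := by
  rw [MemH1, Lp.toTemperedDistribution_toLp_eq]
  exact g.memSobolev

/-- The derivative of a Schwartz function. -/
def derivS (g : 𝓢(ℝ, ℂ)) : 𝓢(ℝ, ℂ) := SchwartzMap.derivCLM ℂ ℂ g

theorem derivS_apply (g : 𝓢(ℝ, ℂ)) (x : ℝ) : derivS g x = deriv g x := SchwartzMap.derivCLM_apply ℂ g x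

theorem hasDerivAt_schwartz (g : 𝓢(ℝ, ℂ)) (x : ℝ) : HasDerivAt g (derivS g x) x := by
  rw [derivS_apply]; exact g.differentiableAt.hasDerivAt

theorem weakDeriv_toLp (g : 𝓢(ℝ, ℂ)) : weakDeriv (g.toLp 2) = (derivS g).toLp 2 := by
  have h := (memH1_toLp g).isWeakDeriv
  rw [IsWeakDeriv, Lp.toTemperedDistribution_toLp_eq,
    TemperedDistribution.derivCLM_toTemperedDistributionCLM_eq (𝕜 := ℂ),
    ← Lp.toTemperedDistribution_toLp_eq (p := 2)] at h
  have hk := Lp.ker_toTemperedDistributionCLM_eq_bot (F := ℂ) (μ := (volume : Measure ℝ)) (p := 2)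
  exact (LinearMap.ker_eq_bot.1 hk h).symm

theorem inner_toLp (v : 𝓢(ℝ, ℂ)) (f : L2) : ⟪v.toLp 2, f⟫ = ∫ x, conj (v x) * f x := by
  rw [L2.inner_def]
  refine integral_congr_ae ?_
  filter_upwards [v.coeFn_toLp 2 volume] with x hx
  rw [hx, RCLike.inner_apply, mul_comm]

/-- The complex conjugate of a Schwartz function. -/
def conjS (g : 𝓢(ℝ, ℂ)) : 𝓢(ℝ, ℂ) :=
  SchwartzMap.postcompCLM (𝕜 := ℝ) (Complex.conjCLE : ℂ →L[ℝ] ℂ) g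

theorem conjS_apply (g : 𝓢(ℝ, ℂ)) (x : ℝ) : conjS g x = conj (g x) := by
  rw [conjS, SchwartzMap.postcompCLM_apply]; simp

/-- The distributional pairing is bilinear and the inner product conjugates its first entry, so the
test function is the conjugate of `v`. -/
theorem inner_derivS {f f' : L2} (h : IsWeakDeriv f f') (v : 𝓢(ℝ, ℂ)) :
    ⟪v.toLp 2, f'⟫ = -⟪(derivS v).toLp 2, f⟫ := by
  have h1 := DFunLike.congr_fun h (conjS v)
  rw [TemperedDistribution.derivCLM_apply_apply, Lp.toTemperedDistribution_apply,
    Lp.toTemperedDistribution_apply] at h1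
  have hd : ∀ x, (SchwartzMap.derivCLM ℂ ℂ (conjS v)) x = conj (derivS v x) := fun x => by
    rw [SchwartzMap.derivCLM_apply]
    have h2 : HasDerivAt (conjS v) (conj (derivS v x)) x := by
      have := (hasDerivAt_schwartz v x).star
      have e : (conjS v : ℝ → ℂ) = fun x => star (v x) := funext (conjS_apply v)
      rw [e]
      exact this
    exact h2.deriv
  rw [inner_toLp, inner_toLp]
  simp only [neg_apply, hd, conjS_apply, smul_eq_mul, neg_mul, integral_neg] at h1
  exact h1.symm

theorem IsWeakSolution.calQ_eq {d₀ : ℝ → ℝ} {L dav ω : ℝ} (hdav : 0 ≤ dav) {f : L2}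
    (hf : IsWeakSolution d₀ L dav ω f) (g : 𝓢(ℝ, ℂ)) :
    calQ d₀ L (g.toLp 2) f f f =
      ⟪((ω : ℂ) • g - (dav : ℂ) • derivS (derivS g)).toLp 2, f⟫ := by
  have h1 := hf.eq _ (memH1_toLp g)
  have e1 : ((ω : ℂ) • g - (dav : ℂ) • derivS (derivS g)).toLp 2 (volume : Measure ℝ) =
      (ω : ℂ) • g.toLp 2 volume - (dav : ℂ) • (derivS (derivS g)).toLp 2 volume := by
    simp only [← SchwartzMap.toLpCLM_apply (𝕜 := ℂ), map_sub, map_smul]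
  rw [e1, inner_sub_left, inner_smul_left, inner_smul_left, Complex.conj_ofReal, Complex.conj_ofReal]
  -- If `dav = 0`, then `f` need not be in `H¹` and `weakDeriv f` may be the default value, but it
  -- is multiplied by zero.
  rcases hdav.eq_or_lt with h0 | h0
  · subst h0
    simp only [Complex.ofReal_zero, zero_mul, sub_zero] at h1 ⊢
    linear_combination h1
  · rw [weakDeriv_toLp, inner_derivS (hf.memH1 h0).isWeakDeriv] at h1
    linear_combination h1

/-! ### The resolvent -/

theorem fourier_derivS (g : 𝓢(ℝ, ℂ)) (ξ : ℝ) :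
    (𝓕 (derivS g) : 𝓢(ℝ, ℂ)) ξ = 2 * Real.pi * Complex.I * ξ * (𝓕 g : 𝓢(ℝ, ℂ)) ξ := by
  have e : (derivS g : ℝ → ℂ) = deriv g := funext (derivS_apply g)
  have hi : Integrable (deriv g) := by rw [← e]; exact (derivS g).integrable
  rw [SchwartzMap.fourier_coe, SchwartzMap.fourier_coe, e,
    Real.fourier_deriv g.integrable g.differentiable hi]
  simp only [smul_eq_mul]

theorem exists_resolvent {dav ω : ℝ} (hdav : 0 ≤ dav) (hω : 0 < ω) (u : 𝓢(ℝ, ℂ)) :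
    ∃ g : 𝓢(ℝ, ℂ), (ω : ℂ) • g - (dav : ℂ) • derivS (derivS g) = u ∧
      ∀ ξ, ‖(𝓕 g : 𝓢(ℝ, ℂ)) ξ‖ ≤ ω⁻¹ * ‖(𝓕 u : 𝓢(ℝ, ℂ)) ξ‖ := by
  -- With this `c`, `ω (1 + |cξ|²) = ω + dav (2πξ)²`, so the inverse symbol is a rescaled Japanese
  -- bracket, which is known to have temperate growth. The case `dav = 0` is `c = 0`.
  set c : ℝ := 2 * Real.pi * √(dav / ω) with hc
  set m : ℝ → ℝ := fun ξ => ω⁻¹ * (1 + ‖c * ξ‖ ^ 2) ^ (-1 : ℝ) with hm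
  have hmt : Function.HasTemperateGrowth m := by
    have h1 := Function.hasTemperateGrowth_one_add_norm_sq_rpow ℝ (-1)
    have h2 : Function.HasTemperateGrowth fun ξ : ℝ => c * ξ :=
      (Function.HasTemperateGrowth.const c).mul Function.HasTemperateGrowth.id'
    exact (Function.HasTemperateGrowth.const ω⁻¹).mul (h1.comp h2)
  have hcx : ∀ ξ, 1 + ‖c * ξ‖ ^ 2 = (ω + dav * (2 * Real.pi * ξ) ^ 2) / ω := fun ξ => by
    rw [Real.norm_eq_abs, sq_abs, hc]
    have : √(dav / ω) ^ 2 = dav / ω := Real.sq_sqrt (by positivity)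
    have e : (2 * Real.pi * √(dav / ω) * ξ) ^ 2 = √(dav / ω) ^ 2 * (2 * Real.pi * ξ) ^ 2 := by ring
    rw [e, this]
    field_simp
  have hpos : ∀ ξ, 0 < ω + dav * (2 * Real.pi * ξ) ^ 2 := fun ξ => by positivity
  have hmx : ∀ ξ, m ξ = (ω + dav * (2 * Real.pi * ξ) ^ 2)⁻¹ := fun ξ => by
    simp only [hm]
    rw [Real.rpow_neg_one, hcx, inv_div]
    field_simp
  set g : 𝓢(ℝ, ℂ) := 𝓕⁻ (SchwartzMap.smulLeftCLM ℂ m (𝓕 u)) with hg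
  have hFg : ∀ ξ, (𝓕 g : 𝓢(ℝ, ℂ)) ξ = (m ξ : ℂ) * (𝓕 u : 𝓢(ℝ, ℂ)) ξ := fun ξ => by
    rw [hg, FourierTransform.fourier_fourierInv_eq, SchwartzMap.smulLeftCLM_apply_apply hmt,
      Complex.real_smul]
  refine ⟨g, ?_, fun ξ => ?_⟩
  · have hF : (𝓕 ((ω : ℂ) • g - (dav : ℂ) • derivS (derivS g)) : 𝓢(ℝ, ℂ)) = 𝓕 u := by
      have hl : (𝓕 ((ω : ℂ) • g - (dav : ℂ) • derivS (derivS g)) : 𝓢(ℝ, ℂ)) =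
          (ω : ℂ) • 𝓕 g - (dav : ℂ) • 𝓕 (derivS (derivS g)) := by
        simp only [← FourierTransform.fourierCLE_apply (R := ℂ), map_sub, map_smul]
      rw [hl]
      ext ξ
      rw [sub_apply, smul_apply, smul_apply, fourier_derivS,
        fourier_derivS, hFg, hmx, smul_eq_mul, smul_eq_mul]
      have h0 : (ω + dav * (2 * Real.pi * ξ) ^ 2 : ℂ) ≠ 0 := by
        have := (hpos ξ).ne'
        exact_mod_cast this
      have h1 := inv_mul_cancel₀ h0
      push_cast
      linear_combination (𝓕 u : 𝓢(ℝ, ℂ)) ξ * h1 - 4 * dav * Real.pi ^ 2 * ξ ^ 2 *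
        ((ω + dav * (2 * Real.pi * ξ) ^ 2 : ℂ)⁻¹ * (𝓕 u : 𝓢(ℝ, ℂ)) ξ) * Complex.I_sq
    rw [← FourierTransform.fourierInv_fourier_eq (F := 𝓢(ℝ, ℂ)) u, ← hF,
      FourierTransform.fourierInv_fourier_eq]
  · rw [hFg, norm_mul, Complex.norm_real, hmx, Real.norm_eq_abs, abs_of_pos (inv_pos.2 (hpos ξ))]
    gcongr
    nlinarith [mul_nonneg hdav (sq_nonneg (2 * Real.pi * ξ))]

/-- The integrand is the derivative of `-e^{-ay}(h' + a h)`, which vanishes at infinity. -/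
theorem integral_exp_mul_eq {a : ℝ} (ha : 0 < a) (h : 𝓢(ℝ, ℂ)) :
    ∫ y in Ioi (0 : ℝ), (Real.exp (-a * y) : ℂ) * ((a : ℂ) ^ 2 * h y - derivS (derivS h) y) =
      derivS h 0 + a * h 0 := by
  have hd : ∀ y : ℝ, HasDerivAt
      (fun y : ℝ => -(((Real.exp (-a * y) : ℝ) : ℂ) * (derivS h y + a * h y)))
      ((Real.exp (-a * y) : ℂ) * ((a : ℂ) ^ 2 * h y - derivS (derivS h) y)) y := fun y => by
    have h1 : HasDerivAt (fun y : ℝ => ((Real.exp (-a * y) : ℝ) : ℂ))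
        ((Real.exp (-a * y) * (-a) : ℝ) : ℂ) y := by
      have := ((hasDerivAt_id' y).const_mul (-a)).exp
      rw [mul_one] at this
      exact this.ofReal_comp
    refine (h1.fun_mul ((hasDerivAt_schwartz (derivS h) y).fun_add
      ((hasDerivAt_schwartz h y).const_mul (a : ℂ)))).fun_neg.congr_deriv ?_
    push_cast
    ring
  have lim0 : ∀ φ : 𝓢(ℝ, ℂ), Tendsto φ atTop (𝓝 0) := fun φ =>
    φ.tendsto_cocompact.mono_left atTop_le_cocompact
  have hb : ∀ y : ℝ, 0 ≤ y → ‖((Real.exp (-a * y) : ℝ) : ℂ)‖ ≤ 1 := fun y hy => by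
    rw [Complex.norm_real, Real.norm_eq_abs, abs_of_pos (Real.exp_pos _), Real.exp_le_one_iff]
    nlinarith
  have lim : Tendsto (fun y : ℝ => -(((Real.exp (-a * y) : ℝ) : ℂ) * (derivS h y + a * h y))) atTop
      (𝓝 0) := by
    have h1 : Tendsto (fun y => derivS h y + a * h y) atTop (𝓝 0) := by
      simpa using (lim0 (derivS h)).add ((lim0 h).const_mul (a : ℂ))
    rw [← neg_zero]
    refine Tendsto.neg (squeeze_zero_norm' ?_ (by simpa using h1.norm))
    · filter_upwards [eventually_ge_atTop 0] with y hy
      rw [norm_mul]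
      exact mul_le_of_le_one_left (norm_nonneg _) (hb y hy)
  have hint : IntegrableOn (fun y : ℝ => (Real.exp (-a * y) : ℂ) *
      ((a : ℂ) ^ 2 * h y - derivS (derivS h) y)) (Ioi 0) := by
    have h1 : IntegrableOn (fun y : ℝ => (a : ℂ) ^ 2 * h y - derivS (derivS h) y) (Ioi 0) :=
      ((h.integrable.const_mul _).sub (derivS (derivS h)).integrable).integrableOn
    refine h1.bdd_mul (c := 1) (by fun_prop : Continuous _).aestronglyMeasurable ?_
    filter_upwards [ae_restrict_mem measurableSet_Ioi] with y hy using hb y (mem_Ioi.1 hy).le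
  have := integral_Ioi_of_hasDerivAt_of_tendsto (hd 0).continuousAt.continuousWithinAt
    (fun y _ => hd y) hint lim
  rw [this]
  simp

/-- The Schwartz function `y ↦ g (x + σ y)`. -/
def reflectS (g : 𝓢(ℝ, ℂ)) (x : ℝ) {σ : ℝ} (hσ : σ ≠ 0) : 𝓢(ℝ, ℂ) :=
  SchwartzMap.compCLMOfAntilipschitz ℂ (K := ‖σ‖₊⁻¹) (g := fun y => x + σ * y)
    (by fun_prop) (by
      refine AntilipschitzWith.of_le_mul_dist fun y z => ?_
      rw [Real.dist_eq, Real.dist_eq]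
      have : x + σ * y - (x + σ * z) = σ * (y - z) := by ring
      rw [this, abs_mul]
      simp [hσ]) g

theorem reflectS_apply (g : 𝓢(ℝ, ℂ)) (x : ℝ) {σ : ℝ} (hσ : σ ≠ 0) (y : ℝ) :
    reflectS g x hσ y = g (x + σ * y) := rfl

theorem derivS_reflectS (g : 𝓢(ℝ, ℂ)) (x : ℝ) {σ : ℝ} (hσ : σ ≠ 0) :
    derivS (reflectS g x hσ) = (σ : ℂ) • reflectS (derivS g) x hσ := by
  ext y
  rw [derivS_apply, smul_apply, reflectS_apply, smul_eq_mul]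
  have h1 : HasDerivAt (fun y => x + σ * y) σ y := by
    simpa using ((hasDerivAt_id' y).const_mul σ).const_add x
  have := (hasDerivAt_schwartz g (x + σ * y)).scomp y h1
  rw [Complex.real_smul] at this
  exact this.deriv

theorem integral_exp_mul_resolvent_eq {dav ω a : ℝ} (ha : 0 < a)
    (haω : dav * a ^ 2 = ω) {g u : 𝓢(ℝ, ℂ)}
    (hgu : (ω : ℂ) • g - (dav : ℂ) • derivS (derivS g) = u) (x : ℝ) {σ : ℝ} (hσ : σ ^ 2 = 1) :
    ∫ y in Ioi (0 : ℝ), (Real.exp (-a * y) : ℂ) * u (x + σ * y) =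
      dav * (σ * derivS g x + a * g x) := by
  have hσ0 : σ ≠ 0 := fun h => by rw [h] at hσ; norm_num at hσ
  have h := integral_exp_mul_eq ha (reflectS g x hσ0)
  have hd2 : derivS (derivS (reflectS g x hσ0)) = reflectS (derivS (derivS g)) x hσ0 := by
    have hs : ∀ v : 𝓢(ℝ, ℂ), derivS ((σ : ℂ) • v) = (σ : ℂ) • derivS v := fun v =>
      map_smul (SchwartzMap.derivCLM ℂ ℂ) _ _
    rw [derivS_reflectS, hs, derivS_reflectS, smul_smul]
    have : (σ : ℂ) * σ = 1 := by rw [← pow_two]; exact_mod_cast hσ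
    rw [this, one_smul]
  rw [hd2, derivS_reflectS] at h
  simp only [smul_apply, reflectS_apply, smul_eq_mul, mul_zero, add_zero] at h
  rw [← h, ← integral_const_mul]
  refine integral_congr_ae (Eventually.of_forall fun y => ?_)
  simp only [← hgu, sub_apply, smul_apply, smul_eq_mul, ← haω]
  push_cast
  ring

/-! ### The resolvent as convolution with an exponential kernel -/

/-- The exponential measure `e^{-a y} dy` on the half-line. -/
def expMeasure (a : ℝ) : Measure ℝ :=
  (volume.restrict (Ioi (0 : ℝ))).withDensity fun y => ENNReal.ofReal (Real.exp (-a * y))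

instance (a : ℝ) : SFinite (expMeasure a) := by unfold expMeasure; infer_instance

theorem lintegral_expMeasure (a : ℝ) {h : ℝ → ℝ≥0∞} (mh : Measurable h) :
    ∫⁻ y, h y ∂(expMeasure a) = ∫⁻ y in Ioi (0 : ℝ), ENNReal.ofReal (Real.exp (-a * y)) * h y :=
  lintegral_withDensity_eq_lintegral_mul _ (by fun_prop) mh

/-- A multiple of `e^{-a |y|} dy`. -/
def twoSidedExpMeasure (c : ℝ≥0∞) (a : ℝ) : Measure ℝ :=
  c • (expMeasure a + (expMeasure a).map fun y => -y)

instance (c : ℝ≥0∞) (a : ℝ) : SFinite (twoSidedExpMeasure c a) := by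
  unfold twoSidedExpMeasure; infer_instance

theorem lintegral_twoSidedExpMeasure (c : ℝ≥0∞) (a : ℝ) {h : ℝ → ℝ≥0∞} (mh : Measurable h) :
    ∫⁻ y, h y ∂(twoSidedExpMeasure c a) =
      c * ((∫⁻ y in Ioi (0 : ℝ), ENNReal.ofReal (Real.exp (-a * y)) * h y) +
        ∫⁻ y in Ioi (0 : ℝ), ENNReal.ofReal (Real.exp (-a * y)) * h (-y)) := by
  rw [twoSidedExpMeasure, lintegral_smul_measure, lintegral_add_measure,
    lintegral_map mh (by fun_prop), lintegral_expMeasure a mh,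
    lintegral_expMeasure a (h := fun y => h (-y)) (mh.comp measurable_neg), smul_eq_mul]

/-- For `dav > 0` the Green's function is `e^{-a|y|}/(2a dav)` with `a = √(ω/dav)`, and the rate
`a/2` leaves a finite exponential moment. For `dav = 0` the resolvent is division by `ω`, a point
mass at zero. -/
theorem exists_resolvent_kernel {dav ω : ℝ} (hdav : 0 ≤ dav) (hω : 0 < ω) :
    ∃ ρ : Measure ℝ, SFinite ρ ∧ ∃ μ₀ : ℝ, 0 < μ₀ ∧
      ∫⁻ y, ENNReal.ofReal (Real.exp (μ₀ * |y|)) ∂ρ < ∞ ∧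
      ∀ g u : 𝓢(ℝ, ℂ), (ω : ℂ) • g - (dav : ℂ) • derivS (derivS g) = u →
        ∀ x, ‖g x‖ₑ ≤ convMeasure ρ (‖u ·‖ₑ) x := by
  rcases hdav.eq_or_lt with h0 | h0
  · subst h0
    refine ⟨ENNReal.ofReal ω⁻¹ • Measure.dirac 0, inferInstance, 1, one_pos, ?_, fun g u hgu x => ?_⟩
    · rw [lintegral_smul_measure, lintegral_dirac]
      simp
    · rw [convMeasure, lintegral_smul_measure, lintegral_dirac, sub_zero, ← hgu]
      simp only [Complex.ofReal_zero, zero_smul, sub_zero, smul_apply, smul_eq_mul, enorm_mul]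
      rw [← mul_assoc, ← ofReal_norm (ω : ℂ), Complex.norm_real, Real.norm_eq_abs, abs_of_pos hω,
        ← ENNReal.ofReal_mul (by positivity), inv_mul_cancel₀ hω.ne', ENNReal.ofReal_one, one_mul]
  · set a : ℝ := √(ω / dav) with ha'
    have ha : 0 < a := Real.sqrt_pos.2 (by positivity)
    have haω : dav * a ^ 2 = ω := by rw [Real.sq_sqrt (by positivity)]; field_simp
    set c : ℝ := (2 * a * dav)⁻¹ with hc
    have hc0 : 0 < c := by positivity
    refine ⟨twoSidedExpMeasure (ENNReal.ofReal c) a, inferInstance, a / 2, by positivity, ?_,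
      fun g u hgu x => ?_⟩
    · have hfin : ∫⁻ y in Ioi (0 : ℝ), ENNReal.ofReal (Real.exp (-a * y)) *
          ENNReal.ofReal (Real.exp (a / 2 * |y|)) < ∞ := by
        have hi := (exp_neg_integrableOn_Ioi 0 (b := a / 2) (by positivity)).lintegral_lt_top
        refine lt_of_le_of_lt (setLIntegral_mono' measurableSet_Ioi fun y hy => ?_) hi
        rw [← ENNReal.ofReal_mul (Real.exp_pos _).le, ← Real.exp_add, abs_of_pos hy]
        refine ENNReal.ofReal_le_ofReal (Real.exp_le_exp.2 (le_of_eq ?_))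
        ring
      rw [lintegral_twoSidedExpMeasure _ _ (by fun_prop)]
      simp only [abs_neg]
      exact ENNReal.mul_lt_top ENNReal.ofReal_lt_top (ENNReal.add_lt_top.2 ⟨hfin, hfin⟩)
    · have h1 := integral_exp_mul_resolvent_eq ha haω hgu x (σ := 1) (by norm_num)
      have h2 := integral_exp_mul_resolvent_eq ha haω hgu x (σ := -1) (by norm_num)
      -- Adding the half-line formulas for `σ = 1` and `σ = -1` cancels `g'` and leaves `2 a dav g`.
      have hg : g x = (c : ℂ) * ((∫ y in Ioi (0 : ℝ), (Real.exp (-a * y) : ℂ) * u (x + -1 * y)) +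
          ∫ y in Ioi (0 : ℝ), (Real.exp (-a * y) : ℂ) * u (x + 1 * y)) := by
        rw [h1, h2, hc]
        have h3 : (a : ℂ) ≠ 0 := by exact_mod_cast ha.ne'
        have h4 : (dav : ℂ) ≠ 0 := by exact_mod_cast h0.ne'
        push_cast
        field_simp
        ring
      have mu : Measurable fun y => ‖u (x - y)‖ₑ :=
        (u.continuous.comp (by fun_prop : Continuous fun y => x - y)).measurable.enorm
      rw [convMeasure, lintegral_twoSidedExpMeasure _ _ mu, hg, enorm_mul]
      have hce : ‖(c : ℂ)‖ₑ = ENNReal.ofReal c := by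
        rw [← ofReal_norm, Complex.norm_real, Real.norm_eq_abs, abs_of_pos hc0]
      rw [hce]
      gcongr
      refine (enorm_add_le _ _).trans (add_le_add ?_ ?_)
      all_goals
        refine (enorm_integral_le_lintegral_enorm _).trans (lintegral_mono fun y => ?_)
        rw [enorm_mul, ← ofReal_norm (_ : ℂ), Complex.norm_real, Real.norm_eq_abs,
          abs_of_pos (Real.exp_pos _)]
      · rw [neg_one_mul, ← sub_eq_add_neg]
      · rw [one_mul, sub_neg_eq_add]

/-! ### Exponential decay from testing with Schwartz functions -/

theorem measurable_convMeasure (ρ : Measure ℝ) [SFinite ρ] {h : ℝ → ℝ≥0∞} (mh : Measurable h) :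
    Measurable (convMeasure ρ h) :=
  Measurable.lintegral_prod_right (f := fun (x y : ℝ) => h (x - y)) (by fun_prop)

theorem eLpNorm_convMeasure_le (ρ : Measure ℝ) [SFinite ρ] {h : ℝ → ℝ≥0∞} (mh : Measurable h) :
    eLpNorm (convMeasure ρ h) 2 ≤ ρ univ * eLpNorm h 2 := by
  have := eLpNorm_weighted_conv_le ρ (g := fun _ => 1) measurable_const mh
  simpa [convMeasure, Function.comp_def] using! this

/-- `ρ` may have atoms, so null sets cannot be ignored for fixed `x`. Young's inequality shows that
an almost everywhere vanishing function has an almost everywhere vanishing convolution. -/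
theorem convMeasure_mono_ae (ρ : Measure ℝ) [SFinite ρ] {h₁ h₂ : ℝ → ℝ≥0∞}
    (m₁ : Measurable h₁) (m₂ : Measurable h₂) (h : h₁ ≤ᵐ[volume] h₂) :
    convMeasure ρ h₁ ≤ᵐ[volume] convMeasure ρ h₂ := by
  set d : ℝ → ℝ≥0∞ := fun x => h₁ x - h₂ x with hd
  have md : Measurable d := m₁.sub m₂
  have hd0 : d =ᵐ[volume] 0 := by
    filter_upwards [h] with x hx using tsub_eq_zero_of_le hx
  have hc : convMeasure ρ d =ᵐ[volume] 0 := by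
    have h0 : eLpNorm d 2 = 0 := by rw [eLpNorm_congr_ae hd0, eLpNorm_zero]
    have h1 := eLpNorm_convMeasure_le ρ md
    rw [h0, mul_zero, nonpos_iff_eq_zero, ← pow_eq_zero_iff two_ne_zero, eLpNorm_two_sq,
      lintegral_eq_zero_iff ((measurable_convMeasure ρ md).pow_const 2)] at h1
    filter_upwards [h1] with x hx using by simpa using hx
  filter_upwards [hc] with x hx
  have m₂x : Measurable fun y => h₂ (x - y) := m₂.comp (by fun_prop : Measurable fun y => x - y)
  calc convMeasure ρ h₁ x ≤ ∫⁻ y, (h₂ (x - y) + d (x - y)) ∂ρ :=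
        lintegral_mono fun y => le_add_tsub
    _ = convMeasure ρ h₂ x + convMeasure ρ d x := lintegral_add_left m₂x _
    _ = convMeasure ρ h₂ x := by rw [hx]; simp

/-- Density extends the hypothesis to all `v` in `L²`; a test function with the phase of `w` then
turns the inner product into the integral of `h |w|` required by `exists_exponential_decay`. -/
theorem exists_exponential_decay_of_schwartz (w : L2) (ρ : Measure ℝ) [SFinite ρ] {μ₀ : ℝ}
    (hμ₀ : 0 < μ₀) (hρ : ∫⁻ y, ENNReal.ofReal (Real.exp (μ₀ * |y|)) ∂ρ < ∞) {C : ℝ≥0∞} (hC : C < ∞)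
    (hS : ∀ v : 𝓢(ℝ, ℂ), ‖⟪v.toLp 2, w⟫‖ₑ ≤
      C * majorant (convMeasure ρ (‖v ·‖ₑ)) (‖w ·‖ₑ) (‖w ·‖ₑ) (‖w ·‖ₑ)) :
    ∃ μ : ℝ, 0 < μ ∧
      eLpNorm (fun x => ENNReal.ofReal (Real.exp (μ * |x|)) * ‖w x‖ₑ) 2 < ∞ := by
  have mw := measurable_enorm_L2 w
  have hw : eLpNorm (fun x => ‖w x‖ₑ) 2 < ∞ := by
    rw [eLpNorm_enorm, ← Lp.enorm_def]; exact enorm_lt_top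
  have hρf : ρ univ < ∞ := by
    refine lt_of_le_of_lt ?_ hρ
    rw [← lintegral_one]
    refine lintegral_mono fun y => ?_
    rw [ENNReal.one_le_ofReal, Real.one_le_exp_iff]
    positivity
  have hL2 : ∀ v : L2, ‖⟪v, w⟫‖ₑ ≤
      C * majorant (convMeasure ρ (‖v ·‖ₑ)) (‖w ·‖ₑ) (‖w ·‖ₑ) (‖w ·‖ₑ) := fun v => by
    obtain ⟨φ, hφ⟩ := exists_schwartz_approx v
    have mv := measurable_enorm_L2 v
    set A : ℝ≥0∞ := decay 0 * decay 0 * (ρ univ * eLpNorm (fun x => ‖w x‖ₑ) 2 ^ 3) with hA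
    have hAt : A ≠ ∞ := by
      have := decay_zero_lt_top
      exact (ENNReal.mul_lt_top (ENNReal.mul_lt_top this this)
        (ENNReal.mul_lt_top hρf (ENNReal.pow_lt_top hw))).ne
    have step : ∀ n, ‖⟪(φ n).toLp 2, w⟫‖ₑ ≤ C * (majorant (convMeasure ρ (‖v ·‖ₑ)) (‖w ·‖ₑ)
        (‖w ·‖ₑ) (‖w ·‖ₑ) + 2⁻¹ ^ n * A) := fun n => by
      refine (hS (φ n)).trans ?_
      gcongr
      set d : ℝ → ℝ≥0∞ := fun x => ‖φ n x - v x‖ₑ with hd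
      have md : Measurable d :=
        ((φ n).continuous.measurable.sub (Lp.stronglyMeasurable v).measurable).enorm
      have nd : eLpNorm d 2 ≤ 2⁻¹ ^ n := by
        refine le_trans (le_of_eq ?_) (hφ n)
        rw [Lp.enorm_def, hd, eLpNorm_enorm]
        refine eLpNorm_congr_ae ?_
        filter_upwards [Lp.coeFn_sub ((φ n).toLp 2 volume) v, (φ n).coeFn_toLp 2 volume] with x h1 h2
        rw [h1, Pi.sub_apply, h2]
      have hle : convMeasure ρ (‖φ n ·‖ₑ) ≤ convMeasure ρ (‖v ·‖ₑ) + convMeasure ρ d := fun x => by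
        simp only [Pi.add_apply, convMeasure]
        have mvx : Measurable fun y => ‖v (x - y)‖ₑ :=
          mv.comp (by fun_prop : Measurable fun y => x - y)
        rw [← lintegral_add_left mvx]
        refine lintegral_mono fun y => ?_
        calc ‖φ n (x - y)‖ₑ = ‖v (x - y) + (φ n (x - y) - v (x - y))‖ₑ := by rw [add_sub_cancel]
          _ ≤ _ := enorm_add_le _ _
      refine (majorant_mono hle le_rfl le_rfl le_rfl).trans ?_
      rw [majorant_add₁ (measurable_convMeasure ρ mv) mw mw mw (measurable_convMeasure ρ md)]
      gcongr
      refine (majorant_le (measurable_convMeasure ρ md) mw mw mw).trans ?_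
      calc _ ≤ decay 0 * decay 0 * ((ρ univ * 2⁻¹ ^ n) * eLpNorm (fun x => ‖w x‖ₑ) 2 *
            eLpNorm (fun x => ‖w x‖ₑ) 2 * eLpNorm (fun x => ‖w x‖ₑ) 2) := by
            gcongr
            exact (eLpNorm_convMeasure_le ρ md).trans (by gcongr)
        _ = _ := by rw [hA]; ring
    have lim1 : Tendsto (fun n => ‖⟪(φ n).toLp 2, w⟫‖ₑ) atTop (𝓝 ‖⟪v, w⟫‖ₑ) := by
      have h1 := tendsto_of_enorm_sub_le hφ tendsto_inv_two_pow
      have h2 : Continuous fun v : L2 => ‖⟪v, w⟫‖ₑ :=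
        continuous_enorm.comp (continuous_id.inner continuous_const)
      exact (h2.tendsto v).comp h1
    have lim2 : Tendsto (fun n : ℕ => C * (majorant (convMeasure ρ (‖v ·‖ₑ)) (‖w ·‖ₑ)
        (‖w ·‖ₑ) (‖w ·‖ₑ) + 2⁻¹ ^ n * A)) atTop (𝓝 (C * (majorant (convMeasure ρ (‖v ·‖ₑ)) (‖w ·‖ₑ)
        (‖w ·‖ₑ) (‖w ·‖ₑ) + 0 * A))) :=
      ENNReal.Tendsto.const_mul (tendsto_const_nhds.add
        (ENNReal.Tendsto.mul_const tendsto_inv_two_pow (Or.inr hAt))) (Or.inr hC.ne)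
    rw [zero_mul, add_zero] at lim2
    exact le_of_tendsto_of_tendsto' lim1 lim2 step
  refine exists_exponential_decay mw hw ρ hμ₀ hρ hC fun h mh hh => ?_
  -- Where `w` vanishes the quotient is `0`, and where `h` is infinite `toReal` is `0`; the first
  -- costs nothing and the second happens on a null set.
  set v₀ : ℝ → ℂ := fun x => ((h x).toReal : ℂ) * (w x / (‖w x‖ : ℂ)) with hv₀
  have mw' : Measurable fun x => w x := (Lp.stronglyMeasurable w).measurable
  have mv₀ : Measurable v₀ := by fun_prop
  have nv₀ : ∀ x, ‖v₀ x‖ₑ ≤ h x := fun x => by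
    rw [hv₀, ← ofReal_norm, norm_mul, norm_div, Complex.norm_real, Complex.norm_real, norm_norm,
      Real.norm_eq_abs, abs_of_nonneg ENNReal.toReal_nonneg]
    refine (ENNReal.ofReal_le_ofReal (mul_le_of_le_one_right ENNReal.toReal_nonneg
      (div_self_le_one _))).trans ENNReal.ofReal_toReal_le
  have hmem : MemLp v₀ 2 volume := by
    refine ⟨mv₀.aestronglyMeasurable, lt_of_le_of_lt ?_ hh⟩
    rw [← eLpNorm_enorm]
    exact eLpNorm_mono_enn nv₀
  have hfin : ∀ᵐ x, h x < ∞ := by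
    have h2 : ∫⁻ x, h x ^ 2 ≠ ∞ := by rw [← eLpNorm_two_sq]; exact ENNReal.pow_ne_top hh.ne
    filter_upwards [ae_lt_top (mh.pow_const 2) h2] with x hx
    exact lt_of_not_ge fun hx' => by rw [top_le_iff.1 hx'] at hx; simp at hx
  have hinner : ⟪hmem.toLp v₀, w⟫ = ((∫ x, (h x).toReal * ‖w x‖ : ℝ) : ℂ) := by
    rw [L2.inner_def, ← integral_complex_ofReal]
    refine integral_congr_ae ?_
    filter_upwards [hmem.coeFn_toLp] with x hx
    rw [hx, RCLike.inner_apply, hv₀]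
    simp only [map_mul, map_div₀, Complex.conj_ofReal]
    rcases eq_or_ne (w x) 0 with h0 | h0
    · simp [h0]
    · have h1 : ((‖w x‖ : ℝ) : ℂ) ≠ 0 := by simpa using h0
      have h2 := Complex.mul_conj' (w x)
      push_cast
      field_simp
      linear_combination ((h x).toReal : ℂ) * h2
  have hi : Integrable fun x => (h x).toReal * ‖w x‖ := by
    have := (L2.integrable_inner (𝕜 := ℂ) (hmem.toLp v₀) w).norm
    refine this.congr ?_
    filter_upwards [hmem.coeFn_toLp] with x hx
    rw [hx, RCLike.inner_apply, hv₀, norm_mul, RCLike.norm_conj, norm_mul, norm_div, Complex.norm_real,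
      Complex.norm_real, norm_norm, Real.norm_eq_abs, abs_of_nonneg ENNReal.toReal_nonneg]
    rcases eq_or_ne (w x) 0 with h0 | h0
    · simp [h0]
    · rw [div_self (norm_ne_zero_iff.2 h0)]; ring
  have heq : ∫⁻ x, h x * ‖w x‖ₑ = ‖⟪hmem.toLp v₀, w⟫‖ₑ := by
    rw [hinner, ← ofReal_norm, Complex.norm_real, Real.norm_eq_abs,
      abs_of_nonneg (integral_nonneg fun x => mul_nonneg ENNReal.toReal_nonneg (norm_nonneg _)),
      ofReal_integral_eq_lintegral_ofReal hi (Eventually.of_forall fun x =>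
        mul_nonneg ENNReal.toReal_nonneg (norm_nonneg _))]
    refine lintegral_congr_ae ?_
    filter_upwards [hfin] with x hx
    rw [ENNReal.ofReal_mul ENNReal.toReal_nonneg, ENNReal.ofReal_toReal hx.ne, ofReal_norm]
  rw [heq]
  refine (hL2 _).trans ?_
  gcongr
  have hle : (fun x => ‖hmem.toLp v₀ x‖ₑ) ≤ᵐ[volume] h := by
    filter_upwards [hmem.coeFn_toLp] with x hx
    simp only [hx]
    exact nv₀ x
  have hcle := convMeasure_mono_ae ρ (measurable_enorm_L2 _) mh hle
  have hae : convMeasure ρ (fun x => ‖hmem.toLp v₀ x‖ₑ) =ᵐ[volume]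
      fun x => min (convMeasure ρ (fun x => ‖hmem.toLp v₀ x‖ₑ) x) (convMeasure ρ h x) := by
    filter_upwards [hcle] with x hx using (min_eq_left hx).symm
  rw [majorant_congr_ae hae (EventuallyEq.refl _ _) (EventuallyEq.refl _ _) (EventuallyEq.refl _ _)]
  exact majorant_mono (fun x => min_le_right _ _) le_rfl le_rfl le_rfl

section Profile

variable {d₀ : ℝ → ℝ} {L dav ω : ℝ} {f : L2}

/-- For a given `v`, solving `(ω - dav ∂²) g = v` turns the weak equation into `⟨v, f⟩ = 𝒬(g, f, f,
f)`. The space bound and the resolvent kernel then give the self-estimate. -/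
theorem IsWeakSolution.exists_decay (hL : 0 < L) (hd₀ : PiecewiseW11 d₀ L)
    (hd₀' : BoundedAwayFromZero d₀ L) (hdav : 0 ≤ dav) (hω : 0 < ω)
    (hf : IsWeakSolution d₀ L dav ω f) : ∃ μ : ℝ, 0 < μ ∧
      eLpNorm (fun x => ENNReal.ofReal (Real.exp (μ * |x|)) * ‖f x‖ₑ) 2 < ∞ := by
  obtain ⟨C, hC, hb⟩ := exists_enorm_calQ_le hL hd₀ hd₀'
  obtain ⟨ρ, _, μ₀, hμ₀, hρ, hker⟩ := exists_resolvent_kernel hdav hω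
  refine exists_exponential_decay_of_schwartz f ρ hμ₀ hρ hC fun v => ?_
  obtain ⟨g, hg, -⟩ := exists_resolvent hdav hω v
  rw [← hg, ← hf.calQ_eq hdav g, hg]
  refine ((hb g f).1).trans ?_
  gcongr
  exact majorant_mono (hker g v hg) le_rfl le_rfl le_rfl

/-- The same argument after Plancherel. In frequency the resolvent is a multiplier bounded by `ω⁻¹`,
so the convolution measure is a point mass for every `dav`. -/
theorem IsWeakSolution.exists_fourier_decay (hL : 0 < L) (hd₀ : PiecewiseW11 d₀ L)
    (hd₀' : BoundedAwayFromZero d₀ L) (hdav : 0 ≤ dav) (hω : 0 < ω)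
    (hf : IsWeakSolution d₀ L dav ω f) : ∃ μ : ℝ, 0 < μ ∧
      eLpNorm (fun x => ENNReal.ofReal (Real.exp (μ * |x|)) * ‖(𝓕 f : L2) x‖ₑ) 2 < ∞ := by
  obtain ⟨C, hC, hb⟩ := exists_enorm_calQ_le hL hd₀ hd₀'
  refine exists_exponential_decay_of_schwartz (𝓕 f) (ENNReal.ofReal ω⁻¹ • Measure.dirac 0) one_pos ?_
    hC fun v => ?_
  · rw [lintegral_smul_measure, lintegral_dirac]
    simp
  obtain ⟨g, hg, hgb⟩ := exists_resolvent hdav hω (𝓕⁻ v)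
  have e1 : ⟪v.toLp 2, (𝓕 f : L2)⟫ = calQ d₀ L (g.toLp 2) f f f := by
    rw [hf.calQ_eq hdav g, hg, ← Lp.inner_fourier_eq ((𝓕⁻ v : 𝓢(ℝ, ℂ)).toLp 2 volume) f,
      SchwartzMap.toLp_fourier_eq,
      FourierTransform.fourier_fourierInv_eq]
  rw [e1]
  refine ((hb g f).2).trans ?_
  gcongr
  refine majorant_mono (fun x => ?_) le_rfl le_rfl le_rfl
  have h := ENNReal.ofReal_le_ofReal (hgb x)
  rw [FourierTransform.fourier_fourierInv_eq, ENNReal.ofReal_mul (by positivity), ofReal_norm,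
    ofReal_norm] at h
  rwa [convMeasure, lintegral_smul_measure, lintegral_dirac, sub_zero]

end Profile

/-! ### Exponential decay and analyticity -/

section Analytic

variable {w : L2} {μ : ℝ}

/-- Cauchy–Schwarz against `e^{-(μ-ν)|x|}`, which is square integrable. -/
theorem integrable_exp_mul_of_decay
    (hw : eLpNorm (fun x => ENNReal.ofReal (Real.exp (μ * |x|)) * ‖w x‖ₑ) 2 < ∞) {ν : ℝ} (hν : ν < μ) :
    Integrable fun x => Real.exp (ν * |x|) * ‖w x‖ := by
  have mw : Measurable fun x => w x := (Lp.stronglyMeasurable w).measurable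
  have h1 : MemLp (fun x => Real.exp (μ * |x|) * ‖w x‖) 2 volume := by
    refine ⟨(by fun_prop : Measurable _).aestronglyMeasurable, ?_⟩
    rw [← eLpNorm_enorm]
    refine lt_of_le_of_lt (le_of_eq ?_) hw
    congr 1
    ext x
    rw [enorm_mul, enorm_norm, ← ofReal_norm, Real.norm_eq_abs, abs_of_pos (Real.exp_pos _)]
  have h2 : MemLp (fun x : ℝ => Real.exp (-(μ - ν) * |x|)) 2 volume := by
    rw [memLp_two_iff_integrable_sq (by fun_prop : Continuous _).aestronglyMeasurable]
    have h3 : IntegrableOn (fun x : ℝ => Real.exp (-(2 * (μ - ν)) * x)) (Ioi 0) :=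
      exp_neg_integrableOn_Ioi 0 (by linarith)
    refine (integrable_comp_abs h3).congr (Eventually.of_forall fun x => ?_)
    simp only
    rw [← Real.exp_nat_mul]
    congr 1
    push_cast; ring
  refine (h1.integrable_mul h2).congr (Eventually.of_forall fun x => ?_)
  simp only [Pi.mul_apply]
  have : Real.exp (ν * |x|) = Real.exp (μ * |x|) * Real.exp (-(μ - ν) * |x|) := by
    rw [← Real.exp_add]; congr 1; ring
  rw [this]; ring

theorem norm_exp_I_mul_complex (τ k : ℝ) (z : ℂ) :
    ‖Complex.exp (Complex.I * (τ * k : ℝ) * z)‖ = Real.exp (-(τ * k) * z.im) := by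
  rw [Complex.norm_exp]
  congr 1
  simp

theorem analyticOnNhd_integral_exp (hμ : 0 < μ)
    (hw : eLpNorm (fun x => ENNReal.ofReal (Real.exp (μ * |x|)) * ‖w x‖ₑ) 2 < ∞) {τ : ℝ} (hτ : τ ≠ 0) :
    AnalyticOnNhd ℂ (fun z : ℂ => ∫ k, Complex.exp (Complex.I * (τ * k : ℝ) * z) * w k)
      {z : ℂ | |z.im| < μ / (4 * |τ|)} := by
  have hτ' : 0 < |τ| := abs_pos.2 hτ
  set r : ℝ := μ / (4 * |τ|) with hr
  have hr0 : 0 < r := by positivity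
  have hopen : IsOpen {z : ℂ | |z.im| < r} :=
    isOpen_lt (continuous_abs.comp Complex.continuous_im) continuous_const
  have mw : Measurable fun x => w x := (Lp.stronglyMeasurable w).measurable
  have hexp : ∀ (k : ℝ) (z : ℂ), |z.im| ≤ 2 * r →
      ‖Complex.exp (Complex.I * (τ * k : ℝ) * z)‖ ≤ Real.exp (μ / 2 * |k|) := fun k z hz => by
    rw [norm_exp_I_mul_complex, Real.exp_le_exp]
    calc -(τ * k) * z.im ≤ |-(τ * k) * z.im| := le_abs_self _
      _ = |τ| * |k| * |z.im| := by rw [abs_mul, abs_neg, abs_mul]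
      _ ≤ |τ| * |k| * (2 * r) := by gcongr
      _ = μ / 2 * |k| := by rw [hr]; field_simp; ring
  refine DifferentiableOn.analyticOnNhd (fun z₀ hz₀ => ?_) hopen
  refine DifferentiableAt.differentiableWithinAt ?_
  have hz₀' : |z₀.im| < r := hz₀
  have hball : ∀ z ∈ Metric.ball z₀ r, |z.im| ≤ 2 * r := fun z hz => by
    have h1 : |(z - z₀).im| ≤ ‖z - z₀‖ := Complex.abs_im_le_norm _
    rw [Metric.mem_ball, dist_eq_norm] at hz
    rw [Complex.sub_im] at h1
    have h2 : |z.im| ≤ |z.im - z₀.im| + |z₀.im| := by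
      simpa using abs_add_le (z.im - z₀.im) z₀.im
    linarith
  -- On discs of radius `r` in the strip the exponential costs `e^{μ|k|/2}`, and the factor `k` from
  -- differentiation costs another `e^{μ|k|/4}`; the total `3μ/4` is below `μ`.
  have i34 := integrable_exp_mul_of_decay hw (ν := 3 * μ / 4) (by linarith)
  refine (hasDerivAt_integral_of_dominated_loc_of_deriv_le (μ := volume)
    (F := fun (z : ℂ) (k : ℝ) => Complex.exp (Complex.I * (τ * k : ℝ) * z) * w k)
    (F' := fun (z : ℂ) (k : ℝ) =>
      Complex.I * (τ * k : ℝ) * (Complex.exp (Complex.I * (τ * k : ℝ) * z) * w k))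
    (bound := fun k => |τ| * (4 / μ) * (Real.exp (3 * μ / 4 * |k|) * ‖w k‖))
    (Metric.ball_mem_nhds z₀ hr0) (Eventually.of_forall fun z => ?_) ?_ ?_
    (Eventually.of_forall fun k z hz => ?_) (i34.const_mul _)
    (Eventually.of_forall fun k z _ => ?_)).2.differentiableAt
  · exact (by fun_prop : Measurable _).aestronglyMeasurable
  · refine (integrable_exp_mul_of_decay hw (ν := μ / 2) (by linarith)).mono'
      (by fun_prop : Measurable _).aestronglyMeasurable (Eventually.of_forall fun k => ?_)
    rw [norm_mul]
    gcongr
    exact hexp k z₀ (by linarith)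
  · exact (by fun_prop : Measurable _).aestronglyMeasurable
  · rw [norm_mul, norm_mul, norm_mul, Complex.norm_I, one_mul, Complex.norm_real, Real.norm_eq_abs,
      abs_mul]
    have h1 : |k| ≤ 4 / μ * Real.exp (μ / 4 * |k|) := by
      have := Real.add_one_le_exp (μ / 4 * |k|)
      rw [div_mul_eq_mul_div, le_div_iff₀ hμ]
      linarith
    calc |τ| * |k| * (‖Complex.exp (Complex.I * (τ * k : ℝ) * z)‖ * ‖w k‖)
        ≤ |τ| * (4 / μ * Real.exp (μ / 4 * |k|)) * (Real.exp (μ / 2 * |k|) * ‖w k‖) := by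
          gcongr
          exact hexp k z (hball z hz)
      _ = |τ| * (4 / μ) * (Real.exp (μ / 4 * |k| + μ / 2 * |k|) * ‖w k‖) := by
          rw [Real.exp_add]; ring
      _ = _ := by
          congr 3
          ring
  · have h1 : HasDerivAt (fun z : ℂ => Complex.I * (τ * k : ℝ) * z) (Complex.I * (τ * k : ℝ)) z := by
      simpa using (hasDerivAt_id' z).const_mul (Complex.I * ((τ * k : ℝ) : ℂ))
    refine (h1.cexp.mul_const (w k)).congr_deriv ?_
    ring

/-- The hypothesis says that `u` is the transform of `w` as a distribution. Fubini turns it into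
equality of the integrals of `u` and of a continuous function against every test function. -/
theorem ae_eq_integral_exp {u : L2} (hw : Integrable fun x => w x) (τ : ℝ)
    (h : ∀ φ : 𝓢(ℝ, ℂ), ∫ x, φ x * u x =
      ∫ k : ℝ, (∫ x : ℝ, Complex.exp (Complex.I * (τ * k : ℝ) * (x : ℂ)) * φ x) * w k) :
    ∀ᵐ x : ℝ, u x = ∫ k, Complex.exp (Complex.I * (τ * k : ℝ) * (x : ℂ)) * w k := by
  have mw : Measurable fun x => w x := (Lp.stronglyMeasurable w).measurable
  have hexp : ∀ k x : ℝ, ‖Complex.exp (Complex.I * (τ * k : ℝ) * (x : ℂ))‖ = 1 := fun k x => by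
    rw [norm_exp_I_mul_complex]; simp
  set G : ℝ → ℂ := fun x => ∫ k, Complex.exp (Complex.I * (τ * k : ℝ) * (x : ℂ)) * w k with hG
  have hGc : Continuous G := by
    refine continuous_of_dominated (bound := fun k => ‖w k‖)
      (fun x => (by fun_prop : Measurable _).aestronglyMeasurable)
      (fun x => Eventually.of_forall fun k => ?_) hw.norm (Eventually.of_forall fun k => by fun_prop)
    rw [norm_mul, hexp, one_mul]
  refine ae_eq_of_integral_contDiff_smul_eq
    ((Lp.memLp u).locallyIntegrable (by norm_num)) hGc.locallyIntegrable fun g hg hgc => ?_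
  have hgc' : HasCompactSupport fun x => (g x : ℂ) := hgc.comp_left Complex.ofReal_zero
  have hg' : ContDiff ℝ (⊤ : ℕ∞) fun x => (g x : ℂ) := Complex.ofRealCLM.contDiff.comp hg
  set φ : 𝓢(ℝ, ℂ) := hgc'.toSchwartzMap hg' with hφ
  have hφx : ∀ x, φ x = g x := fun x => rfl
  have h1 := h φ
  simp only [hφx] at h1
  simp only [Complex.real_smul]
  rw [h1]
  have iφ : Integrable fun x => (g x : ℂ) := φ.integrable
  have hprod : Integrable (Function.uncurry fun (k x : ℝ) =>
      Complex.exp (Complex.I * (τ * k : ℝ) * (x : ℂ)) * g x * w k) (volume.prod volume) := by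
    have h2 := hw.mul_prod iφ
    refine (h2.bdd_mul (f := fun z : ℝ × ℝ => Complex.exp (Complex.I * (τ * z.1 : ℝ) * (z.2 : ℂ))) (c := 1)
      (by fun_prop : Measurable _).aestronglyMeasurable
      (Eventually.of_forall fun z => (hexp _ _).le)).congr (Eventually.of_forall fun z => ?_)
    simp only [Function.uncurry]
    ring
  simp only [← integral_mul_const]
  rw [integral_integral_swap hprod]
  refine integral_congr_ae (Eventually.of_forall fun x => ?_)
  simp only [← integral_const_mul]
  refine integral_congr_ae (Eventually.of_forall fun k => ?_)
  simp only
  ring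

end Analytic

theorem AnalyticInStrip.mono {u : ℝ → ℂ} {μ ν : ℝ} (h : AnalyticInStrip u μ) (hν : ν ≤ μ) :
    AnalyticInStrip u ν := by
  obtain ⟨F, hF, hu⟩ := h
  exact ⟨F, hF.mono fun z hz => lt_of_lt_of_le hz hν, hu⟩

theorem analyticInStrip_of_fourier_decay {f : L2} {μ : ℝ} (hμ : 0 < μ)
    (hw : eLpNorm (fun x => ENNReal.ofReal (Real.exp (μ * |x|)) * ‖(𝓕 f : L2) x‖ₑ) 2 < ∞) :
    AnalyticInStrip f (μ / (4 * |2 * Real.pi|)) := by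
  have hτ : 2 * Real.pi ≠ 0 := by have := Real.pi_pos; positivity
  refine ⟨_, analyticOnNhd_integral_exp hμ hw hτ, ?_⟩
  have hi : Integrable fun x => (𝓕 f : L2) x := by
    have := integrable_exp_mul_of_decay hw hμ
    simp only [zero_mul, Real.exp_zero, one_mul] at this
    exact (integrable_norm_iff (Lp.aestronglyMeasurable _)).1 this
  refine ae_eq_integral_exp hi _ fun φ => ?_
  have h1 := DFunLike.congr_fun (Lp.fourierInv_toTemperedDistribution_eq (𝓕 f : L2)) φ
  rw [FourierTransform.fourierInv_fourier_eq, TemperedDistribution.fourierInv_apply,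
    Lp.toTemperedDistribution_apply, Lp.toTemperedDistribution_apply] at h1
  simp only [smul_eq_mul] at h1
  rw [← h1]
  refine integral_congr_ae (Eventually.of_forall fun k => ?_)
  simp only [SchwartzMap.fourierInv_coe, Real.fourierInv_eq']
  congr 1
  refine integral_congr_ae (Eventually.of_forall fun x => ?_)
  simp only [smul_eq_mul, RCLike.inner_apply, conj_trivial]
  congr 2
  push_cast; ring

theorem analyticInStrip_fourierHat_of_decay {f : L2} {μ : ℝ} (hμ : 0 < μ)
    (hw : eLpNorm (fun x => ENNReal.ofReal (Real.exp (μ * |x|)) * ‖f x‖ₑ) 2 < ∞) :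
    AnalyticInStrip (fourierHat f) (μ / 4) := by
  have hπ := Real.pi_pos
  have hτ : -(2 * Real.pi) ≠ 0 := by simp [hπ.ne']
  have hi : Integrable fun x => f x := by
    have := integrable_exp_mul_of_decay hw hμ
    simp only [zero_mul, Real.exp_zero, one_mul] at this
    exact (integrable_norm_iff (Lp.aestronglyMeasurable _)).1 this
  have hae : ∀ᵐ y : ℝ, (𝓕 f : L2) y =
      ∫ k, Complex.exp (Complex.I * (-(2 * Real.pi) * k : ℝ) * (y : ℂ)) * f k := by
    refine ae_eq_integral_exp hi _ fun φ => ?_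
    have h1 := DFunLike.congr_fun (Lp.fourier_toTemperedDistribution_eq f) φ
    rw [TemperedDistribution.fourier_apply,
      Lp.toTemperedDistribution_apply, Lp.toTemperedDistribution_apply] at h1
    simp only [smul_eq_mul] at h1
    rw [← h1]
    refine integral_congr_ae (Eventually.of_forall fun k => ?_)
    simp only [SchwartzMap.fourier_coe, Real.fourier_eq']
    congr 1
    refine integral_congr_ae (Eventually.of_forall fun x => ?_)
    simp only [smul_eq_mul, RCLike.inner_apply, conj_trivial]
    congr 2
    push_cast; ring
  set F : ℂ → ℂ := fun z => ∫ k, Complex.exp (Complex.I * (-(2 * Real.pi) * k : ℝ) * z) * f k with hF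
  have hFa := analyticOnNhd_integral_exp hμ hw hτ
  refine ⟨fun z => ((√(2 * Real.pi) : ℝ) : ℂ)⁻¹ * F (z * ((-(2 * Real.pi)⁻¹ : ℝ) : ℂ)), ?_, ?_⟩
  · refine analyticOnNhd_const.mul (hFa.comp (analyticOnNhd_id.mul analyticOnNhd_const) ?_)
    intro z hz
    have hz' : |z.im| < μ / 4 := hz
    change |(z * ((-(2 * Real.pi)⁻¹ : ℝ) : ℂ)).im| < μ / (4 * |-(2 * Real.pi)|)
    rw [Complex.im_mul_ofReal, abs_mul, abs_neg, abs_neg, abs_of_pos (by positivity : 0 < 2 * Real.pi),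
      abs_of_pos (by positivity : 0 < (2 * Real.pi)⁻¹), ← div_div, ← div_eq_mul_inv]
    gcongr
  -- The formula for `𝓕 f` holds off a null set, and null sets survive the dilation by `-1/(2π)`.
  · have hq : Measure.QuasiMeasurePreserving (fun k : ℝ => -(2 * Real.pi)⁻¹ * k) volume volume := by
      refine ⟨by fun_prop, ?_⟩
      rw [Real.map_volume_mul_left (by simp [hπ.ne'])]
      exact Measure.smul_absolutelyContinuous
    filter_upwards [hq.ae hae] with k hk
    have e1 : -k / (2 * Real.pi) = -(2 * Real.pi)⁻¹ * k := by ring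
    rw [fourierHat, e1, hk]
    simp only [hF]
    congr 3
    ext x
    push_cast
    congr 2
    ring

end

end DispersionManagement

theorem mainTheorem2 (L : ℝ) (hL : 0 < L) (d₀ : ℝ → ℝ)
    (hd₀ : DispersionManagement.PiecewiseW11 d₀ L)
    (hd₀' : DispersionManagement.BoundedAwayFromZero d₀ L)
    (dav : ℝ) (hdav : 0 ≤ dav) (ω : ℝ) (hω : 0 < ω)
    (f : DispersionManagement.L2)
    (hf : DispersionManagement.IsWeakSolution d₀ L dav ω f) :
    ∃ μ : ℝ, 0 < μ ∧
      DispersionManagement.AnalyticInStrip f μ ∧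
      DispersionManagement.AnalyticInStrip (DispersionManagement.fourierHat f) μ := by
  obtain ⟨μ₁, hμ₁, h₁⟩ := hf.exists_fourier_decay hL hd₀ hd₀' hdav hω
  obtain ⟨μ₂, hμ₂, h₂⟩ := hf.exists_decay hL hd₀ hd₀' hdav hω
  have hπ := Real.pi_pos
  exact ⟨min (μ₁ / (4 * |2 * Real.pi|)) (μ₂ / 4), lt_min (by positivity) (by positivity),
    (DispersionManagement.analyticInStrip_of_fourier_decay hμ₁ h₁).mono (min_le_left _ _),
    (DispersionManagement.analyticInStrip_fourierHat_of_decay hμ₂ h₂).mono (min_le_right _ _)⟩
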